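/- Let $m,n\ge 0$ and fix integer sequences $\mathbf I=\{0=i_0<\dots<i_r=m\}$ and $\mathbf J=\{0=j_0<\dots<j_s=n\}$. **Graphs.** A pre-crystal graph is a simple directed graph with countably many vertices and labelled edges in which every vertex has a weight in $\mathbb Z_{\ge0}^t$ ($t$ fixed). A homomorphism is a weight-preserving map of vertices that preserves edges and their labels; an isomorphism is an invertible homomorphism whose inverse is a homomorphism. A homomorphism $f:\mathcal G\to\mathcal H$ is a local isomorphism if its restriction to each connected component of $\mathcal G$ is an isomorphism onto a connected component of $\mathcal H$. The direct sum $\oplus$ is the disjoint union. The Cartesian product $\mathcal G\,\square\,\mathcal H$ has vertices $(g,h)$, concatenated weights, and edges $(g,h)\to(g',h)$ for $g\to g'$ and $(g,h)\to(g,h')$ for $h\to h'$, labelled by the disjoint union of the label sets. **Words and tableaux.** For a word $w$ and an integer $i$, read each letter $i$ as "$)$" and each letter $i+1$ as "$($"; $f_i(w)$ is obtained by changing the letter $i$ at the rightmost unmatched "$)$" to $i+1$ ($f_i(w)=\varnothing$ if there is none). The graph $\mathcal W_{[a,b]}$ has as vertices the words on the alphabet $[a,b]$, with weight $(\#a,\dots,\#b)$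 and an edge $w\xrightarrow{i}f_i(w)$ for $a\le i<b$ whenever $f_i(w)\ne\varnothing$. For a semistandard tableau $T$, $\mathrm{word}(T)$ reads the columns from left to right, each from bottom to top. $\mathcal B_{\lambda,[a,b]}$ is the subgraph of $\mathcal W_{[a,b]}$ induced on the words $\mathrm{word}(T)$, $T\in \mathrm{SSYT}(\lambda,[a,b])$; its vertices are identified with the tableaux $T$. Knuth equivalence $\sim_K$ is generated by $yzx\leftrightarrow yxz$ ($x<y\le z$) and $zxy\leftrightarrow xzy$ ($x\le y<z$) on consecutive letters. For a tuple $\underline\lambda=(\lambda^{(1)},\dots,\lambda^{(r)})$ of partitions, where $\lambda^{(k)}$ has at most $i_k-i_{k-1}$ rows, put $\mathcal B_{\underline\lambda,m}=\mathcal B_{\lambda^{(1)},[i_0+1,i_1]}\,\square\cdots\square\,\mathcal B_{\lambda^{(r)},[i_{r-1}+1,i_r]}$; similarly $\mathcal B_{\underline\mu,n}$, using $\mathbf J$. **Matrices.** For $M\in\mathrm{Mat}_{m,n}(\mathbb Z_{\ge0})$, $\mathrm{row}(M)$ records $m_{ij}$ copies of $i$ for each entry, reading down the columns, from left to right; $\mathrm{col}(M)$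 records $m_{ij}$ copies of $j$, reading along the rows, from top to bottom. If the letter of $\mathrm{row}(M)$ changed by $f_i$ ($1\le i<m$) comes from the entry in position $(i,a)$, then $f_i^{\mathrm{row}}(M)$ is obtained from $M$ by subtracting $1$ from $m_{i,a}$ and adding $1$ to $m_{i+1,a}$; $f_j^{\mathrm{col}}$ ($1\le j<n$) is defined analogously with $\mathrm{col}(M)$ (that is, through transposes). The graph $\mathcal M^{\mathbf I|\mathbf J}_{m,n}$ has vertices $\mathrm{Mat}_{m,n}(\mathbb Z_{\ge0})$, weight of $M$ the letter counts of $\mathrm{row}(M)$ followed by those of $\mathrm{col}(M)$, and edges $M\xrightarrow{i^{\mathrm{row}}}f_i^{\mathrm{row}}(M)$ for $i\notin\mathbf I$ and $M\xrightarrow{j^{\mathrm{col}}}f_j^{\mathrm{col}}(M)$ for $j\notin\mathbf J$ whenever defined. Edges of $\mathcal B_{\underline\lambda,m}$ and $\mathcal B_{\underline\mu,n}$ labelled $i$ and $j$ carry the labels $i^{\mathrm{row}}$ and $j^{\mathrm{col}}$ in $\mathcal B_{\underline\lambda,m}\,\square\,\mathcal B_{\underline\mu,n}$. **Filtered RSK.**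 $\mathrm{filterRSK}_{\mathbf I|\mathbf J}(M)=(P^{(1)},\dots,P^{(r)}\,|\,Q^{(1)},\dots,Q^{(s)})$, where $P^{(a)}$, $Q^{(b)}$ are the unique semistandard tableaux such that $\mathrm{word}(P^{(a)})$ is Knuth equivalent to the subword of $\mathrm{row}(M)$ of the letters in $[i_{a-1}+1,i_a]$, and $\mathrm{word}(Q^{(b)})$ to the subword of $\mathrm{col}(M)$ of the letters in $[j_{b-1}+1,j_b]$. **Statement.** The map $\mathrm{filterRSK}_{\mathbf I|\mathbf J}$ is well defined, takes its values in the vertices of the graph below, and $$\mathrm{filterRSK}_{\mathbf I|\mathbf J}:\ \mathcal M^{\mathbf I|\mathbf J}_{m,n}\longrightarrow\bigoplus_{\underline\lambda,\underline\mu}\left(\mathcal B_{\underline\lambda,m}\,\square\,\mathcal B_{\underline\mu,n}\right)$$ is a local isomorphism of pre-crystal graphs. Moreover, every connected component $\mathcal G$ of $\mathcal M^{\mathbf I|\mathbf J}_{m,n}$ has a unique source $M$ (a vertex in which no edge ends, i.e. a vertex of highest weight), and there are partition-tuples $\underline\lambda,\underline\mu$ such that $\mathrm{filterRSK}_{\mathbf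 I|\mathbf J}(M)=(T_{\underline\lambda}|T_{\underline\mu})$ and $\mathcal G\cong\mathcal B_{\underline\lambda,m}\,\square\,\mathcal B_{\underline\mu,n}$. Here $T_{\underline\lambda}^{(k)}$ is the tableau of shape $\lambda^{(k)}$ with constant value $i_{k-1}+x$ on row $x=1,2,\dots$, and $T_{\underline\mu}^{(k)}$ is the tableau of shape $\mu^{(k)}$ with constant value $j_{k-1}+x$ on row $x$. -/

import Mathlib

namespace FilteredRSK

/-! ### Pre-crystal graphs -/

/-- A pre-crystal graph with edge labels in `L`: a simple directed graph with countably many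
vertices, labelled edges, and a weight in `ℕ ^ rank` (written as a list of length `rank`) on every
vertex. -/
structure PreCrystalGraph (L : Type) where
  /-- the vertices -/
  V : Type
  /-- the length of the weights -/
  rank : ℕ
  /-- the weight of a vertex -/
  cwt : V → List ℕ
  length_cwt : ∀ v, (cwt v).length = rank
  /-- `edge l v v'` says that there is an edge labelled `l` from `v` to `v'` -/
  edge : L → V → V → Prop
  countable : Countable V
  loopless : ∀ l v, ¬ edge l v v
  simple : ∀ l l' v v', edge l v v' → edge l' v v' → l = l'

namespace PreCrystalGraph

variable {L L' : Type}

/-- Pre-crystal graph homomorphisms. -/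
structure IsHom (G H : PreCrystalGraph L) (f : G.V → H.V) : Prop where
  cwt_eq : ∀ v, G.cwt v = H.cwt (f v)
  map_edge : ∀ l v v', G.edge l v v' → H.edge l (f v) (f v')

/-- Pre-crystal graph isomorphisms. -/
structure Iso (G H : PreCrystalGraph L) where
  /-- the bijection on vertices -/
  toEquiv : G.V ≃ H.V
  isHom : IsHom G H toEquiv
  isHom_symm : IsHom H G toEquiv.symm

/-- The graph obtained by renaming the vertices of an induced subgraph. -/
def comap (G : PreCrystalGraph L) {V' : Type} (f : V' → G.V) (hf : Function.Injective f) :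
    PreCrystalGraph L where
  V := V'
  rank := G.rank
  cwt v := G.cwt (f v)
  length_cwt v := G.length_cwt (f v)
  edge l v v' := G.edge l (f v) (f v')
  countable := by
    have := G.countable
    exact hf.countable
  loopless l v := G.loopless l (f v)
  simple l l' v v' := G.simple l l' (f v) (f v')

/-- The induced subgraph on a set of vertices. -/
def induce (G : PreCrystalGraph L) (C : Set G.V) : PreCrystalGraph L :=
  G.comap (V' := C) Subtype.val Subtype.val_injective

/-- The subgraph obtained by deleting all edges with labels in `S`. -/
def deleteLabels (G : PreCrystalGraph L) (S : Set L) : PreCrystalGraph L where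
  V := G.V
  rank := G.rank
  cwt := G.cwt
  length_cwt := G.length_cwt
  edge l v v' := l ∉ S ∧ G.edge l v v'
  countable := G.countable
  loopless l v h := G.loopless l v h.2
  simple l l' v v' h h' := G.simple l l' v v' h.2 h'.2

/-- Renaming of the edge labels. -/
def relabel (G : PreCrystalGraph L) (g : L → L') : PreCrystalGraph L' where
  V := G.V
  rank := G.rank
  cwt := G.cwt
  length_cwt := G.length_cwt
  edge l v v' := ∃ k, g k = l ∧ G.edge k v v'
  countable := G.countable
  loopless := by
    rintro l v ⟨k, -, h⟩
    exact G.loopless k v h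
  simple := by
    rintro l l' v v' ⟨k, rfl, h⟩ ⟨k', rfl, h'⟩
    rw [G.simple k k' v v' h h']

/-- The Cartesian product of two pre-crystal graphs. -/
def box (G : PreCrystalGraph L) (H : PreCrystalGraph L') : PreCrystalGraph (L ⊕ L') where
  V := G.V × H.V
  rank := G.rank + H.rank
  cwt v := G.cwt v.1 ++ H.cwt v.2
  length_cwt v := by simp [G.length_cwt, H.length_cwt]
  edge l v v' := match l with
    | Sum.inl i => G.edge i v.1 v'.1 ∧ v.2 = v'.2
    | Sum.inr j => v.1 = v'.1 ∧ H.edge j v.2 v'.2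
  countable := by
    have := G.countable
    have := H.countable
    infer_instance
  loopless := by
    rintro (i | j) v h
    · exact G.loopless _ _ h.1
    · exact H.loopless _ _ h.2
  simple := by
    rintro (i | j) (i' | j') v v' h h'
    · rw [G.simple _ _ _ _ h.1 h'.1]
    · exact absurd (h'.1 ▸ h.1) (G.loopless _ _)
    · exact absurd (h.1 ▸ h'.1) (G.loopless _ _)
    · rw [H.simple _ _ _ _ h.2 h'.2]

/-- The Cartesian product of a finite sequence of pre-crystal graphs. The edge labels are the
disjoint union of the edge labels of the factors. -/
def boxPi {r : ℕ} {K : Fin r → Type} (G : (k : Fin r) → PreCrystalGraph (K k)) :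
    PreCrystalGraph ((k : Fin r) × K k) where
  V := (k : Fin r) → (G k).V
  rank := ∑ k, (G k).rank
  cwt v := (List.ofFn fun k => (G k).cwt (v k)).flatten
  length_cwt v := by
    simp [List.length_flatten, List.map_ofFn, List.sum_ofFn, (G _).length_cwt]
  edge l v v' := (G l.1).edge l.2 (v l.1) (v' l.1) ∧ ∀ k, k ≠ l.1 → v k = v' k
  countable := by
    have := fun k => (G k).countable
    infer_instance
  loopless l v h := (G l.1).loopless _ _ h.1
  simple := by
    rintro ⟨k, l⟩ ⟨k', l'⟩ v v' ⟨h, hv⟩ ⟨h', hv'⟩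
    by_cases hk : k = k'
    · subst hk
      exact congrArg (Sigma.mk k) ((G k).simple l l' _ _ h h')
    · have := hv' k hk
      simp only at h
      rw [← this] at h
      exact absurd h ((G k).loopless _ _)

/-- The direct sum (disjoint union) of a countable family of pre-crystal graphs with weights of the
same length. -/
def directSum {ι : Type} [Countable ι] (G : ι → PreCrystalGraph L) (rank : ℕ)
    (hrank : ∀ x, (G x).rank = rank) : PreCrystalGraph L where
  V := (x : ι) × (G x).V
  rank := rank
  cwt v := (G v.1).cwt v.2
  length_cwt v := by rw [(G v.1).length_cwt, hrank]
  edge l v v' := ∃ (x : ι) (u u' : (G x).V), v = ⟨x, u⟩ ∧ v' = ⟨x, u'⟩ ∧ (G x).edge l u u'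
  countable := by
    have := fun x => (G x).countable
    infer_instance
  loopless := by
    rintro l v ⟨x, u, u', rfl, h, hl⟩
    cases h
    exact (G x).loopless _ _ hl
  simple := by
    rintro l l' v v' ⟨x, u, u', rfl, rfl, h⟩ ⟨y, w, w', h1, h2, h'⟩
    cases h1
    cases h2
    exact (G x).simple _ _ _ _ h h'

/-- Two vertices are joined by an undirected path. -/
def Joined (G : PreCrystalGraph L) : G.V → G.V → Prop :=
  Relation.EqvGen fun v v' => ∃ l, G.edge l v v'

/-- `C` is the vertex set of a connected component. -/
def IsComponent (G : PreCrystalGraph L) (C : Set G.V) : Prop :=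
  ∃ v, C = {w | G.Joined v w}

/-- A vertex is a source (a vertex of highest weight) if no edge ends in it. -/
def IsSource (G : PreCrystalGraph L) (v : G.V) : Prop :=
  ∀ l u, ¬ G.edge l u v

/-- A local isomorphism: a homomorphism whose restriction to every connected component of the
domain is an isomorphism onto a connected component of the codomain. -/
def IsLocalIso (G H : PreCrystalGraph L) (f : G.V → H.V) : Prop :=
  IsHom G H f ∧ ∀ C, G.IsComponent C → ∃ C', H.IsComponent C' ∧
    ∃ e : Iso (G.induce C) (H.induce C'), ∀ v : C, (e.toEquiv v : C').1 = f v.1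

end PreCrystalGraph

/-! ### Words -/

/-- The positions of the unmatched closing parentheses in the bracket word in which a letter `i`
is read as `)`, a letter `i + 1` as `(`, and all other letters are ignored. Here `c` is the number
of opening parentheses still to be matched and `p` is the position of the first letter. -/
def unmatchedClose (i : ℕ) : ℕ → ℕ → List ℕ → List ℕ
  | _, _, [] => []
  | c, p, x :: w =>
    if x = i + 1 then unmatchedClose i (c + 1) (p + 1) w
    else if x = i then
      if c = 0 then p :: unmatchedClose i 0 (p + 1) w
      else unmatchedClose i (c - 1) (p + 1) w
    else unmatchedClose i c (p + 1) w

/-- The position (counted from `0`) of the letter altered by the crystal lowering operator: the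
rightmost unmatched closing parenthesis. -/
def lowerPos (i : ℕ) (w : List ℕ) : Option ℕ :=
  (unmatchedClose i 0 0 w).getLast?

/-- The crystal lowering operator `f_i` on words; `none` is the special symbol `∅`. -/
def lower (i : ℕ) (w : List ℕ) : Option (List ℕ) :=
  (lowerPos i w).map fun p => w.set p (i + 1)

theorem of_mem_unmatchedClose (i : ℕ) (w : List ℕ) : ∀ (c p q : ℕ),
    q ∈ unmatchedClose i c p w → p ≤ q ∧ w[q - p]? = some i := by
  induction w with
  | nil => intro c p q h; simp [unmatchedClose] at h
  | cons x w ih =>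
    intro c p q h
    have key : ∀ c', q ∈ unmatchedClose i c' (p + 1) w →
        p ≤ q ∧ (x :: w)[q - p]? = some i := by
      intro c' h'
      obtain ⟨h1, h2⟩ := ih _ _ _ h'
      refine ⟨by omega, ?_⟩
      rw [show q - p = (q - (p + 1)) + 1 by omega, List.getElem?_cons_succ]
      exact h2
    rw [unmatchedClose] at h
    split_ifs at h with h1 h2 h3
    · exact key _ h
    · rcases List.mem_cons.1 h with h | h
      · subst h
        simp [h2]
      · exact key _ h
    · exact key _ h
    · exact key _ h

theorem getElem?_of_lowerPos {i p : ℕ} {w : List ℕ} (h : lowerPos i w = some p) :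
    w[p]? = some i := by
  have := of_mem_unmatchedClose i w 0 0 p (List.mem_of_getLast? h)
  simpa using this.2

theorem lower_spec {i : ℕ} {w v : List ℕ} (h : lower i w = some v) :
    ∃ p, w[p]? = some i ∧ v = w.set p (i + 1) := by
  obtain ⟨p, hp, rfl⟩ := Option.map_eq_some_iff.1 h
  exact ⟨p, getElem?_of_lowerPos hp, rfl⟩

/-- The word crystal graph on the alphabet `[a, b]`. (Since both ends of an edge are words on
`[a, b]`, all edge labels lie in `[a, b - 1]`.) -/
def wordGraph (a b : ℕ) : PreCrystalGraph ℕ where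
  V := {w : List ℕ // ∀ x ∈ w, a ≤ x ∧ x ≤ b}
  rank := b + 1 - a
  cwt w := (List.range' a (b + 1 - a)).map fun x => w.1.count x
  length_cwt w := by simp
  edge i w v := lower i w.1 = some v.1
  countable := inferInstance
  loopless i w h := by
    obtain ⟨p, hp, h⟩ := lower_spec h
    have hlt : p < w.1.length := (List.getElem?_eq_some_iff.1 hp).1
    have h2 : (w.1.set p (i + 1))[p]? = some (i + 1) := by simp [hlt]
    rw [← h, hp] at h2
    simp at h2
  simple i i' w v h h' := by
    obtain ⟨p, hp, h⟩ := lower_spec h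
    obtain ⟨p', hp', h'⟩ := lower_spec h'
    have hlt : p < w.1.length := (List.getElem?_eq_some_iff.1 hp).1
    have hv : v.1[p]? = some (i + 1) := by rw [h]; simp [hlt]
    by_cases hpp : p' = p
    · subst hpp
      rw [hp] at hp'
      simpa using hp'
    · rw [h', List.getElem?_set_ne hpp, hp] at hv
      simp at hv

/-- The elementary Knuth moves. -/
inductive KnuthMove : List ℕ → List ℕ → Prop
  | left (u v : List ℕ) (x y z : ℕ) (hxy : x < y) (hyz : y ≤ z) :
      KnuthMove (u ++ [y, z, x] ++ v) (u ++ [y, x, z] ++ v)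
  | right (u v : List ℕ) (x y z : ℕ) (hxy : x ≤ y) (hyz : y < z) :
      KnuthMove (u ++ [z, x, y] ++ v) (u ++ [x, z, y] ++ v)

/-- Knuth equivalence of words. -/
def KnuthEquiv : List ℕ → List ℕ → Prop :=
  Relation.EqvGen KnuthMove

/-- The `k`-th component (`k` is counted from `0`) of the `I`-filtration of a word, where
`I = {i 0 < ... < i r}`: the subword of the letters in `[i k + 1, i (k + 1)]`. -/
def filterWord {r : ℕ} (i : Fin (r + 1) → ℕ) (w : List ℕ) (k : Fin r) : List ℕ :=
  w.filter fun x => i k.castSucc + 1 ≤ x ∧ x ≤ i k.succ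

/-! ### Tableaux -/

instance countable_youngDiagram : Countable YoungDiagram :=
  Function.Injective.countable (f := YoungDiagram.cells) fun _ _ h => YoungDiagram.ext h

/-- The cells of a Young diagram: columns from left to right, each from bottom to top. -/
def readingCells (lam : YoungDiagram) : List (ℕ × ℕ) :=
  (List.range (lam.rowLen 0)).flatMap fun y =>
    (List.range (lam.colLen y)).reverse.map fun x => (x, y)

theorem mem_readingCells {lam : YoungDiagram} {x y : ℕ} (h : (x, y) ∈ lam) :
    (x, y) ∈ readingCells lam := by
  simp only [readingCells, List.mem_flatMap, List.mem_map, List.mem_reverse, List.mem_range]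
  refine ⟨y, ?_, x, ?_, rfl⟩
  · exact YoungDiagram.mem_iff_lt_rowLen.1 (lam.up_left_mem (Nat.zero_le x) le_rfl h)
  · exact YoungDiagram.mem_iff_lt_colLen.1 h

/-- The (column) reading word of a tableau. -/
def word {lam : YoungDiagram} (T : SemistandardYoungTableau lam) : List ℕ :=
  (readingCells lam).map fun c => T c.1 c.2

theorem word_injective (lam : YoungDiagram) :
    Function.Injective (word : SemistandardYoungTableau lam → List ℕ) := by
  intro T T' h
  ext x y
  by_cases hc : (x, y) ∈ lam
  · exact List.map_inj_left.1 h (x, y) (mem_readingCells hc)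
  · rw [T.zeros hc, T'.zeros hc]

/-- The set `SSYT(λ, [a, b])`. -/
def SSYT (lam : YoungDiagram) (a b : ℕ) : Type :=
  {T : SemistandardYoungTableau lam // ∀ x y, (x, y) ∈ lam → a ≤ T x y ∧ T x y ≤ b}

/-- The reading word as a vertex of the word crystal graph. -/
def SSYT.wordVertex {lam : YoungDiagram} {a b : ℕ} (T : SSYT lam a b) : (wordGraph a b).V :=
  ⟨word T.1, by
    intro z hz
    simp only [word, readingCells, List.mem_map, List.mem_flatMap, List.mem_reverse,
      List.mem_range] at hz
    obtain ⟨c, ⟨y, -, x, hx, rfl⟩, rfl⟩ := hz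
    exact T.2 x y (YoungDiagram.mem_iff_lt_colLen.2 hx)⟩

theorem SSYT.wordVertex_injective (lam : YoungDiagram) (a b : ℕ) :
    Function.Injective (SSYT.wordVertex : SSYT lam a b → (wordGraph a b).V) := fun _ _ h =>
  Subtype.ext (word_injective lam (congrArg Subtype.val h))

/-- The tableau crystal graph `B_{λ,[a,b]}`: the induced subgraph of the word crystal graph on the
reading words of the tableaux in `SSYT(λ, [a, b])`, with these tableaux as vertices. -/
def tableauGraph (lam : YoungDiagram) (a b : ℕ) : PreCrystalGraph ℕ :=
  (wordGraph a b).comap SSYT.wordVertex (SSYT.wordVertex_injective lam a b)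

/-- The highest-weight tableau of shape `λ` with entries from `[a, ∞)`: constant on each row, with
the value `a` on the first row, `a + 1` on the second row, and so on. -/
def highestTableau (lam : YoungDiagram) (a : ℕ) : SemistandardYoungTableau lam where
  entry x y := if (x, y) ∈ lam then a + x else 0
  row_weak' hj hcell := by
    rw [if_pos hcell, if_pos (lam.up_left_mem le_rfl (le_of_lt hj) hcell)]
  col_strict' hi hcell := by
    rw [if_pos hcell, if_pos (lam.up_left_mem (le_of_lt hi) le_rfl hcell)]
    omega
  zeros' hc := if_neg hc

/-- Semistandard tableaux of arbitrary shape. -/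
abbrev AnyTableau : Type := (lam : YoungDiagram) × SemistandardYoungTableau lam

/-- The tableau whose reading word is Knuth equivalent to `w`. -/
noncomputable def knuthTableau (w : List ℕ) : AnyTableau :=
  @Classical.epsilon AnyTableau ⟨⟨⊥, highestTableau ⊥ 0⟩⟩ fun T => KnuthEquiv (word T.2) w

/-! ### Matrices -/

section Matrices

variable {m n : ℕ}

/-- The cells of a matrix, each repeated as often as its entry says; columns from left to right,
each from top to bottom. -/
def rowCells (M : Matrix (Fin m) (Fin n) ℕ) : List (Fin m × Fin n) :=
  (List.finRange n).flatMap fun y =>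
    (List.finRange m).flatMap fun x => List.replicate (M x y) (x, y)

/-- The cells of a matrix, each repeated as often as its entry says; rows from top to bottom,
each from left to right. -/
def colCells (M : Matrix (Fin m) (Fin n) ℕ) : List (Fin m × Fin n) :=
  (List.finRange m).flatMap fun x =>
    (List.finRange n).flatMap fun y => List.replicate (M x y) (x, y)

/-- The row word: the row indices (counted from `1`) in the order of `rowCells`. -/
def rowWord (M : Matrix (Fin m) (Fin n) ℕ) : List ℕ :=
  (rowCells M).map fun c => c.1.val + 1

/-- The column word: the column indices (counted from `1`) in the order of `colCells`. -/
def colWord (M : Matrix (Fin m) (Fin n) ℕ) : List ℕ :=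
  (colCells M).map fun c => c.2.val + 1

/-- Subtract one from the entry at `c` and add one to the entry at `d`. -/
def moveUnit (M : Matrix (Fin m) (Fin n) ℕ) (c d : Fin m × Fin n) : Matrix (Fin m) (Fin n) ℕ :=
  Matrix.of fun x y =>
    if (x, y) = c then M x y - 1 else if (x, y) = d then M x y + 1 else M x y

/-- The row crystal lowering operator `f_i^row`; `none` is the special symbol `∅`. -/
def lowerRow (i : ℕ) (M : Matrix (Fin m) (Fin n) ℕ) : Option (Matrix (Fin m) (Fin n) ℕ) :=
  (lowerPos i (rowWord M)).bind fun p => (rowCells M)[p]?.bind fun c =>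
    if h : c.1.val + 1 < m then some (moveUnit M c (⟨c.1.val + 1, h⟩, c.2)) else none

/-- The column crystal lowering operator `f_j^col`; `none` is the special symbol `∅`. -/
def lowerCol (j : ℕ) (M : Matrix (Fin m) (Fin n) ℕ) : Option (Matrix (Fin m) (Fin n) ℕ) :=
  (lowerPos j (colWord M)).bind fun p => (colCells M)[p]?.bind fun c =>
    if h : c.2.val + 1 < n then some (moveUnit M c (c.1, ⟨c.2.val + 1, h⟩)) else none

theorem moveUnit_inj {M : Matrix (Fin m) (Fin n) ℕ} {c d c' d' : Fin m × Fin n}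
    (hc : 0 < M c.1 c.2) (hc' : 0 < M c'.1 c'.2) (hcd : c ≠ d) (hcd' : c' ≠ d')
    (h : moveUnit M c d = moveUnit M c' d') : c = c' ∧ d = d' := by
  have key : ∀ z : Fin m × Fin n, moveUnit M c d z.1 z.2 = moveUnit M c' d' z.1 z.2 := fun z => by rw [h]
  have h1 := key c
  have h2 := key d
  simp only [moveUnit, Matrix.of_apply, Prod.mk.eta] at h1 h2
  constructor
  · by_contra hne
    rw [if_pos trivial, if_neg hne] at h1
    split_ifs at h1 <;> omega
  · by_contra hne
    rw [if_neg hcd.symm, if_pos trivial, if_neg hne] at h2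
    split_ifs at h2 <;> omega

theorem moveUnit_ne {M : Matrix (Fin m) (Fin n) ℕ} {c d : Fin m × Fin n}
    (hc : 0 < M c.1 c.2) : moveUnit M c d ≠ M := by
  intro h
  have h1 : moveUnit M c d c.1 c.2 = M c.1 c.2 := by rw [h]
  simp only [moveUnit, Matrix.of_apply, Prod.mk.eta, if_true] at h1
  omega

theorem lowerRow_spec {i : ℕ} {M M' : Matrix (Fin m) (Fin n) ℕ} (h : lowerRow i M = some M') :
    ∃ (c : Fin m × Fin n) (hc : c.1.val + 1 < m), c.1.val + 1 = i ∧ 0 < M c.1 c.2 ∧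
      M' = moveUnit M c (⟨c.1.val + 1, hc⟩, c.2) := by
  obtain ⟨p, hp, h⟩ := Option.bind_eq_some_iff.1 h
  obtain ⟨c, hc, h⟩ := Option.bind_eq_some_iff.1 h
  have hi := getElem?_of_lowerPos hp
  rw [rowWord, List.getElem?_map, hc] at hi
  have hmem : c ∈ rowCells M := List.mem_of_getElem? hc
  split_ifs at h with hlt
  refine ⟨c, hlt, by simpa using hi, ?_, by simpa using h.symm⟩
  simp only [rowCells, List.mem_flatMap, List.mem_replicate] at hmem
  obtain ⟨y, -, x, -, h0, rfl⟩ := hmem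
  exact Nat.pos_of_ne_zero h0

theorem lowerCol_spec {j : ℕ} {M M' : Matrix (Fin m) (Fin n) ℕ} (h : lowerCol j M = some M') :
    ∃ (c : Fin m × Fin n) (hc : c.2.val + 1 < n), c.2.val + 1 = j ∧ 0 < M c.1 c.2 ∧
      M' = moveUnit M c (c.1, ⟨c.2.val + 1, hc⟩) := by
  obtain ⟨p, hp, h⟩ := Option.bind_eq_some_iff.1 h
  obtain ⟨c, hc, h⟩ := Option.bind_eq_some_iff.1 h
  have hi := getElem?_of_lowerPos hp
  rw [colWord, List.getElem?_map, hc] at hi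
  have hmem : c ∈ colCells M := List.mem_of_getElem? hc
  split_ifs at h with hlt
  refine ⟨c, hlt, by simpa using hi, ?_, by simpa using h.symm⟩
  simp only [colCells, List.mem_flatMap, List.mem_replicate] at hmem
  obtain ⟨x, -, y, -, h0, rfl⟩ := hmem
  exact Nat.pos_of_ne_zero h0

end Matrices

/-- The row weight of a matrix followed by its column weight, where these are the weights of the
row word in `W_m` and of the column word in `W_n`. -/
def matrixWeight {m n : ℕ} (M : Matrix (Fin m) (Fin n) ℕ) : List ℕ :=
  ((List.range' 1 m).map fun x => (rowWord M).count x) ++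
    ((List.range' 1 n).map fun y => (colWord M).count y)

/-- The matrix bicrystal graph. The label `i^row` is `Sum.inl i`, the label `j^col` is
`Sum.inr j`. -/
def matrixGraph (m n : ℕ) : PreCrystalGraph (ℕ ⊕ ℕ) where
  V := Matrix (Fin m) (Fin n) ℕ
  rank := m + n
  cwt := matrixWeight
  length_cwt M := by simp [matrixWeight]
  edge l M M' := match l with
    | Sum.inl i => lowerRow i M = some M'
    | Sum.inr j => lowerCol j M = some M'
  countable := inferInstanceAs (Countable (Fin m → Fin n → ℕ))
  loopless := by
    rintro (i | j) M h
    · obtain ⟨c, hc, -, h0, h⟩ := lowerRow_spec h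
      exact moveUnit_ne h0 h.symm
    · obtain ⟨c, hc, -, h0, h⟩ := lowerCol_spec h
      exact moveUnit_ne h0 h.symm
  simple := by
    have rne : ∀ (c : Fin m × Fin n) (hc : c.1.val + 1 < m),
        c ≠ (⟨c.1.val + 1, hc⟩, c.2) := fun c hc h => by
      have := congrArg (fun z => z.1.val) h
      simp at this
    have cne : ∀ (c : Fin m × Fin n) (hc : c.2.val + 1 < n),
        c ≠ (c.1, ⟨c.2.val + 1, hc⟩) := fun c hc h => by
      have := congrArg (fun z => z.2.val) h
      simp at this
    rintro (i | j) (i' | j') M M' h h'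
    · obtain ⟨c, hc, rfl, h0, h⟩ := lowerRow_spec h
      obtain ⟨d, hd, rfl, h0', h'⟩ := lowerRow_spec h'
      obtain ⟨rfl, -⟩ := moveUnit_inj h0 h0' (rne c hc) (rne d hd) (h.symm.trans h')
      rfl
    · obtain ⟨c, hc, rfl, h0, h⟩ := lowerRow_spec h
      obtain ⟨d, hd, rfl, h0', h'⟩ := lowerCol_spec h'
      obtain ⟨rfl, h2⟩ := moveUnit_inj h0 h0' (rne c hc) (cne d hd) (h.symm.trans h')
      have := congrArg (fun z => z.1.val) h2
      simp at this
    · obtain ⟨c, hc, rfl, h0, h⟩ := lowerCol_spec h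
      obtain ⟨d, hd, rfl, h0', h'⟩ := lowerRow_spec h'
      obtain ⟨rfl, h2⟩ := moveUnit_inj h0 h0' (cne c hc) (rne d hd) (h.symm.trans h')
      have := congrArg (fun z => z.1.val) h2
      simp at this
    · obtain ⟨c, hc, rfl, h0, h⟩ := lowerCol_spec h
      obtain ⟨d, hd, rfl, h0', h'⟩ := lowerCol_spec h'
      obtain ⟨rfl, -⟩ := moveUnit_inj h0 h0' (cne c hc) (cne d hd) (h.symm.trans h')
      rfl

/-! ### Filtered graphs and filtered RSK

The sequences `I = {0 = i_0 < ... < i_r = m}` and `J = {0 = j_0 < ... < j_s = n}` are given as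
functions `i : Fin (r + 1) → ℕ` and `j : Fin (s + 1) → ℕ`. -/

section Filtered

variable {r s : ℕ}

/-- The `(I|J)`-filtered matrix bicrystal graph. -/
def filteredMatrixGraph (m n : ℕ) (i : Fin (r + 1) → ℕ) (j : Fin (s + 1) → ℕ) :
    PreCrystalGraph (ℕ ⊕ ℕ) :=
  (matrixGraph m n).deleteLabels (Sum.inl '' Set.range i ∪ Sum.inr '' Set.range j)

/-- `I`-filtered partition-tuples: the `k`-th partition has at most `i (k + 1) - i k` rows. -/
abbrev PartitionTuple (i : Fin (r + 1) → ℕ) : Type :=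
  (k : Fin r) → {lam : YoungDiagram // lam.colLen 0 ≤ i k.succ - i k.castSucc}

/-- The `I`-filtered tableau crystal graph: the Cartesian product of the graphs
`B_{λ^(k),[i_{k-1}+1,i_k]}`. The labels `x` of the edges of the `k`-th factor satisfy
`i_{k-1} < x < i_k`, so the disjoint union of the sets of labels is their union. -/
def filteredTableauGraph (i : Fin (r + 1) → ℕ) (lam : PartitionTuple i) : PreCrystalGraph ℕ :=
  (PreCrystalGraph.boxPi fun k =>
    tableauGraph (lam k).1 (i k.castSucc + 1) (i k.succ)).relabel fun l => l.2

/-- The graph `B_{λ,m} □ B_{μ,n}` for a pair of partition-tuples. -/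
def tableauPairGraph (i : Fin (r + 1) → ℕ) (j : Fin (s + 1) → ℕ)
    (x : PartitionTuple i × PartitionTuple j) : PreCrystalGraph (ℕ ⊕ ℕ) :=
  (filteredTableauGraph i x.1).box (filteredTableauGraph j x.2)

/-- The direct sum of the graphs `B_{λ,m} □ B_{μ,n}` over all pairs of partition-tuples. -/
def tableauPairSum (i : Fin (r + 1) → ℕ) (j : Fin (s + 1) → ℕ) : PreCrystalGraph (ℕ ⊕ ℕ) :=
  PreCrystalGraph.directSum (tableauPairGraph i j)
    ((∑ k : Fin r, (i k.succ + 1 - (i k.castSucc + 1))) +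
      ∑ k : Fin s, (j k.succ + 1 - (j k.castSucc + 1))) fun _ => rfl

/-- The pair of tableau-tuples that is a given vertex of the direct sum. -/
def tableaux (i : Fin (r + 1) → ℕ) (j : Fin (s + 1) → ℕ) (v : (tableauPairSum i j).V) :
    (Fin r → AnyTableau) × (Fin s → AnyTableau) :=
  (fun k => ⟨(v.1.1 k).1, (v.2.1 k).1⟩, fun k => ⟨(v.1.2 k).1, (v.2.2 k).1⟩)

/-- The highest-weight tableau-tuple of shape `(λ|μ)`. -/
def highestTuple (i : Fin (r + 1) → ℕ) (j : Fin (s + 1) → ℕ)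
    (lam : PartitionTuple i) (mu : PartitionTuple j) :
    (Fin r → AnyTableau) × (Fin s → AnyTableau) :=
  (fun k => ⟨(lam k).1, highestTableau (lam k).1 (i k.castSucc + 1)⟩,
    fun k => ⟨(mu k).1, highestTableau (mu k).1 (j k.castSucc + 1)⟩)

/-- The condition that determines filtered RSK: the reading words of the tableaux are Knuth
equivalent to the components of the filtrations of the row word and the column word. -/
def IsFilterRSK {m n : ℕ} (i : Fin (r + 1) → ℕ) (j : Fin (s + 1) → ℕ)
    (M : Matrix (Fin m) (Fin n) ℕ) (T : (Fin r → AnyTableau) × (Fin s → AnyTableau)) : Prop :=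
  (∀ k, KnuthEquiv (word (T.1 k).2) (filterWord i (rowWord M) k)) ∧
    ∀ k, KnuthEquiv (word (T.2 k).2) (filterWord j (colWord M) k)

/-- Filtered RSK. -/
noncomputable def filterRSK {m n : ℕ} (i : Fin (r + 1) → ℕ) (j : Fin (s + 1) → ℕ)
    (M : Matrix (Fin m) (Fin n) ℕ) : (Fin r → AnyTableau) × (Fin s → AnyTableau) :=
  (fun k => knuthTableau (filterWord i (rowWord M) k),
    fun k => knuthTableau (filterWord j (colWord M) k))

end Filtered

end FilteredRSK

/-! Everything rests on the numbers `phi` and `eps` of unmatched `)` and `(`. On concatenations they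
obey the tensor product rule, so an operator changes exactly one factor, and these numbers alone
decide which one. A Knuth move replaces a triple by one with the same numbers, and a check on
triples then shows that the operators act on Knuth classes (`KnuthEquiv.step`,
`KnuthEquiv.step_to`). They also preserve the reading words of the tableaux of a fixed shape.
Raising as long as possible thus reduces existence and uniqueness of the tableau in a Knuth class to
words without unmatched `(`; there the tableau is the highest-weight one, and its shape is given by
the letter counts.

On a matrix, a row operator is a crystal step on the row word, and it changes the column word only
within its Knuth class (`knuthEquiv_colWord`). The reason is that the bracket conditions say exactly
that, on either side of the moved letter, one of the two rows of column indices dominates the other,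
which is what the Knuth moves require (`knuthEquiv_move`). Transposition gives the same for column
operators. Restriction to an interval of letters respects operators and Knuth equivalence, so
filtered RSK is a homomorphism. Edges lift in both directions, because `phi` and `eps` of the
tableaux are those of the row and column words.

What remains is injectivity on components. Raising two matrices with equal images along equal labels
reduces it to two sources of one component. Two facts settle this case. First, a matrix is
determined by the Knuth classes of its two unfiltered words (`eq_of_knuthEquiv`): raise with all
operators until both words are without unmatched `(`; then the sums over lower right corners depend
only on `a + b`, hence only on the row weight. Secondly, two sources of one component have Knuth
equivalent row words, and likewise column words. To see this, replace the row word by the reading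
word of its tableau, which column operators do not change. Along row operators the shapes of the
tableaux of the filtered suffixes are constant; for a source these shapes give the letter content of
every suffix, hence the word (`eq_of_isBlockSource`).

In the codomain, each summand has the tuple of highest-weight tableaux as its only source, and every
vertex can be raised to a source. So the summands are the components, which yields the description
of the components of the matrix graph. -/

namespace FilteredRSK

/-! ### Signatures of words -/

/-- The number of unmatched closing parentheses. -/
def phi (i : ℕ) : List ℕ → ℕ
  | [] => 0
  | x :: w => if x = i then phi i w + 1 else if x = i + 1 then phi i w - 1 else phi i w

/-- The number of unmatched opening parentheses. -/
def eps (i : ℕ) : List ℕ → ℕ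
  | [] => 0
  | x :: w => if x = i + 1 ∧ phi i w = 0 then eps i w + 1 else eps i w

@[simp] theorem phi_nil (i : ℕ) : phi i [] = 0 := rfl

@[simp] theorem eps_nil (i : ℕ) : eps i [] = 0 := rfl

theorem phi_cons (i x : ℕ) (w : List ℕ) : phi i (x :: w) =
    if x = i then phi i w + 1 else if x = i + 1 then phi i w - 1 else phi i w := rfl

theorem eps_cons (i x : ℕ) (w : List ℕ) : eps i (x :: w) =
    if x = i + 1 ∧ phi i w = 0 then eps i w + 1 else eps i w := rfl

/-- The unmatched `(` of `u` cancel against the unmatched `)` of `v`; the truncated subtractions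
record the surplus of either kind. -/
theorem phi_eps_append (i : ℕ) (u v : List ℕ) :
    phi i (u ++ v) = phi i u + (phi i v - eps i u) ∧
      eps i (u ++ v) = eps i v + (eps i u - phi i v) := by
  induction u with
  | nil => simp
  | cons x u ih =>
    obtain ⟨h1, h2⟩ := ih
    simp only [List.cons_append, phi_cons, eps_cons, h1, h2]
    constructor <;> split_ifs <;> omega

theorem phi_append (i : ℕ) (u v : List ℕ) :
    phi i (u ++ v) = phi i u + (phi i v - eps i u) := (phi_eps_append i u v).1

theorem eps_append (i : ℕ) (u v : List ℕ) :
    eps i (u ++ v) = eps i v + (eps i u - phi i v) := (phi_eps_append i u v).2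

/-- Matched pairs contain equally many letters `i` and `i + 1`. -/
theorem phi_add_count (i : ℕ) (w : List ℕ) :
    phi i w + w.count (i + 1) = eps i w + w.count i := by
  induction w with
  | nil => simp
  | cons x w ih =>
    simp only [phi_cons, eps_cons, List.count_cons, beq_iff_eq]
    split_ifs <;> omega

/-- The relation `v = f_i(w)` in terms of signatures. -/
def Step (i : ℕ) (w v : List ℕ) : Prop :=
  ∃ w₁ w₂, w = w₁ ++ i :: w₂ ∧ v = w₁ ++ (i + 1) :: w₂ ∧ eps i w₁ = 0 ∧ phi i w₂ = 0

theorem exists_step_of_phi_pos {i : ℕ} {w : List ℕ} (h : 0 < phi i w) : ∃ v, Step i w v := by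
  suffices h : ∃ w₁ w₂, w = w₁ ++ i :: w₂ ∧ eps i w₁ = 0 ∧ phi i w₂ = 0 by
    obtain ⟨w₁, w₂, h1, h2, h3⟩ := h
    exact ⟨_, w₁, w₂, h1, rfl, h2, h3⟩
  induction w with
  | nil => simp at h
  | cons x w ih =>
    by_cases hw : 0 < phi i w
    · obtain ⟨w₁, w₂, rfl, h1, h2⟩ := ih hw
      refine ⟨x :: w₁, w₂, rfl, ?_, h2⟩
      simp only [phi_cons, phi_append, eps_cons] at h ⊢
      split_ifs at h ⊢ <;> simp_all
    · refine ⟨[], w, ?_, rfl, by omega⟩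
      simp only [phi_cons] at h
      split_ifs at h with h1 h2
      · simp [h1]
      · omega
      · omega

theorem exists_step_of_eps_pos {i : ℕ} {w : List ℕ} (h : 0 < eps i w) : ∃ u, Step i u w := by
  suffices h : ∃ w₁ w₂, w = w₁ ++ (i + 1) :: w₂ ∧ eps i w₁ = 0 ∧ phi i w₂ = 0 by
    obtain ⟨w₁, w₂, h1, h2, h3⟩ := h
    exact ⟨_, w₁, w₂, rfl, h1, h2, h3⟩
  induction w with
  | nil => simp at h
  | cons x w ih =>
    by_cases hx : x = i + 1 ∧ phi i w = 0
    · exact ⟨[], w, by simp [hx.1], rfl, hx.2⟩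
    · rw [eps_cons, if_neg hx] at h
      obtain ⟨w₁, w₂, rfl, h1, h2⟩ := ih h
      refine ⟨x :: w₁, w₂, rfl, ?_, h2⟩
      rw [eps_cons, if_neg, h1]
      simp only [phi_append, phi_cons, h1, h2] at hx
      simpa using hx

theorem Step.phi_pos {i : ℕ} {w v : List ℕ} (h : Step i w v) : 0 < phi i w := by
  obtain ⟨w₁, w₂, rfl, rfl, h1, h2⟩ := h
  simp [phi_append, phi_cons, h1]

theorem Step.eps_pos {i : ℕ} {w v : List ℕ} (h : Step i w v) : 0 < eps i v := by
  obtain ⟨w₁, w₂, rfl, rfl, h1, h2⟩ := h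
  simp [eps_append, eps_cons, h2]

/-- The same two conditions single out the last unmatched `)` before the change and the first
unmatched `(` after it. Hence one lemma makes both lowering and raising single-valued. -/
theorem step_split_unique {i : ℕ} {w₁ w₂ w₁' w₂' : List ℕ} {x : ℕ} (hx : x = i ∨ x = i + 1)
    (h : w₁ ++ x :: w₂ = w₁' ++ x :: w₂') (h1 : eps i w₁ = 0) (h2 : phi i w₂ = 0)
    (h1' : eps i w₁' = 0) (h2' : phi i w₂' = 0) : w₁ = w₁' ∧ w₂ = w₂' := by
  -- Two distinct positions would enclose a list `d`; the `eps` condition of the later one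
  -- contradicts the `phi` condition of the earlier one.
  have key : ∀ a d b : List ℕ, eps i (a ++ x :: d) = 0 → phi i (d ++ x :: b) = 0 → False := by
    intro a d b h h'
    simp only [eps_append, phi_append, eps_cons, phi_cons] at h h'
    rcases hx with rfl | rfl
    · simp at h h'
      omega
    · split_ifs at h h' <;> omega
  rcases List.append_eq_append_iff.1 h with ⟨d, hd, hd'⟩ | ⟨d, hd, hd'⟩
  · cases d with
    | nil => simp_all
    | cons y d =>
      obtain ⟨rfl, rfl⟩ := List.cons_eq_cons.1 hd'
      rw [hd] at h1'
      exact (key _ _ _ h1' h2).elim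
  · cases d with
    | nil => simp_all
    | cons y d =>
      obtain ⟨rfl, rfl⟩ := List.cons_eq_cons.1 hd'
      rw [hd] at h1
      exact (key _ _ _ h1 h2').elim

theorem Step.right_unique {i : ℕ} {w v v' : List ℕ} (h : Step i w v) (h' : Step i w v') :
    v = v' := by
  obtain ⟨w₁, w₂, rfl, rfl, h1, h2⟩ := h
  obtain ⟨w₁', w₂', he, rfl, h1', h2'⟩ := h'
  obtain ⟨rfl, rfl⟩ := step_split_unique (Or.inl rfl) he h1 h2 h1' h2'
  rfl

theorem Step.left_unique {i : ℕ} {w w' v : List ℕ} (h : Step i w v) (h' : Step i w' v) :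
    w = w' := by
  obtain ⟨w₁, w₂, rfl, rfl, h1, h2⟩ := h
  obtain ⟨w₁', w₂', rfl, he, h1', h2'⟩ := h'
  obtain ⟨rfl, rfl⟩ := step_split_unique (Or.inr rfl) he h1 h2 h1' h2'
  rfl

theorem Step.sum_eq {i : ℕ} {w v : List ℕ} (h : Step i w v) : v.sum = w.sum + 1 := by
  obtain ⟨w₁, w₂, rfl, rfl, -, -⟩ := h
  simp; omega

/-- The induction has to carry `c` pending `(`. They must be used up before the altered letter,
hence the condition `c ≤ phi i w₁`, which is vacuous in the application at `c = 0`. -/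
theorem getLast?_unmatchedClose (i : ℕ) (w : List ℕ) : ∀ c p : ℕ,
    (phi i w ≤ c → unmatchedClose i c p w = []) ∧
    (c < phi i w → ∃ w₁ w₂, w = w₁ ++ i :: w₂ ∧ eps i w₁ = 0 ∧ c ≤ phi i w₁ ∧ phi i w₂ = 0 ∧
      (unmatchedClose i c p w).getLast? = some (p + w₁.length)) := by
  induction w with
  | nil => intro c p; simp [unmatchedClose]
  | cons x w ih =>
    intro c p
    rw [phi_cons, unmatchedClose]
    by_cases h1 : x = i + 1
    · have h2 : x ≠ i := by omega
      simp only [if_pos h1, if_neg h2]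
      refine ⟨fun h => (ih _ _).1 (by omega), fun h => ?_⟩
      obtain ⟨w₁, w₂, rfl, e1, e2, e3, e4⟩ := (ih (c + 1) (p + 1)).2 (by omega)
      refine ⟨x :: w₁, w₂, rfl, ?_, ?_, e3, ?_⟩
      · rw [eps_cons, if_neg (by omega), e1]
      · rw [phi_cons, if_neg h2, if_pos h1]; omega
      · rw [e4, List.length_cons]; congr 1; omega
    · by_cases h2 : x = i
      · simp only [if_pos h2, if_neg h1]
        refine ⟨fun h => ?_, fun h => ?_⟩
        · rw [if_neg (by omega)]
          exact (ih _ _).1 (by omega)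
        -- With truncated subtraction this asks whether a `)` of the tail survives; otherwise `c =
        -- 0` and the head is the last unmatched one.
        · by_cases hw : c - 1 < phi i w ∧ c ≤ phi i w
          · obtain ⟨w₁, w₂, rfl, e1, e2, e3, e4⟩ := (ih (c - 1) (p + 1)).2 hw.1
            refine ⟨x :: w₁, w₂, rfl, ?_, ?_, e3, ?_⟩
            · rw [eps_cons, if_neg (by omega), e1]
            · rw [phi_cons, if_pos h2]; omega
            · have e5 : p + (x :: w₁).length = p + 1 + w₁.length := by
                rw [List.length_cons]; omega
              rw [e5]
              split_ifs with hc
              · subst hc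
                rw [List.getLast?_cons, e4]
                rfl
              · exact e4
          · have hc : c = 0 := by omega
            subst hc
            have hw0 : phi i w = 0 := by omega
            refine ⟨[], w, by simp [h2], rfl, le_rfl, hw0, ?_⟩
            rw [if_pos rfl, (ih 0 (p + 1)).1 (by omega)]
            rfl
      · simp only [if_neg h2, if_neg h1]
        refine ⟨fun h => (ih _ _).1 (by omega), fun h => ?_⟩
        obtain ⟨w₁, w₂, rfl, e1, e2, e3, e4⟩ := (ih c (p + 1)).2 (by omega)
        refine ⟨x :: w₁, w₂, rfl, ?_, ?_, e3, ?_⟩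
        · rw [eps_cons, if_neg (by omega), e1]
        · rw [phi_cons, if_neg h2, if_neg h1]; omega
        · rw [e4, List.length_cons]; congr 1; omega

theorem lowerPos_eq_some_iff {i p : ℕ} {w : List ℕ} : lowerPos i w = some p ↔
    ∃ w₁ w₂, w = w₁ ++ i :: w₂ ∧ eps i w₁ = 0 ∧ phi i w₂ = 0 ∧ w₁.length = p := by
  have key : 0 < phi i w → ∃ w₁ w₂, w = w₁ ++ i :: w₂ ∧ eps i w₁ = 0 ∧ phi i w₂ = 0 ∧
      lowerPos i w = some w₁.length := fun h => by
    obtain ⟨w₁, w₂, e0, e1, -, e3, e4⟩ := (getLast?_unmatchedClose i w 0 0).2 h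
    exact ⟨w₁, w₂, e0, e1, e3, by rw [lowerPos, e4, Nat.zero_add]⟩
  constructor
  · intro h
    rcases Nat.eq_zero_or_pos (phi i w) with h0 | h0
    · rw [lowerPos, (getLast?_unmatchedClose i w 0 0).1 (by omega)] at h
      simp at h
    · obtain ⟨w₁, w₂, e0, e1, e3, e4⟩ := key h0
      rw [e4] at h
      exact ⟨w₁, w₂, e0, e1, e3, by simpa using h⟩
  · rintro ⟨w₁, w₂, rfl, e1, e2, rfl⟩
    obtain ⟨w₁', w₂', e0, e1', e3, e4⟩ := key (Step.phi_pos ⟨w₁, w₂, rfl, rfl, e1, e2⟩)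
    rw [e4, (step_split_unique (Or.inl rfl) e0 e1 e2 e1' e3).1]

theorem lower_eq_some_iff {i : ℕ} {w v : List ℕ} : lower i w = some v ↔ Step i w v := by
  simp only [lower, Option.map_eq_some_iff, lowerPos_eq_some_iff]
  constructor
  · rintro ⟨p, ⟨w₁, w₂, rfl, e1, e2, rfl⟩, rfl⟩
    exact ⟨w₁, w₂, rfl, by simp, e1, e2⟩
  · rintro ⟨w₁, w₂, rfl, rfl, e1, e2⟩
    exact ⟨_, ⟨w₁, w₂, rfl, e1, e2, rfl⟩, by simp⟩

/-! ### The tensor product rule -/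

theorem Step.append_left {i : ℕ} {v v' : List ℕ} (u : List ℕ) (h : Step i v v')
    (hu : eps i u < phi i v) : Step i (u ++ v) (u ++ v') := by
  obtain ⟨w₁, w₂, rfl, rfl, e1, e2⟩ := h
  refine ⟨u ++ w₁, w₂, by simp, by simp, ?_, e2⟩
  simp only [phi_append, phi_cons, e1, e2] at hu
  simp only [eps_append, e1]
  simp at hu
  omega

theorem Step.append_right {i : ℕ} {u u' : List ℕ} (h : Step i u u') (v : List ℕ)
    (hu : phi i v ≤ eps i u) : Step i (u ++ v) (u' ++ v) := by
  obtain ⟨w₁, w₂, rfl, rfl, e1, e2⟩ := h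
  refine ⟨w₁, w₂ ++ v, by simp, by simp, e1, ?_⟩
  simp only [eps_append, eps_cons, e1] at hu
  simp only [phi_append, e2]
  simp at hu
  omega

theorem Step.eps_eq {i : ℕ} {w v : List ℕ} (h : Step i w v) : eps i v = eps i w + 1 := by
  obtain ⟨w₁, w₂, rfl, rfl, e1, e2⟩ := h
  simp [eps_append, eps_cons, e1, e2]

theorem Step.phi_eq {i : ℕ} {w v : List ℕ} (h : Step i w v) : phi i w = phi i v + 1 := by
  obtain ⟨w₁, w₂, rfl, rfl, e1, e2⟩ := h
  simp [phi_append, phi_cons, e1, e2]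

/-- The last unmatched `)` lies in `v` exactly when the unmatched `(` of `u` do not consume all
unmatched `)` of `v`. -/
theorem step_append_iff {i : ℕ} {u v w : List ℕ} : Step i (u ++ v) w ↔
    (phi i v ≤ eps i u ∧ ∃ u', Step i u u' ∧ w = u' ++ v) ∨
      (eps i u < phi i v ∧ ∃ v', Step i v v' ∧ w = u ++ v') := by
  constructor
  · intro h
    rcases le_or_gt (phi i v) (eps i u) with h1 | h1
    · have h2 := h.phi_pos
      rw [phi_append] at h2
      obtain ⟨u', hu⟩ := exists_step_of_phi_pos (i := i) (w := u) (by omega)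
      exact Or.inl ⟨h1, u', hu, h.right_unique (hu.append_right v h1)⟩
    · obtain ⟨v', hv⟩ := exists_step_of_phi_pos (i := i) (w := v) (by omega)
      exact Or.inr ⟨h1, v', hv, h.right_unique (hv.append_left u h1)⟩
  · rintro (⟨h, u', hu, rfl⟩ | ⟨h, v', hv, rfl⟩)
    · exact hu.append_right v h
    · exact hv.append_left u h

/-- The inequalities differ by one from those of `step_append_iff`, since they are evaluated at the
target: there `eps` of a changed `u` is larger by one, or `phi` of a changed `v` smaller by one. -/
theorem step_to_append_iff {i : ℕ} {u v w : List ℕ} : Step i w (u ++ v) ↔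
    (phi i v < eps i u ∧ ∃ u', Step i u' u ∧ w = u' ++ v) ∨
      (eps i u ≤ phi i v ∧ ∃ v', Step i v' v ∧ w = u ++ v') := by
  have key : ∀ u', Step i u' u → phi i v < eps i u → Step i (u' ++ v) (u ++ v) := fun u' hu h =>
    hu.append_right v (by have := hu.eps_eq; omega)
  have key' : ∀ v', Step i v' v → eps i u ≤ phi i v → Step i (u ++ v') (u ++ v) := fun v' hv h =>
    hv.append_left u (by have := hv.phi_eq; omega)
  constructor
  · intro h
    rcases le_or_gt (eps i u) (phi i v) with h1 | h1
    · have h2 := h.eps_pos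
      rw [eps_append] at h2
      obtain ⟨v', hv⟩ := exists_step_of_eps_pos (i := i) (w := v) (by omega)
      exact Or.inr ⟨h1, v', hv, h.left_unique (key' v' hv h1)⟩
    · obtain ⟨u', hu⟩ := exists_step_of_eps_pos (i := i) (w := u) (by omega)
      exact Or.inl ⟨h1, u', hu, h.left_unique (key u' hu h1)⟩
  · rintro (⟨h, u', hu, rfl⟩ | ⟨h, v', hv, rfl⟩)
    · exact key u' hu h
    · exact key' v' hv h

/-! ### Knuth equivalence -/

theorem KnuthEquiv.refl (w : List ℕ) : KnuthEquiv w w := Relation.EqvGen.refl _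

theorem KnuthEquiv.symm {w v : List ℕ} (h : KnuthEquiv w v) : KnuthEquiv v w :=
  Relation.EqvGen.symm _ _ h

theorem KnuthEquiv.trans {w v u : List ℕ} (h : KnuthEquiv w v) (h' : KnuthEquiv v u) :
    KnuthEquiv w u := Relation.EqvGen.trans _ _ _ h h'

theorem KnuthMove.context {w v : List ℕ} (h : KnuthMove w v) (a b : List ℕ) :
    KnuthMove (a ++ w ++ b) (a ++ v ++ b) := by
  cases h with
  | left u v x y z h1 h2 => simpa using KnuthMove.left (a ++ u) (v ++ b) x y z h1 h2
  | right u v x y z h1 h2 => simpa using KnuthMove.right (a ++ u) (v ++ b) x y z h1 h2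

theorem KnuthEquiv.context {w v : List ℕ} (h : KnuthEquiv w v) (a b : List ℕ) :
    KnuthEquiv (a ++ w ++ b) (a ++ v ++ b) := by
  induction h with
  | rel _ _ h => exact Relation.EqvGen.rel _ _ (h.context a b)
  | refl _ => exact .refl _
  | symm _ _ _ ih => exact ih.symm
  | trans _ _ _ _ _ ih1 ih2 => exact ih1.trans ih2

theorem KnuthEquiv.append_left {w v : List ℕ} (h : KnuthEquiv w v) (a : List ℕ) :
    KnuthEquiv (a ++ w) (a ++ v) := by simpa using h.context a []

theorem KnuthEquiv.append_right {w v : List ℕ} (h : KnuthEquiv w v) (b : List ℕ) :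
    KnuthEquiv (w ++ b) (v ++ b) := by simpa using h.context [] b

theorem KnuthEquiv.cons {w v : List ℕ} (x : ℕ) (h : KnuthEquiv w v) :
    KnuthEquiv (x :: w) (x :: v) := h.append_left [x]

/-- An elementary move replaces a triple of consecutive letters. -/
theorem KnuthMove.triple {w v : List ℕ} (h : KnuthMove w v) : ∃ a t t' b, w = a ++ t ++ b ∧
    v = a ++ t' ++ b ∧ ∃ x y z, (x < y ∧ y ≤ z ∧ t = [y, z, x] ∧ t' = [y, x, z]) ∨
      (x ≤ y ∧ y < z ∧ t = [z, x, y] ∧ t' = [x, z, y]) := by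
  cases h with
  | left u v x y z h1 h2 => exact ⟨u, _, _, v, rfl, rfl, x, y, z, Or.inl ⟨h1, h2, rfl, rfl⟩⟩
  | right u v x y z h1 h2 => exact ⟨u, _, _, v, rfl, rfl, x, y, z, Or.inr ⟨h1, h2, rfl, rfl⟩⟩

theorem phi_single (i a : ℕ) : phi i [a] = if a = i then 1 else 0 := by
  simp [phi_cons]

theorem eps_single (i a : ℕ) : eps i [a] = if a = i + 1 then 1 else 0 := by
  simp [eps_cons]

/-- By the tensor product rule only the replaced triple matters, and there single letters are
compared. -/
theorem KnuthMove.eps_phi_eq {w v : List ℕ} (h : KnuthMove w v) (i : ℕ) :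
    eps i w = eps i v ∧ phi i w = phi i v := by
  obtain ⟨a, t, t', b, rfl, rfl, x, y, z, h⟩ := h.triple
  have : eps i t = eps i t' ∧ phi i t = phi i t' := by
    have e : ∀ a b c : ℕ, [a, b, c] = [a] ++ ([b] ++ [c]) := fun _ _ _ => rfl
    rcases h with ⟨h1, h2, rfl, rfl⟩ | ⟨h1, h2, rfl, rfl⟩
    · simp only [e, eps_append, phi_append, eps_single, phi_single]
      constructor <;> split_ifs <;> omega
    · simp only [e, eps_append, phi_append, eps_single, phi_single]
      constructor <;> split_ifs <;> omega
  simp only [eps_append, phi_append, this, and_self]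

theorem KnuthEquiv.eps_phi_eq {w v : List ℕ} (h : KnuthEquiv w v) (i : ℕ) :
    eps i w = eps i v ∧ phi i w = phi i v := by
  induction h with
  | rel _ _ h => exact h.eps_phi_eq i
  | refl _ => exact ⟨rfl, rfl⟩
  | symm _ _ _ ih => exact ⟨ih.1.symm, ih.2.symm⟩
  | trans _ _ _ _ _ ih1 ih2 => exact ⟨ih1.1.trans ih2.1, ih1.2.trans ih2.2⟩

theorem KnuthEquiv.eps_eq {w v : List ℕ} (h : KnuthEquiv w v) (i : ℕ) : eps i w = eps i v :=
  (h.eps_phi_eq i).1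

theorem KnuthEquiv.phi_eq {w v : List ℕ} (h : KnuthEquiv w v) (i : ℕ) : phi i w = phi i v :=
  (h.eps_phi_eq i).2

theorem KnuthEquiv.perm {w v : List ℕ} (h : KnuthEquiv w v) : w.Perm v := by
  induction h with
  | rel _ _ h =>
    obtain ⟨a, t, t', b, rfl, rfl, x, y, z, h⟩ := h.triple
    have : t.Perm t' := by
      rcases h with ⟨-, -, rfl, rfl⟩ | ⟨-, -, rfl, rfl⟩
      · exact (List.Perm.swap _ _ _).cons _
      · exact List.Perm.swap _ _ _
    exact (this.append_left a).append_right b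
  | refl _ => exact .refl _
  | symm _ _ _ ih => exact ih.symm
  | trans _ _ _ _ _ ih1 ih2 => exact ih1.trans ih2

theorem step_triple_iff {i a b c : ℕ} {v : List ℕ} : Step i [a, b, c] v ↔
    (a = i ∧ phi i [b, c] = 0 ∧ v = [i + 1, b, c]) ∨
    (b = i ∧ eps i [a] = 0 ∧ phi i [c] = 0 ∧ v = [a, i + 1, c]) ∨
    (c = i ∧ eps i [a, b] = 0 ∧ v = [a, b, i + 1]) := by
  constructor
  · rintro ⟨w₁, w₂, h, rfl, h1, h2⟩
    rcases w₁ with _ | ⟨x, _ | ⟨y, _ | ⟨z, w₁⟩⟩⟩ <;> simp at h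
    · obtain ⟨rfl, rfl⟩ := h; exact Or.inl ⟨rfl, h2, rfl⟩
    · obtain ⟨rfl, rfl, rfl⟩ := h; exact Or.inr (Or.inl ⟨rfl, h1, h2, rfl⟩)
    · obtain ⟨rfl, rfl, rfl, rfl⟩ := h; exact Or.inr (Or.inr ⟨rfl, h1, rfl⟩)
  · rintro (⟨rfl, h, rfl⟩ | ⟨rfl, h, h', rfl⟩ | ⟨rfl, h, rfl⟩)
    · exact ⟨[], _, rfl, rfl, rfl, h⟩
    · exact ⟨[a], _, rfl, rfl, h, h'⟩
    · exact ⟨[a, b], [], rfl, rfl, h, rfl⟩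

theorem step_to_triple_iff {i a b c : ℕ} {v : List ℕ} : Step i v [a, b, c] ↔
    (a = i + 1 ∧ phi i [b, c] = 0 ∧ v = [i, b, c]) ∨
    (b = i + 1 ∧ eps i [a] = 0 ∧ phi i [c] = 0 ∧ v = [a, i, c]) ∨
    (c = i + 1 ∧ eps i [a, b] = 0 ∧ v = [a, b, i]) := by
  constructor
  · rintro ⟨w₁, w₂, rfl, h, h1, h2⟩
    rcases w₁ with _ | ⟨x, _ | ⟨y, _ | ⟨z, w₁⟩⟩⟩ <;> simp at h
    · obtain ⟨rfl, rfl⟩ := h; exact Or.inl ⟨rfl, h2, rfl⟩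
    · obtain ⟨rfl, rfl, rfl⟩ := h; exact Or.inr (Or.inl ⟨rfl, h1, h2, rfl⟩)
    · obtain ⟨rfl, rfl, rfl, rfl⟩ := h; exact Or.inr (Or.inr ⟨rfl, h1, rfl⟩)
  · rintro (⟨rfl, h, rfl⟩ | ⟨rfl, h, h', rfl⟩ | ⟨rfl, h, rfl⟩)
    · exact ⟨[], _, rfl, rfl, rfl, h⟩
    · exact ⟨[a], _, rfl, rfl, h, h'⟩
    · exact ⟨[a, b], [], rfl, rfl, h, rfl⟩

theorem knuthEquiv_left {x y z : ℕ} (h1 : x < y) (h2 : y ≤ z) :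
    KnuthEquiv [y, z, x] [y, x, z] := .rel _ _ (KnuthMove.left [] [] x y z h1 h2)

theorem knuthEquiv_right {x y z : ℕ} (h1 : x ≤ y) (h2 : y < z) :
    KnuthEquiv [z, x, y] [x, z, y] := .rel _ _ (KnuthMove.right [] [] x y z h1 h2)

theorem phi_single_iff (i a : ℕ) : phi i [a] = 0 ↔ a ≠ i := by simp [phi_single]

theorem eps_single_iff (i a : ℕ) : eps i [a] = 0 ↔ a ≠ i + 1 := by simp [eps_single]

theorem phi_pair_iff (i a b : ℕ) : phi i [a, b] = 0 ↔ a ≠ i ∧ (b = i → a = i + 1) := by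
  rw [show [a, b] = [a] ++ [b] from rfl]
  simp only [phi_append, phi_single, eps_single]
  grind

theorem eps_pair_iff (i a b : ℕ) : eps i [a, b] = 0 ↔ b ≠ i + 1 ∧ (a = i + 1 → b = i) := by
  rw [show [a, b] = [a] ++ [b] from rfl]
  simp only [eps_append, phi_single, eps_single]
  grind

/-- The lowering operators of the triples in an elementary Knuth move. -/
theorem step_triple_transport {x y z : ℕ} {t t' : List ℕ}
    (h : (x < y ∧ y ≤ z ∧ t = [y, z, x] ∧ t' = [y, x, z]) ∨
      (x ≤ y ∧ y < z ∧ t = [z, x, y] ∧ t' = [x, z, y])) {i : ℕ} {s : List ℕ} (hs : Step i t s) :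
    ∃ s', Step i t' s' ∧ KnuthEquiv s s' := by
  rcases h with ⟨h1, h2, rfl, rfl⟩ | ⟨h1, h2, rfl, rfl⟩
  · simp only [step_triple_iff, phi_single_iff, eps_single_iff, phi_pair_iff, eps_pair_iff] at hs ⊢
    rcases hs with ⟨rfl, h, rfl⟩ | ⟨rfl, h, h', rfl⟩ | ⟨rfl, h, rfl⟩
    · exact ⟨_, Or.inl ⟨rfl, by omega, rfl⟩, knuthEquiv_left (by omega) (by omega)⟩
    · exact ⟨_, Or.inr (Or.inr ⟨rfl, by omega, rfl⟩), knuthEquiv_left (by omega) (by omega)⟩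
    · exact ⟨_, Or.inr (Or.inl ⟨rfl, by omega, by omega, rfl⟩), knuthEquiv_left (by omega) (by omega)⟩
  · simp only [step_triple_iff, phi_single_iff, eps_single_iff, phi_pair_iff, eps_pair_iff] at hs ⊢
    rcases hs with ⟨rfl, h, rfl⟩ | ⟨rfl, h, h', rfl⟩ | ⟨rfl, h, rfl⟩
    · exact ⟨_, Or.inr (Or.inl ⟨rfl, by omega, by omega, rfl⟩),
        knuthEquiv_right (by omega) (by omega)⟩
    · exact ⟨_, Or.inl ⟨rfl, by omega, rfl⟩, knuthEquiv_right (by omega) (by omega)⟩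
    -- The kind of move can change: `[i+1, i, i]` and `[i, i+1, i]` step to `[i+1, i, i+1]` and
    -- `[i+1, i+1, i]`, which are related by the other Knuth move.
    · by_cases hz : z = y + 1
      · obtain rfl : x = y := h.2 hz
        subst hz
        exact ⟨_, Or.inl ⟨rfl, by omega, rfl⟩, (knuthEquiv_left (by omega) (by omega)).symm⟩
      · exact ⟨_, Or.inr (Or.inr ⟨rfl, by omega, rfl⟩), knuthEquiv_right (by omega) (by omega)⟩

theorem step_triple_transport_symm {x y z : ℕ} {t t' : List ℕ}
    (h : (x < y ∧ y ≤ z ∧ t = [y, z, x] ∧ t' = [y, x, z]) ∨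
      (x ≤ y ∧ y < z ∧ t = [z, x, y] ∧ t' = [x, z, y])) {i : ℕ} {s : List ℕ} (hs : Step i s t) :
    ∃ s', Step i s' t' ∧ KnuthEquiv s s' := by
  rcases h with ⟨h1, h2, rfl, rfl⟩ | ⟨h1, h2, rfl, rfl⟩
  · simp only [step_to_triple_iff, phi_single_iff, eps_single_iff, phi_pair_iff,
      eps_pair_iff] at hs ⊢
    rcases hs with ⟨rfl, h, rfl⟩ | ⟨rfl, h, h', rfl⟩ | ⟨rfl, h, rfl⟩
    -- The exceptional case read backwards: `[i+1, i+1, i]` and `[i+1, i, i+1]` come from `[i, i+1,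
    -- i]` and `[i+1, i, i]`.
    · by_cases hx : x = i
      · subst hx
        obtain rfl : z = x + 1 := h.2 rfl
        exact ⟨_, Or.inr (Or.inr ⟨rfl, by omega, rfl⟩), (knuthEquiv_right (by omega) (by omega)).symm⟩
      · exact ⟨_, Or.inl ⟨rfl, by omega, rfl⟩, knuthEquiv_left (by omega) (by omega)⟩
    · exact ⟨_, Or.inr (Or.inr ⟨rfl, by omega, rfl⟩), knuthEquiv_left (by omega) (by omega)⟩
    · exact ⟨_, Or.inr (Or.inl ⟨rfl, by omega, by omega, rfl⟩), knuthEquiv_left (by omega) (by omega)⟩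
  · simp only [step_to_triple_iff, phi_single_iff, eps_single_iff, phi_pair_iff,
      eps_pair_iff] at hs ⊢
    rcases hs with ⟨rfl, h, rfl⟩ | ⟨rfl, h, h', rfl⟩ | ⟨rfl, h, rfl⟩
    · exact ⟨_, Or.inr (Or.inl ⟨rfl, by omega, by omega, rfl⟩),
        knuthEquiv_right (by omega) (by omega)⟩
    · exact ⟨_, Or.inl ⟨rfl, by omega, rfl⟩, knuthEquiv_right (by omega) (by omega)⟩
    · exact ⟨_, Or.inr (Or.inr ⟨rfl, by omega, rfl⟩), knuthEquiv_right (by omega) (by omega)⟩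

end FilteredRSK

namespace FilteredRSK

/-! ### Crystal operators act on Knuth classes -/

theorem KnuthMove.exists_step {i : ℕ} {w w' v : List ℕ} (h : KnuthMove w w') (hs : Step i w v) :
    ∃ v', Step i w' v' ∧ KnuthEquiv v v' := by
  obtain ⟨a, t, t', b, rfl, rfl, x, y, z, ht⟩ := h.triple
  have e : KnuthMove t t' := by
    rcases ht with ⟨h1, h2, rfl, rfl⟩ | ⟨h1, h2, rfl, rfl⟩
    · exact KnuthMove.left [] [] x y z h1 h2
    · exact KnuthMove.right [] [] x y z h1 h2
  obtain ⟨e1, e2⟩ := e.eps_phi_eq i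
  have e3 : eps i (a ++ t) = eps i (a ++ t') := by simp only [eps_append, e1, e2]
  have e4 : KnuthEquiv t t' := .rel _ _ e
  -- Which of `a`, `t`, `b` changes is decided by `eps` and `phi`, which agree for `t` and `t'`.
  -- Only a change in the middle factor needs the analysis of triples.
  rcases step_append_iff.1 hs with ⟨hb, u, hu, rfl⟩ | ⟨hb, u, hu, rfl⟩
  · rcases step_append_iff.1 hu with ⟨ha, u', hu', rfl⟩ | ⟨ha, u', hu', rfl⟩
    · exact ⟨_, (hu'.append_right t' (by omega)).append_right b (by omega), e4.context _ _⟩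
    · obtain ⟨s', hs', h'⟩ := step_triple_transport ht hu'
      exact ⟨_, (hs'.append_left a (by omega)).append_right b (by omega), h'.context _ _⟩
  · exact ⟨_, hu.append_left _ (by omega), e4.context _ _⟩

theorem KnuthMove.exists_step_to {i : ℕ} {w w' v : List ℕ} (h : KnuthMove w w')
    (hs : Step i v w) : ∃ v', Step i v' w' ∧ KnuthEquiv v v' := by
  obtain ⟨a, t, t', b, rfl, rfl, x, y, z, ht⟩ := h.triple
  have e : KnuthMove t t' := by
    rcases ht with ⟨h1, h2, rfl, rfl⟩ | ⟨h1, h2, rfl, rfl⟩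
    · exact KnuthMove.left [] [] x y z h1 h2
    · exact KnuthMove.right [] [] x y z h1 h2
  obtain ⟨e1, e2⟩ := e.eps_phi_eq i
  have e3 : eps i (a ++ t) = eps i (a ++ t') := by simp only [eps_append, e1, e2]
  have e4 : KnuthEquiv t t' := .rel _ _ e
  rcases step_to_append_iff.1 hs with ⟨hb, u, hu, rfl⟩ | ⟨hb, u, hu, rfl⟩
  · rcases step_to_append_iff.1 hu with ⟨ha, u', hu', rfl⟩ | ⟨ha, u', hu', rfl⟩
    · exact ⟨_, step_to_append_iff.2 (Or.inl ⟨by omega, _,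
        step_to_append_iff.2 (Or.inl ⟨by omega, _, hu', rfl⟩), rfl⟩), e4.context _ _⟩
    · obtain ⟨s', hs', h'⟩ := step_triple_transport_symm ht hu'
      exact ⟨_, step_to_append_iff.2 (Or.inl ⟨by omega, _,
        step_to_append_iff.2 (Or.inr ⟨by omega, _, hs', rfl⟩), rfl⟩), h'.context _ _⟩
  · exact ⟨_, step_to_append_iff.2 (Or.inr ⟨by omega, _, hu, rfl⟩), e4.context _ _⟩

theorem KnuthEquiv.step {i : ℕ} {w w' v v' : List ℕ} (h : KnuthEquiv w w') (hs : Step i w v)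
    (hs' : Step i w' v') : KnuthEquiv v v' := by
  induction h generalizing v v' with
  | rel _ _ h =>
    obtain ⟨v'', h1, h2⟩ := h.exists_step hs
    rwa [hs'.right_unique h1]
  | refl _ => rw [hs.right_unique hs']; exact .refl _
  | symm _ _ _ ih => exact (ih hs' hs).symm
  | trans _ u _ h1 _ ih1 ih2 =>
    obtain ⟨u', hu⟩ := exists_step_of_phi_pos (KnuthEquiv.phi_eq h1 i ▸ hs.phi_pos)
    exact (ih1 hs hu).trans (ih2 hu hs')

theorem KnuthEquiv.step_to {i : ℕ} {w w' v v' : List ℕ} (h : KnuthEquiv w w') (hs : Step i v w)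
    (hs' : Step i v' w') : KnuthEquiv v v' := by
  induction h generalizing v v' with
  | rel _ _ h =>
    obtain ⟨v'', h1, h2⟩ := h.exists_step_to hs
    rwa [hs'.left_unique h1]
  | refl _ => rw [hs.left_unique hs']; exact .refl _
  | symm _ _ _ ih => exact (ih hs' hs).symm
  | trans _ u _ h1 _ ih1 ih2 =>
    obtain ⟨u', hu⟩ := exists_step_of_eps_pos (KnuthEquiv.eps_eq h1 i ▸ hs.eps_pos)
    exact (ih1 hs hu).trans (ih2 hu hs')

theorem KnuthEquiv.exists_step {i : ℕ} {w w' v : List ℕ} (h : KnuthEquiv w w')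
    (hs : Step i w v) : ∃ v', Step i w' v' ∧ KnuthEquiv v v' := by
  obtain ⟨v', hv⟩ := exists_step_of_phi_pos (h.phi_eq i ▸ hs.phi_pos)
  exact ⟨v', hv, h.step hs hv⟩

theorem KnuthEquiv.exists_step_to {i : ℕ} {w w' v : List ℕ} (h : KnuthEquiv w w')
    (hs : Step i v w) : ∃ v', Step i v' w' ∧ KnuthEquiv v v' := by
  obtain ⟨v', hv⟩ := exists_step_of_eps_pos (h.eps_eq i ▸ hs.eps_pos)
  exact ⟨v', hv, h.step_to hs hv⟩

/-! ### Restriction to a subalphabet -/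

theorem eps_phi_filter {i : ℕ} {p : ℕ → Bool} (h : p i) (h' : p (i + 1)) (w : List ℕ) :
    eps i (w.filter p) = eps i w ∧ phi i (w.filter p) = phi i w := by
  induction w with
  | nil => simp
  | cons x w ih =>
    by_cases hx : p x
    · simp only [List.filter_cons_of_pos hx, eps_cons, phi_cons, ih, and_self]
    · have h1 : x ≠ i := by rintro rfl; exact hx h
      have h2 : x ≠ i + 1 := by rintro rfl; exact hx h'
      simp [List.filter_cons_of_neg hx, eps_cons, phi_cons, ih, h1, h2]

theorem Step.filter {i : ℕ} {p : ℕ → Bool} (h : p i) (h' : p (i + 1)) {w v : List ℕ}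
    (hs : Step i w v) : Step i (w.filter p) (v.filter p) := by
  obtain ⟨w₁, w₂, rfl, rfl, h1, h2⟩ := hs
  refine ⟨w₁.filter p, w₂.filter p, by simp [h], by simp [h'], ?_, ?_⟩
  · rw [(eps_phi_filter h h' _).1, h1]
  · rw [(eps_phi_filter h h' _).2, h2]

theorem Step.filter_eq {i : ℕ} {p : ℕ → Bool} (h : ¬ p i) (h' : ¬ p (i + 1)) {w v : List ℕ}
    (hs : Step i w v) : w.filter p = v.filter p := by
  obtain ⟨w₁, w₂, rfl, rfl, h1, h2⟩ := hs
  simp [h, h']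

/-- A move exchanges only the smallest and the largest letter of its triple. If either is dropped,
both sides become equal; if both are kept, convexity of `p` keeps the middle letter and the move
survives. -/
theorem KnuthEquiv.filter {w v : List ℕ} (h : KnuthEquiv w v) (p : ℕ → Bool)
    (hp : ∀ x y z, p x → p z → x ≤ y → y ≤ z → p y) : KnuthEquiv (w.filter p) (v.filter p) := by
  induction h with
  | rel _ _ h =>
    obtain ⟨a, t, t', b, rfl, rfl, x, y, z, h⟩ := h.triple
    simp only [List.filter_append]
    refine KnuthEquiv.context ?_ _ _
    have hy : p x → p z → x ≤ y → y ≤ z → p y := hp x y z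
    rcases h with ⟨h1, h2, rfl, rfl⟩ | ⟨h1, h2, rfl, rfl⟩
    · by_cases hx : p x <;> by_cases hz : p z
      · have := hy hx hz (by omega) h2
        simpa [List.filter_cons, hx, hz, this] using knuthEquiv_left h1 h2
      all_goals simpa [List.filter_cons, hx, hz] using KnuthEquiv.refl _
    · by_cases hx : p x <;> by_cases hz : p z
      · have := hy hx hz (by omega) (by omega)
        simpa [List.filter_cons, hx, hz, this] using knuthEquiv_right h1 h2
      all_goals simpa [List.filter_cons, hx, hz] using KnuthEquiv.refl _
  | refl _ => exact .refl _
  | symm _ _ _ ih => exact ih.symm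
  | trans _ _ _ _ _ ih1 ih2 => exact ih1.trans ih2

/-! ### Crystal operators on tableaux -/

/-- The order in which the cells of a tableau are read. -/
def ReadBefore (c d : ℕ × ℕ) : Prop := c.2 < d.2 ∨ c.2 = d.2 ∧ d.1 < c.1

theorem mem_readingCells_iff {lam : YoungDiagram} {c : ℕ × ℕ} :
    c ∈ readingCells lam ↔ c ∈ lam := by
  refine ⟨fun h => ?_, mem_readingCells⟩
  simp only [readingCells, List.mem_flatMap, List.mem_map, List.mem_reverse, List.mem_range] at h
  obtain ⟨y, -, x, hx, rfl⟩ := h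
  exact YoungDiagram.mem_iff_lt_colLen.2 hx

theorem pairwise_readingCells (lam : YoungDiagram) :
    (readingCells lam).Pairwise ReadBefore := by
  rw [readingCells, List.pairwise_flatMap]
  constructor
  · intro y _
    rw [List.pairwise_map, List.pairwise_reverse]
    exact List.pairwise_lt_range.imp fun h => Or.inr ⟨rfl, h⟩
  · refine List.pairwise_lt_range.imp fun h => ?_
    intro c hc d hd
    simp only [List.mem_map] at hc hd
    obtain ⟨_, -, rfl⟩ := hc
    obtain ⟨_, -, rfl⟩ := hd
    exact Or.inl h

theorem nodup_readingCells (lam : YoungDiagram) : (readingCells lam).Nodup :=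
  (pairwise_readingCells lam).imp fun {a b} h e => by
    subst e
    rcases h with h | h <;> omega

theorem phi_pos_of_split {i : ℕ} {u v : List ℕ} (h : ∀ x ∈ u, x ≠ i + 1) :
    0 < phi i (u ++ i :: v) := by
  induction u with
  | nil => simp [phi_cons]
  | cons x u ih =>
    have h1 := ih fun y hy => h y (List.mem_cons_of_mem _ hy)
    have h2 := h x List.mem_cons_self
    rw [List.cons_append, phi_cons]
    split_ifs <;> omega

theorem phi_eq_zero_of_forall_ne {i : ℕ} {u : List ℕ} (h : ∀ x ∈ u, x ≠ i) : phi i u = 0 := by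
  induction u with
  | nil => rfl
  | cons x u ih =>
    have h1 := ih fun y hy => h y (List.mem_cons_of_mem _ hy)
    rw [phi_cons, if_neg (h x List.mem_cons_self), h1]
    simp

theorem eps_pos_of_split {i : ℕ} {u v : List ℕ} (h : ∀ x ∈ v, x ≠ i) :
    0 < eps i (u ++ (i + 1) :: v) := by
  rw [eps_append, eps_cons, phi_cons, phi_eq_zero_of_forall_ne h]
  simp

/-- The cells read after `c` up to the cell `d`. -/
theorem split_after {lam : YoungDiagram} {c₁ c₂ : List (ℕ × ℕ)} {c d : ℕ × ℕ}
    (h : readingCells lam = c₁ ++ c :: c₂) (hd : d ∈ lam) (hcd : ReadBefore c d) :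
    ∃ d₁ d₂, c₂ = d₁ ++ d :: d₂ ∧ ∀ e ∈ d₁, e ∈ lam ∧ ReadBefore c e ∧ ReadBefore e d := by
  have hp := pairwise_readingCells lam
  have hm := mem_readingCells_iff.2 hd
  rw [h, List.pairwise_append, List.pairwise_cons] at hp
  obtain ⟨-, ⟨hp1, hp2⟩, hp3⟩ := hp
  have hmem : d ∈ c₂ := by
    rw [h, List.mem_append, List.mem_cons] at hm
    rcases hm with hm | rfl | hm
    · have h1 := hp3 d hm c List.mem_cons_self
      simp only [ReadBefore] at h1 hcd
      omega
    · simp only [ReadBefore] at hcd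
      omega
    · exact hm
  obtain ⟨d₁, d₂, rfl⟩ := List.append_of_mem hmem
  refine ⟨d₁, d₂, rfl, fun e he => ⟨?_, hp1 e (by simp [he]), ?_⟩⟩
  · exact mem_readingCells_iff.1 (h ▸ by simp [he])
  · exact (List.pairwise_append.1 hp2).2.2 e he d List.mem_cons_self

/-- The cells read from the cell `d` until `c`. -/
theorem split_before {lam : YoungDiagram} {c₁ c₂ : List (ℕ × ℕ)} {c d : ℕ × ℕ}
    (h : readingCells lam = c₁ ++ c :: c₂) (hd : d ∈ lam) (hcd : ReadBefore d c) :
    ∃ d₁ d₂, c₁ = d₁ ++ d :: d₂ ∧ ∀ e ∈ d₂, e ∈ lam ∧ ReadBefore d e ∧ ReadBefore e c := by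
  have hp := pairwise_readingCells lam
  have hm := mem_readingCells_iff.2 hd
  rw [h, List.pairwise_append, List.pairwise_cons] at hp
  obtain ⟨hp2, ⟨hp1, -⟩, hp3⟩ := hp
  have hmem : d ∈ c₁ := by
    rw [h, List.mem_append, List.mem_cons] at hm
    rcases hm with hm | rfl | hm
    · exact hm
    · simp only [ReadBefore] at hcd
      omega
    · have h1 := hp1 d hm
      simp only [ReadBefore] at h1 hcd
      omega
  obtain ⟨d₁, d₂, rfl⟩ := List.append_of_mem hmem
  refine ⟨d₁, d₂, rfl, fun e he => ⟨?_, ?_, hp3 e (by simp [he]) c List.mem_cons_self⟩⟩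
  · exact mem_readingCells_iff.1 (h ▸ by simp [he])
  · exact (List.pairwise_cons.1 (List.pairwise_append.1 hp2).2.1).1 e he

variable {lam : YoungDiagram}

/-- Replacing one entry of a tableau. -/
def updateTableau (T : SemistandardYoungTableau lam) (c : ℕ × ℕ) (hc : c ∈ lam) (k : ℕ)
    (hr : ∀ d ∈ lam, d.1 = c.1 → c.2 < d.2 → k ≤ T d.1 d.2)
    (hl : ∀ y < c.2, T c.1 y ≤ k)
    (hb : ∀ d ∈ lam, d.2 = c.2 → c.1 < d.1 → k < T d.1 d.2)
    (ha : ∀ x < c.1, T x c.2 < k) : SemistandardYoungTableau lam where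
  entry x y := if (x, y) = c then k else T x y
  row_weak' {x y y'} hy h := by
    split_ifs with h1 h2 h2
    · exact le_rfl
    · subst h1
      exact hr _ h rfl hy
    · subst h2
      exact hl _ hy
    · exact T.row_weak hy h
  col_strict' {x x' y} hx h := by
    split_ifs with h1 h2 h2
    · subst h1
      simp at h2
      omega
    · subst h1
      exact hb _ h rfl hx
    · subst h2
      exact ha _ hx
    · exact T.col_strict hx h
  zeros' {x y} h := by
    rw [if_neg, T.zeros h]
    rintro rfl
    exact h hc

theorem word_updateTableau {T : SemistandardYoungTableau lam} {c : ℕ × ℕ} {hc : c ∈ lam} {k : ℕ}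
    {hr hl hb ha} {c₁ c₂ : List (ℕ × ℕ)} (h : readingCells lam = c₁ ++ c :: c₂) :
    word (updateTableau T c hc k hr hl hb ha) =
      (c₁.map fun c => T c.1 c.2) ++ k :: c₂.map fun c => T c.1 c.2 := by
  have hn := nodup_readingCells lam
  rw [h] at hn
  rw [List.nodup_append, List.nodup_cons] at hn
  have key : ∀ x y, updateTableau T c hc k hr hl hb ha x y = if (x, y) = c then k else T x y :=
    fun _ _ => rfl
  simp only [word, h, List.map_append, List.map_cons, key, Prod.mk.eta, if_true]
  congr 1
  · refine List.map_congr_left fun d hd => if_neg ?_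
    rintro rfl
    exact hn.2.2 d hd d List.mem_cons_self rfl
  · congr 1
    refine List.map_congr_left fun d hd => if_neg ?_
    rintro rfl
    exact hn.2.1.1 hd

theorem split_word {T : SemistandardYoungTableau lam} {w₁ w₂ : List ℕ} {k : ℕ}
    (h : word T = w₁ ++ k :: w₂) : ∃ c₁ c c₂, readingCells lam = c₁ ++ c :: c₂ ∧ c ∈ lam ∧
      T c.1 c.2 = k ∧ w₁ = (c₁.map fun c => T c.1 c.2) ∧ w₂ = c₂.map fun c => T c.1 c.2 := by
  obtain ⟨c₁, c', h0, h1, h2⟩ := List.map_eq_append_iff.1 h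
  obtain ⟨c, c₂, rfl, h3, h4⟩ := List.map_eq_cons_iff.1 h2
  exact ⟨c₁, c, c₂, h0, mem_readingCells_iff.1 (h0 ▸ by simp), h3, h1.symm, h4.symm⟩

/-- Replacing one `i` by `i + 1` can only fail because of an `i + 1` below or an `i` to the right.
Either would contradict the bracket conditions on the changed letter. -/
theorem exists_word_eq_of_step {i : ℕ} {T : SemistandardYoungTableau lam} {v : List ℕ}
    (h : Step i (word T) v) : ∃ T' : SemistandardYoungTableau lam, v = word T' := by
  obtain ⟨w₁, w₂, hw, rfl, h1, h2⟩ := h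
  obtain ⟨c₁, ⟨x, y⟩, c₂, hs, hc, hT, rfl, rfl⟩ := split_word hw
  simp only at hT
  -- the entry below is not `i + 1`
  have hbelow : (x + 1, y) ∈ lam → T (x + 1) y ≠ i + 1 := by
    intro hd hT'
    obtain ⟨d₁, d₂, rfl, hd2⟩ := split_before hs hd (Or.inr ⟨rfl, by simp⟩)
    have : d₂ = [] := by
      refine List.eq_nil_iff_forall_not_mem.2 fun e he => ?_
      have := hd2 e he
      simp only [ReadBefore] at this
      omega
    subst this
    rw [List.map_append, List.map_cons] at h1
    simp only [hT'] at h1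
    exact absurd h1 (eps_pos_of_split (by simp)).ne'
  -- Such an `i` would make `phi i w₂` positive. Indeed, an `i + 1` read in between would lie below
  -- it in its column, and then the row and column conditions would force an `i + 1` directly below
  -- the changed cell.
  have hright : (x, y + 1) ∈ lam → T x (y + 1) ≠ i := by
    intro hd hT'
    obtain ⟨d₁, d₂, rfl, hd2⟩ := split_after hs hd (Or.inl (by simp))
    rw [List.map_append, List.map_cons] at h2
    simp only [hT'] at h2
    refine absurd h2 (phi_pos_of_split ?_).ne'
    intro z hz
    obtain ⟨⟨x', y'⟩, he, rfl⟩ := List.mem_map.1 hz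
    obtain ⟨hm, he1, he2⟩ := hd2 _ he
    simp only [ReadBefore] at he1 he2 ⊢
    rcases he1 with he1 | ⟨rfl, he1⟩
    · obtain ⟨rfl, he2⟩ : y' = y + 1 ∧ x < x' := by omega
      intro hT2
      have hm1 : (x + 1, y + 1) ∈ lam := lam.up_left_mem (by omega) le_rfl hm
      have e1 : T x (y + 1) < T (x + 1) (y + 1) := T.col_strict (by omega) hm1
      have e2 : T (x + 1) (y + 1) ≤ T x' (y + 1) := T.col_weak (by omega) hm
      have hm2 : (x + 1, y) ∈ lam := lam.up_left_mem le_rfl (by omega) hm1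
      have e3 : T (x + 1) y ≤ T (x + 1) (y + 1) := T.row_weak (by omega) hm1
      have e4 : T x y < T (x + 1) y := T.col_strict (by omega) hm2
      exact hbelow hm2 (by omega)
    · have := T.col_strict he1 hc
      omega
  refine ⟨updateTableau T (x, y) hc (i + 1) ?_ ?_ ?_ ?_, (word_updateTableau hs).symm⟩
  · rintro ⟨x', y'⟩ hd (rfl : x' = x) hy
    simp only at hy ⊢
    have hd1 : (x', y + 1) ∈ lam := lam.up_left_mem le_rfl hy hd
    have e1 : T x' y ≤ T x' (y + 1) := T.row_weak (by omega) hd1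
    have e2 : T x' (y + 1) ≤ T x' y' := T.row_weak_of_le hy hd
    have := hright hd1
    omega
  · intro y' hy
    have : T x y' ≤ T x y := T.row_weak hy hc
    simp only
    omega
  · rintro ⟨x', y'⟩ hd (rfl : y' = y) hx
    simp only at hx ⊢
    have hd1 : (x + 1, y') ∈ lam := lam.up_left_mem hx le_rfl hd
    have e1 : T x y' < T (x + 1) y' := T.col_strict (by omega) hd1
    have e2 : T (x + 1) y' ≤ T x' y' := T.col_weak hx hd
    have := hbelow hd1
    omega
  · intro x' hx
    have : T x' y < T x y := T.col_strict hx hc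
    simp only
    omega

/-- Now the obstructions are an `i` above and an `i + 1` to the left of the changed cell. -/
theorem exists_word_eq_of_step_to {i : ℕ} {T : SemistandardYoungTableau lam} {v : List ℕ}
    (h : Step i v (word T)) : ∃ T' : SemistandardYoungTableau lam, v = word T' := by
  obtain ⟨w₁, w₂, rfl, hw, h1, h2⟩ := h
  obtain ⟨c₁, ⟨x, y⟩, c₂, hs, hc, hT, rfl, rfl⟩ := split_word hw
  simp only at hT
  have habove : ∀ x', x = x' + 1 → T x' y ≠ i := by
    rintro x' rfl hT'
    have hd : (x', y) ∈ lam := lam.up_left_mem (by omega) le_rfl hc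
    obtain ⟨d₁, d₂, rfl, hd2⟩ := split_after hs hd (Or.inr ⟨rfl, by simp⟩)
    have : d₁ = [] := by
      refine List.eq_nil_iff_forall_not_mem.2 fun e he => ?_
      have := hd2 e he
      simp only [ReadBefore] at this
      omega
    subst this
    rw [List.map_append, List.map_cons] at h2
    simp only [hT'] at h2
    exact absurd h2 (phi_pos_of_split (by simp)).ne'
  have hleft : ∀ y', y = y' + 1 → T x y' ≠ i + 1 := by
    rintro y' rfl hT'
    have hd : (x, y') ∈ lam := lam.up_left_mem le_rfl (by omega) hc
    obtain ⟨d₁, d₂, rfl, hd2⟩ := split_before hs hd (Or.inl (by simp))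
    rw [List.map_append, List.map_cons] at h1
    simp only [hT'] at h1
    refine absurd h1 (eps_pos_of_split ?_).ne'
    intro z hz
    obtain ⟨⟨x', y''⟩, he, rfl⟩ := List.mem_map.1 hz
    obtain ⟨hm, he1, he2⟩ := hd2 _ he
    simp only [ReadBefore] at he1 he2 ⊢
    rcases he1 with he1 | ⟨rfl, he1⟩
    · obtain ⟨rfl, he3⟩ : y'' = y' + 1 ∧ x < x' := by omega
      have : T x (y' + 1) < T x' (y' + 1) := T.col_strict he3 hm
      omega
    -- An `i` higher up in the left column would force an `i` directly above the changed cell.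
    · intro hT2
      obtain ⟨x, rfl⟩ : ∃ x'', x = x'' + 1 := ⟨x - 1, by omega⟩
      have hm1 : (x, y' + 1) ∈ lam := lam.up_left_mem (by omega) le_rfl hc
      have e1 : T x (y' + 1) < T (x + 1) (y' + 1) := T.col_strict (by omega) hc
      have hm2 : (x, y') ∈ lam := lam.up_left_mem (by omega) le_rfl hd
      have e2 : T x' y' ≤ T x y' := T.col_weak (by omega) hm2
      have e3 : T x y' ≤ T x (y' + 1) := T.row_weak (by omega) hm1
      exact habove x rfl (by omega)
  refine ⟨updateTableau T (x, y) hc i ?_ ?_ ?_ ?_, (word_updateTableau hs).symm⟩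
  · rintro ⟨x', y'⟩ hd (rfl : x' = x) hy
    simp only at hy ⊢
    have : T x' y ≤ T x' y' := T.row_weak hy hd
    omega
  · intro y' hy
    simp only at hy ⊢
    obtain ⟨y, rfl⟩ : ∃ z, y = z + 1 := ⟨y - 1, by omega⟩
    have e1 : T x y' ≤ T x y :=
      T.row_weak_of_le (by omega) (lam.up_left_mem le_rfl (by omega) hc)
    have e2 : T x y ≤ T x (y + 1) := T.row_weak (by omega) hc
    have := hleft y rfl
    omega
  · rintro ⟨x', y'⟩ hd (rfl : y' = y) hx
    simp only at hx ⊢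
    have : T x y' < T x' y' := T.col_strict hx hd
    omega
  · intro x' hx
    simp only at hx ⊢
    obtain ⟨x, rfl⟩ : ∃ z, x = z + 1 := ⟨x - 1, by omega⟩
    have e1 : T x' y ≤ T x y := T.col_weak (by omega) (lam.up_left_mem (by omega) le_rfl hc)
    have e2 : T x y < T (x + 1) y := T.col_strict (by omega) hc
    have := habove x rfl
    omega

end FilteredRSK

namespace FilteredRSK

/-! ### Highest-weight tableaux -/

theorem eps_pos_mem {i : ℕ} {w : List ℕ} (h : 0 < eps i w) : i + 1 ∈ w := by
  obtain ⟨u, w₁, w₂, -, rfl, -, -⟩ := exists_step_of_eps_pos h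
  simp

theorem phi_pos_mem {i : ℕ} {w : List ℕ} (h : 0 < phi i w) : i ∈ w := by
  obtain ⟨u, w₁, w₂, rfl, -, -, -⟩ := exists_step_of_phi_pos h
  simp

theorem add_le_entry {lam : YoungDiagram} (T : SemistandardYoungTableau lam) {a : ℕ}
    (h : ∀ x y, (x, y) ∈ lam → a ≤ T x y) : ∀ x y, (x, y) ∈ lam → a + x ≤ T x y := by
  intro x
  induction x with
  | zero => exact fun y hy => h 0 y hy
  | succ x ih =>
    intro y hy
    have := ih y (lam.up_left_mem (by omega) le_rfl hy)
    have : T x y < T (x + 1) y := T.col_strict (by omega) hy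
    omega

theorem highestTableau_apply (lam : YoungDiagram) (a x y : ℕ) :
    highestTableau lam a x y = if (x, y) ∈ lam then a + x else 0 := rfl

/-- A tableau with entries at least `a` whose reading word is a source is the highest-weight
tableau. -/
theorem eq_highestTableau {lam : YoungDiagram} (T : SemistandardYoungTableau lam) {a : ℕ}
    (h : ∀ x y, (x, y) ∈ lam → a ≤ T x y) (he : ∀ i, a ≤ i → eps i (word T) = 0) :
    T = highestTableau lam a := by
  have hT := add_le_entry T h
  -- Proceed from the end of the reading word. An entry `k + 1 > a + x` would be unmatched, as no
  -- `k` is read later: such a `k` would lie weakly below and to the right, so that `(x, y + 1)` is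
  -- a cell, and its known value `a + x` bounds the entry.
  have key : ∀ c₂ c₁, readingCells lam = c₁ ++ c₂ → ∀ c ∈ c₂, T c.1 c.2 = a + c.1 := by
    intro c₂
    induction c₂ with
    | nil => simp
    | cons c c₂ ih =>
      intro c₁ hc
      have ih' := ih (c₁ ++ [c]) (by simp [hc])
      refine List.forall_mem_cons.2 ⟨?_, ih'⟩
      by_contra hne
      have hm : c ∈ lam := mem_readingCells_iff.1 (hc ▸ by simp)
      obtain ⟨x, y⟩ := c
      simp only at hne
      have hge := hT x y hm
      obtain ⟨k, hk⟩ : ∃ k, T x y = k + 1 := ⟨T x y - 1, by omega⟩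
      have h0 := he k (by omega)
      rw [word, hc, List.map_append, List.map_cons] at h0
      simp only [hk] at h0
      refine absurd h0 (eps_pos_of_split ?_).ne'
      intro z hz
      obtain ⟨⟨x', y'⟩, hd, rfl⟩ := List.mem_map.1 hz
      have hp := pairwise_readingCells lam
      rw [hc, List.pairwise_append, List.pairwise_cons] at hp
      have hb := hp.2.1.1 _ hd
      have hd' : (x', y') ∈ lam := mem_readingCells_iff.1 (hc ▸ by simp [hd])
      have hv := ih' _ hd
      simp only [ReadBefore] at hb hv ⊢
      rcases hb with hb | ⟨rfl, hb⟩
      · by_cases hx : x ≤ x'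
        · have hd2 : (x, y + 1) ∈ lam := lam.up_left_mem hx hb hd'
          have e1 : T x y ≤ T x (y + 1) := T.row_weak (by omega) hd2
          obtain ⟨d₁, d₂, rfl, -⟩ := split_after hc hd2 (Or.inl (by simp))
          have e2 := ih' (x, y + 1) (by simp)
          simp only at e2
          omega
        · omega
      · omega
  ext x y
  rw [highestTableau_apply]
  split_ifs with hc
  · exact key _ [] rfl (x, y) (mem_readingCells_iff.2 hc)
  · exact T.zeros hc

theorem mem_word_iff {lam : YoungDiagram} {T : SemistandardYoungTableau lam} {k : ℕ} :
    k ∈ word T ↔ ∃ x y, (x, y) ∈ lam ∧ T x y = k := by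
  simp [word, mem_readingCells_iff]

theorem colLen_eq_zero {lam : YoungDiagram} {y : ℕ} (h : lam.rowLen 0 ≤ y) : lam.colLen y = 0 := by
  by_contra hne
  have : (0, y) ∈ lam := YoungDiagram.mem_iff_lt_colLen.2 (by omega)
  have := YoungDiagram.mem_iff_lt_rowLen.1 this
  omega

/-- Empty columns up to `N` are allowed so that two diagrams can be compared column by column. -/
theorem word_highestTableau (lam : YoungDiagram) {N : ℕ} (hN : lam.rowLen 0 ≤ N) :
    word (highestTableau lam 0) =
      (List.range N).flatMap fun y => (List.range (lam.colLen y)).reverse := by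
  obtain ⟨d, rfl⟩ := Nat.exists_eq_add_of_le hN
  rw [List.range_add, List.flatMap_append]
  have h0 : (List.map (fun x => lam.rowLen 0 + x) (List.range d)).flatMap
      (fun y => (List.range (lam.colLen y)).reverse) = [] := by
    rw [List.flatMap_eq_nil_iff]
    intro y hy
    obtain ⟨z, -, rfl⟩ := List.mem_map.1 hy
    rw [colLen_eq_zero (by omega)]
    rfl
  rw [h0, List.append_nil, word, readingCells, List.map_flatMap]
  refine List.flatMap_congr fun y _ => ?_
  rw [List.map_map]
  conv_rhs => rw [← List.map_id (List.range (lam.colLen y)).reverse]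
  refine List.map_congr_left fun x hx => ?_
  have : (x, y) ∈ lam := YoungDiagram.mem_iff_lt_colLen.2 (by simpa using hx)
  simp [highestTableau_apply, this]

theorem count_reverse_range (k c : ℕ) :
    (List.range c).reverse.count k = if k < c then 1 else 0 := by
  rw [List.count_reverse]
  split_ifs with h
  · exact List.count_eq_one_of_mem List.nodup_range (List.mem_range.2 h)
  · exact List.count_eq_zero_of_not_mem (by simpa using h)

theorem sum_range_indicator (N r : ℕ) :
    ((List.range N).map fun y => if y < r then 1 else 0).sum = min N r := by
  induction N with
  | zero => simp
  | succ N ih =>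
    rw [List.range_succ, List.map_append, List.sum_append, ih]
    simp only [List.map_cons, List.map_nil, List.sum_cons, List.sum_nil]
    split_ifs <;> omega

theorem count_word_highestTableau (lam : YoungDiagram) (k : ℕ) :
    (word (highestTableau lam 0)).count k = lam.rowLen k := by
  rw [word_highestTableau lam le_rfl, List.count_flatMap]
  have : (List.count k ∘ fun y => (List.range (lam.colLen y)).reverse) =
      fun y => if y < lam.rowLen k then 1 else 0 := by
    funext y
    simp only [Function.comp, count_reverse_range, ← YoungDiagram.mem_iff_lt_colLen,
      ← YoungDiagram.mem_iff_lt_rowLen]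
  rw [this, sum_range_indicator]
  exact min_eq_right (lam.rowLen_anti 0 k (Nat.zero_le k))

theorem youngDiagram_ext_rowLen {lam mu : YoungDiagram} (h : ∀ k, lam.rowLen k = mu.rowLen k) :
    lam = mu := by
  refine SetLike.ext ?_
  rintro ⟨x, y⟩
  rw [YoungDiagram.mem_iff_lt_rowLen, YoungDiagram.mem_iff_lt_rowLen, h]

theorem reverse_range_succ (c : ℕ) : (List.range (c + 1)).reverse = c :: (List.range c).reverse := by
  simp [List.range_succ]

/-- The letter `y` in front permits the exchange of `x` with the next letter of the column, which
then takes over the role of `y`. -/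
theorem knuthEquiv_down (c : ℕ) : ∀ {y x : ℕ}, c ≤ y → y ≤ x →
    KnuthEquiv (y :: x :: (List.range c).reverse) (y :: ((List.range c).reverse ++ [x])) := by
  induction c with
  | zero => exact fun _ _ => .refl _
  | succ c ih =>
    intro y x h1 h2
    rw [reverse_range_succ]
    have e1 := (knuthEquiv_left (x := c) (y := y) (z := x) (by omega) h2).append_right
      (List.range c).reverse
    exact e1.trans ((ih le_rfl (by omega)).cons y)

/-- A letter passes a column that contains it. -/
theorem knuthEquiv_pass {c x : ℕ} (h : x < c) :
    KnuthEquiv (x :: (List.range c).reverse) ((List.range c).reverse ++ [x]) := by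
  induction c with
  | zero => omega
  | succ c ih =>
    rw [reverse_range_succ]
    -- As long as the head of the column exceeds `x`, the letter after it permits their exchange;
    -- when the head is `x` itself, `knuthEquiv_down` applies.
    rcases Nat.lt_succ_iff_lt_or_eq.1 h with h | rfl
    · obtain ⟨d, rfl⟩ : ∃ d, c = d + 1 := ⟨c - 1, by omega⟩
      refine KnuthEquiv.trans ?_ ((ih h).cons (d + 1))
      rw [reverse_range_succ]
      exact (knuthEquiv_right (x := x) (y := d) (z := d + 1) (by omega) (by omega)).symm.append_right
        (List.range d).reverse
    · exact knuthEquiv_down x le_rfl le_rfl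

theorem knuthEquiv_pass_columns {x : ℕ} (f : ℕ → ℕ) (l : List ℕ) (h : ∀ y ∈ l, x < f y) :
    KnuthEquiv (x :: l.flatMap fun y => (List.range (f y)).reverse)
      ((l.flatMap fun y => (List.range (f y)).reverse) ++ [x]) := by
  induction l with
  | nil => exact .refl _
  | cons y l ih =>
    have h1 := (knuthEquiv_pass (h y List.mem_cons_self)).append_right
      (l.flatMap fun y => (List.range (f y)).reverse)
    have h2 := (ih fun z hz => h z (List.mem_cons_of_mem _ hz)).append_left
      (List.range (f y)).reverse
    simpa using h1.trans (by simpa using h2)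

/-- Adding a cell at the end of row `x`. -/
def addCell (lam : YoungDiagram) (x : ℕ) (h : ∀ x', x = x' + 1 → lam.rowLen x < lam.rowLen x') :
    YoungDiagram where
  cells := insert (x, lam.rowLen x) lam.cells
  isLowerSet := by
    rintro ⟨a, b⟩ ⟨a', b'⟩ hle hm
    simp only [Finset.coe_insert, Set.mem_insert_iff, Finset.mem_coe, YoungDiagram.mem_cells,
      Prod.mk_le_mk, Prod.mk.injEq] at hle hm ⊢
    rcases hm with ⟨rfl, rfl⟩ | hm
    · by_cases ha : a' = a
      · subst ha
        by_cases hb : b' = lam.rowLen a'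
        · exact Or.inl ⟨rfl, hb⟩
        · exact Or.inr (YoungDiagram.mem_iff_lt_rowLen.2 (by omega))
      · right
        obtain ⟨c, rfl⟩ : ∃ c, a = c + 1 := ⟨a - 1, by omega⟩
        have h1 := h c rfl
        have h2 := lam.rowLen_anti a' c (by omega)
        exact YoungDiagram.mem_iff_lt_rowLen.2 (by omega)
    · exact Or.inr (lam.up_left_mem hle.1 hle.2 hm)

theorem mem_addCell {lam : YoungDiagram} {x : ℕ} {h} {c : ℕ × ℕ} :
    c ∈ addCell lam x h ↔ c = (x, lam.rowLen x) ∨ c ∈ lam := by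
  rw [← YoungDiagram.mem_cells, addCell, Finset.mem_insert, YoungDiagram.mem_cells]

theorem colLen_rowLen {lam : YoungDiagram} {x : ℕ}
    (h : ∀ x', x = x' + 1 → lam.rowLen x < lam.rowLen x') : lam.colLen (lam.rowLen x) = x := by
  refine eq_of_forall_lt_iff fun k => ?_
  rw [← YoungDiagram.mem_iff_lt_colLen, YoungDiagram.mem_iff_lt_rowLen]
  constructor
  · intro hk
    by_contra hx
    have := lam.rowLen_anti x k (by omega)
    omega
  · intro hk
    obtain ⟨c, rfl⟩ : ∃ c, x = c + 1 := ⟨x - 1, by omega⟩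
    have h1 := h c rfl
    have h2 := lam.rowLen_anti k c (by omega)
    omega

theorem colLen_addCell {lam : YoungDiagram} {x : ℕ}
    (h : ∀ x', x = x' + 1 → lam.rowLen x < lam.rowLen x') (y : ℕ) :
    (addCell lam x h).colLen y = if y = lam.rowLen x then x + 1 else lam.colLen y := by
  refine eq_of_forall_lt_iff fun k => ?_
  rw [← YoungDiagram.mem_iff_lt_colLen, mem_addCell, YoungDiagram.mem_iff_lt_colLen,
    Prod.mk.injEq]
  split_ifs with hy
  · rw [hy, colLen_rowLen h]
    omega
  · simp [hy]

/-- Each of the first `rowLen x` columns contains `x`, so the letter passes it. The next column has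
length `x`, and `x` in front of it completes a column of length `x + 1`. -/
theorem knuthEquiv_addCell {lam : YoungDiagram} {x : ℕ}
    (h : ∀ x', x = x' + 1 → lam.rowLen x < lam.rowLen x') :
    KnuthEquiv (x :: word (highestTableau lam 0)) (word (highestTableau (addCell lam x h) 0)) := by
  obtain ⟨d, h1, h2⟩ : ∃ d, lam.rowLen 0 ≤ lam.rowLen x + 1 + d ∧
      (addCell lam x h).rowLen 0 ≤ lam.rowLen x + 1 + d :=
    ⟨lam.rowLen 0 + (addCell lam x h).rowLen 0, by omega, by omega⟩
  have hne : ∀ y, y ≠ lam.rowLen x → (addCell lam x h).colLen y = lam.colLen y := fun y hy => by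
    rw [colLen_addCell, if_neg hy]
  rw [word_highestTableau lam h1, word_highestTableau _ h2]
  simp only [List.range_add, List.flatMap_append, List.range_one, List.map_cons, List.map_nil,
    List.flatMap_cons, List.flatMap_nil, List.append_nil, Nat.add_zero]
  rw [colLen_addCell, if_pos rfl, colLen_rowLen h, reverse_range_succ]
  have e1 : (List.range (lam.rowLen x)).flatMap
      (fun y => (List.range ((addCell lam x h).colLen y)).reverse) =
      (List.range (lam.rowLen x)).flatMap fun y => (List.range (lam.colLen y)).reverse :=
    List.flatMap_congr fun y hy => by rw [hne _ (List.mem_range.1 hy).ne]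
  have e2 : (List.map (fun z => lam.rowLen x + 1 + z) (List.range d)).flatMap
      (fun y => (List.range ((addCell lam x h).colLen y)).reverse) =
      (List.map (fun z => lam.rowLen x + 1 + z) (List.range d)).flatMap
        fun y => (List.range (lam.colLen y)).reverse :=
    List.flatMap_congr fun y hy => by
      obtain ⟨z, -, rfl⟩ := List.mem_map.1 hy
      rw [hne _ (by omega)]
  rw [e1, e2]
  have := (knuthEquiv_pass_columns (x := x) lam.colLen (List.range (lam.rowLen x)) fun y hy =>
    YoungDiagram.mem_iff_lt_colLen.1 (YoungDiagram.mem_iff_lt_rowLen.2 (List.mem_range.1 hy))).append_right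
    ((List.range x).reverse ++ (List.map (fun z => lam.rowLen x + 1 + z) (List.range d)).flatMap
        fun y => (List.range (lam.colLen y)).reverse)
  simpa using this

/-! ### The tableau of a Knuth class -/

/-- The hypothesis passes to suffixes, so the word is built from the right. A new letter `x' + 1`
needs an unmatched `x'` after it; then `x'` is more frequent than `x' + 1` in `w`, and a cell may be
added to row `x' + 1`. -/
theorem exists_highestTableau {w : List ℕ} (h : ∀ i, eps i w = 0) :
    ∃ lam, KnuthEquiv (word (highestTableau lam 0)) w := by
  induction w with
  | nil =>
    refine ⟨⊥, ?_⟩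
    rw [word_highestTableau (N := 0) _ (by simp [YoungDiagram.rowLen])]
    exact .refl _
  | cons x w ih =>
    have hw : ∀ i, eps i w = 0 := fun i => by
      have := h i
      rw [eps_cons] at this
      split_ifs at this
      exact this
    obtain ⟨lam, hl⟩ := ih hw
    have hx : ∀ x', x = x' + 1 → lam.rowLen x < lam.rowLen x' := by
      rintro x' rfl
      have h1 := h x'
      rw [eps_cons] at h1
      have h2 := phi_add_count x' w
      rw [hw x', ← hl.perm.count_eq, ← hl.perm.count_eq, count_word_highestTableau,
        count_word_highestTableau] at h2
      have h3 : phi x' w ≠ 0 := fun h0 => by simp [h0] at h1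
      omega
    exact ⟨addCell lam x hx, (knuthEquiv_addCell hx).symm.trans (hl.cons x)⟩

/-- Raising decreases the sum of the letters; the tableau of the raised word is lowered back. -/
theorem exists_tableau (w : List ℕ) : ∃ T : AnyTableau, KnuthEquiv (word T.2) w := by
  induction hn : w.sum using Nat.strong_induction_on generalizing w with
  | _ n ih =>
    by_cases h : ∃ i, 0 < eps i w
    · obtain ⟨i, hi⟩ := h
      obtain ⟨u, hu⟩ := exists_step_of_eps_pos hi
      obtain ⟨⟨lam, T⟩, hT⟩ := ih u.sum (by have := hu.sum_eq; omega) u rfl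
      obtain ⟨v, hv, hv'⟩ := hT.symm.exists_step hu
      obtain ⟨T', rfl⟩ := exists_word_eq_of_step hv
      exact ⟨⟨lam, T'⟩, hv'.symm⟩
    · obtain ⟨lam, hl⟩ := exists_highestTableau (w := w) fun i => by
        by_contra hne
        exact h ⟨i, by omega⟩
      exact ⟨⟨lam, _⟩, hl⟩

/-- Both tableaux are raised in parallel until they are highest-weight tableaux, whose shapes are
given by the common letter counts. -/
theorem tableau_unique {T T' : AnyTableau} (h : KnuthEquiv (word T.2) (word T'.2)) : T = T' := by
  induction hn : (word T.2).sum using Nat.strong_induction_on generalizing T T' with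
  | _ n ih =>
    obtain ⟨lam, T⟩ := T
    obtain ⟨mu, T'⟩ := T'
    simp only at h hn
    by_cases he : ∃ i, 0 < eps i (word T)
    · obtain ⟨i, hi⟩ := he
      obtain ⟨u, hu⟩ := exists_step_of_eps_pos hi
      obtain ⟨u', hu', h'⟩ := h.exists_step_to hu
      obtain ⟨U, rfl⟩ := exists_word_eq_of_step_to hu
      obtain ⟨U', rfl⟩ := exists_word_eq_of_step_to hu'
      have := ih _ (by have := hu.sum_eq; change (word U).sum < n; omega) (T := ⟨lam, U⟩) (T' := ⟨mu, U'⟩) h' rfl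
      cases this
      rw [word_injective lam (hu.right_unique hu')]
    · have h0 : ∀ i, eps i (word T) = 0 := fun i => by
        by_contra hne
        exact he ⟨i, by omega⟩
      have h0' : ∀ i, eps i (word T') = 0 := fun i => by rw [← h.eps_eq, h0]
      have e := eq_highestTableau T (a := 0) (fun _ _ _ => Nat.zero_le _) fun i _ => h0 i
      have e' := eq_highestTableau T' (a := 0) (fun _ _ _ => Nat.zero_le _) fun i _ => h0' i
      subst e e'
      have : lam = mu := youngDiagram_ext_rowLen fun k => by
        rw [← count_word_highestTableau, h.perm.count_eq, count_word_highestTableau]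
      rw [this]

theorem knuthTableau_spec (w : List ℕ) : KnuthEquiv (word (knuthTableau w).2) w :=
  @Classical.epsilon_spec AnyTableau (fun T => KnuthEquiv (word T.2) w) (exists_tableau w)

theorem eq_knuthTableau_iff {T : AnyTableau} {w : List ℕ} :
    T = knuthTableau w ↔ KnuthEquiv (word T.2) w :=
  ⟨fun h => h ▸ knuthTableau_spec w, fun h => tableau_unique (h.trans (knuthTableau_spec w).symm)⟩

theorem knuthTableau_eq_iff {w w' : List ℕ} :
    knuthTableau w = knuthTableau w' ↔ KnuthEquiv w w' := by
  rw [eq_knuthTableau_iff]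
  exact ⟨(knuthTableau_spec w).symm.trans, (knuthTableau_spec w).trans⟩

/-- The lowering operators act on the tableau of a word, preserving the shape. -/
theorem Step.knuthTableau {i : ℕ} {w v : List ℕ} (h : Step i w v) :
    Step i (word (knuthTableau w).2) (word (FilteredRSK.knuthTableau v).2) ∧
      (FilteredRSK.knuthTableau w).1 = (FilteredRSK.knuthTableau v).1 := by
  obtain ⟨u, hu, hu'⟩ := (knuthTableau_spec w).symm.exists_step h
  obtain ⟨T, rfl⟩ := exists_word_eq_of_step hu
  have : (⟨_, T⟩ : AnyTableau) = FilteredRSK.knuthTableau v := eq_knuthTableau_iff.2 hu'.symm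
  rw [← this]
  exact ⟨hu, rfl⟩

end FilteredRSK

namespace FilteredRSK

/-! ### Moving a letter between two rows -/

/-- The list `u` is in relation `r` with the first letters of `v`. -/
def Dom (r : ℕ → ℕ → Prop) : List ℕ → List ℕ → Prop
  | [], _ => True
  | _ :: _, [] => False
  | c :: u, b :: v => r c b ∧ Dom r u v

theorem knuthEquiv_pull {y x : ℕ} {q : List ℕ} (hq : (y :: q).Pairwise (· ≤ ·)) (hx : x < y) :
    KnuthEquiv (y :: (q ++ [x])) (y :: x :: q) := by
  induction q generalizing y with
  | nil => exact .refl _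
  | cons z q ih =>
    obtain ⟨h1, h2⟩ := List.pairwise_cons.1 hq
    have h3 : y ≤ z := h1 z List.mem_cons_self
    exact ((ih h2 (by omega)).cons y).trans ((knuthEquiv_left hx h3).append_right q)

theorem knuthEquiv_push {z y : ℕ} {q : List ℕ} (hq : (q ++ [y]).Pairwise (· ≤ ·)) (hy : y < z) :
    KnuthEquiv (z :: (q ++ [y])) (q ++ [z, y]) := by
  induction q with
  | nil => exact .refl _
  | cons s q ih =>
    rw [List.cons_append, List.pairwise_cons] at hq
    obtain ⟨h1, h2⟩ := hq
    refine KnuthEquiv.trans ?_ ((ih h2).cons s)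
    cases q with
    | nil => exact (knuthEquiv_right (h1 y (by simp)) hy)
    | cons t q =>
      have h3 : t ≤ y := (List.pairwise_cons.1 h2).1 y (by simp)
      exact (knuthEquiv_right (h1 t (by simp)) (by omega)).append_right (q ++ [y])

/-- The head `b` of `v` is pulled next to the head `c` of `u`, which permits the exchange of `a` and
`c`; then `b` plays the role of `a`. Each letter of `u` thus uses up one smaller letter of `v`. -/
theorem knuthEquiv_dom_left {u v : List ℕ} {a : ℕ} (h : Dom (fun c b => b < c) u v)
    (hu : u.Pairwise (· ≤ ·)) (hv : (a :: v).Pairwise (· ≤ ·)) :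
    KnuthEquiv (a :: (u ++ v)) (u ++ a :: v) := by
  induction u generalizing v a with
  | nil => exact .refl _
  | cons c u ih =>
    cases v with
    | nil => exact h.elim
    | cons b v =>
      obtain ⟨hbc, h⟩ := h
      obtain ⟨h1, h2⟩ := List.pairwise_cons.1 hv
      have hab : a ≤ b := h1 b List.mem_cons_self
      have e1 : KnuthEquiv (a :: c :: (u ++ b :: v)) (a :: c :: b :: (u ++ v)) := by
        simpa using ((knuthEquiv_pull hu hbc).append_right v).cons a
      have e2 : KnuthEquiv (a :: c :: b :: (u ++ v)) (c :: a :: b :: (u ++ v)) :=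
        (knuthEquiv_right hab hbc).symm.append_right _
      have e3 : KnuthEquiv (c :: a :: b :: (u ++ v)) (c :: a :: (u ++ b :: v)) :=
        by simpa using (ih h (List.pairwise_cons.1 hu).2 h2).context [c, a] []
      have e4 : KnuthEquiv (c :: (u ++ a :: b :: v)) (c :: a :: (u ++ b :: v)) := by
        simpa using (knuthEquiv_pull hu (show a < c by omega)).append_right (b :: v)
      exact ((e1.trans e2).trans e3).trans e4.symm

/-- Mirror image of `knuthEquiv_dom_left`. The lists are reversed because the comparison starts at
the right ends. -/
theorem knuthEquiv_dom_right_single {u v : List ℕ} {a : ℕ} (h : Dom (fun x y => x < y) v u)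
    (hu : (a :: u).Pairwise (· ≥ ·)) (hv : v.Pairwise (· ≥ ·)) :
    KnuthEquiv (u.reverse ++ [a] ++ v.reverse) (u.reverse ++ v.reverse ++ [a]) := by
  induction v generalizing u a with
  | nil => simpa using KnuthEquiv.refl _
  | cons x v ih =>
    cases u with
    | nil => exact h.elim
    | cons y u =>
      obtain ⟨hxy, h⟩ := h
      obtain ⟨h1, h2⟩ := List.pairwise_cons.1 hu
      have hya : y ≤ a := h1 y List.mem_cons_self
      have hv' : (v.reverse ++ [x]).Pairwise (· ≤ ·) := by
        rw [← List.reverse_cons, List.pairwise_reverse]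
        exact hv
      have e1 := (knuthEquiv_push hv' (show x < a by omega)).append_left (u.reverse ++ [y])
      have e2 := (ih h h2 (List.pairwise_cons.1 hv).2).append_right [a, x]
      have e3 := (knuthEquiv_push hv' hxy).context u.reverse [a]
      have e4 := (knuthEquiv_left hxy hya).append_left (u.reverse ++ v.reverse)
      simp only [List.reverse_cons, List.append_assoc, List.cons_append, List.nil_append]
        at e1 e2 e3 e4 ⊢
      exact (e1.trans e2).trans (e4.trans e3.symm)

theorem dom_cons_right {u v : List ℕ} {c : ℕ} (h : Dom (fun x y => x < y) v u)
    (hu : (c :: u).Pairwise (· ≥ ·)) : Dom (fun x y => x < y) v (c :: u) := by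
  induction v generalizing u c with
  | nil => trivial
  | cons x v ih =>
    cases u with
    | nil => exact h.elim
    | cons y u =>
      obtain ⟨h1, h2⟩ := List.pairwise_cons.1 hu
      exact ⟨lt_of_lt_of_le h.1 (h1 y List.mem_cons_self), ih h.2 h2⟩

/-- The letters of `q` pass one at a time, the last one first; those still in front are counted to
`u`, which preserves domination. -/
theorem knuthEquiv_dom_right {u v q : List ℕ} (h : Dom (fun x y => x < y) v u)
    (hu : (u.reverse ++ q).Pairwise (· ≤ ·)) (hv : v.Pairwise (· ≥ ·)) :
    KnuthEquiv (u.reverse ++ q ++ v.reverse) (u.reverse ++ v.reverse ++ q) := by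
  induction q generalizing u with
  | nil => simpa using KnuthEquiv.refl _
  | cons c q ih =>
    have hc : (c :: u).Pairwise (· ≥ ·) := by
      rw [← List.pairwise_reverse]
      rw [show u.reverse ++ c :: q = (c :: u).reverse ++ q by simp] at hu
      exact (List.pairwise_append.1 hu).1
    have e1 := ih (dom_cons_right h hc) (by simpa using hu)
    have e2 := (knuthEquiv_dom_right_single h hc hv).append_right q
    simp only [List.reverse_cons, List.append_assoc, List.cons_append, List.nil_append]
      at e1 e2 ⊢
    exact e1.trans e2

/-- Moving the letter `a` from the row `u₁ a u₂` to the row `v₁ a v₂` above it. -/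
theorem knuthEquiv_move {u₁ u₂ v₁ v₂ : List ℕ} {a : ℕ} (hu : (u₁ ++ a :: u₂).Pairwise (· ≤ ·))
    (hv : (v₁ ++ a :: v₂).Pairwise (· ≤ ·)) (h1 : Dom (fun x y => x < y) v₁.reverse u₁.reverse)
    (h2 : Dom (fun c b => b < c) u₂ v₂) :
    KnuthEquiv ((u₁ ++ a :: u₂) ++ (v₁ ++ v₂)) ((u₁ ++ u₂) ++ (v₁ ++ a :: v₂)) := by
  obtain ⟨hu1, hu2, hu3⟩ := List.pairwise_append.1 hu
  obtain ⟨hv1, hv2, hv3⟩ := List.pairwise_append.1 hv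
  have hv1' : v₁.reverse.Pairwise (· ≥ ·) := by rwa [List.pairwise_reverse]
  have hu4 : (u₁ ++ u₂).Pairwise (· ≤ ·) :=
    List.pairwise_append.2 ⟨hu1, (List.pairwise_cons.1 hu2).2,
      fun x hx y hy => hu3 x hx y (List.mem_cons_of_mem _ hy)⟩
  -- First `v₁` moves left past `a u₂`, then `a` moves right past `u₂`, finally `v₁` returns past
  -- `u₂`.
  have e1 := (knuthEquiv_dom_right h1 (q := a :: u₂) (by simpa using hu) hv1').append_right v₂
  have e2 := (knuthEquiv_dom_left h2 (List.pairwise_cons.1 hu2).2 hv2).append_left (u₁ ++ v₁)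
  have e3 := (knuthEquiv_dom_right h1 (q := u₂) (by simpa using hu4) hv1').append_right (a :: v₂)
  simp only [List.reverse_reverse, List.append_assoc, List.cons_append] at e1 e2 e3 ⊢
  exact (e1.trans e2).trans e3.symm

/-! ### Lists of cells of a matrix -/

variable {m n : ℕ}

/-- The column-by-column order on the cells of a matrix. -/
def ColMajor (c d : Fin m × Fin n) : Prop := c.2 < d.2 ∨ c.2 = d.2 ∧ c.1 ≤ d.1

/-- The word of row indices of a list of cells. -/
def rowsOf (L : List (Fin m × Fin n)) : List ℕ := L.map fun c => c.1.val + 1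

/-- The column indices of the cells in row `i` (counted from `1`). -/
def colsAt (i : ℕ) (L : List (Fin m × Fin n)) : List ℕ :=
  (L.filter fun c => c.1.val + 1 = i).map fun c => c.2.val + 1

theorem colsAt_cons (i : ℕ) (c : Fin m × Fin n) (L : List (Fin m × Fin n)) :
    colsAt i (c :: L) = if c.1.val + 1 = i then (c.2.val + 1) :: colsAt i L else colsAt i L := by
  simp only [colsAt, List.filter_cons, decide_eq_true_eq]
  split_ifs <;> rfl

theorem colsAt_append (i : ℕ) (L L' : List (Fin m × Fin n)) :
    colsAt i (L ++ L') = colsAt i L ++ colsAt i L' := by simp [colsAt]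

theorem colsAt_reverse (i : ℕ) (L : List (Fin m × Fin n)) :
    colsAt i L.reverse = (colsAt i L).reverse := by simp [colsAt, List.filter_reverse]

theorem pairwise_colsAt {L : List (Fin m × Fin n)} (h : L.Pairwise ColMajor) (i : ℕ) :
    (colsAt i L).Pairwise (· ≤ ·) := by
  rw [colsAt, List.pairwise_map]
  refine (h.filter _).imp fun {c d} h => ?_
  rcases h with h | h
  · exact Nat.succ_le_succ (Fin.le_def.1 h.le)
  · rw [h.1]

/-- The queue `q` holds the columns of the letters `i + 1` still to be paired. Pairing first in,
first out instead of as brackets keeps both lists in order. The inequalities are strict since an `i`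
read after an `i + 1` lies in a later column. -/
theorem dom_left_of_phi {i : ℕ} {L : List (Fin m × Fin n)} (hL : L.Pairwise ColMajor)
    (q : List ℕ) (hq : ∀ b ∈ q, ∀ c ∈ L, c.1.val + 1 = i → b < c.2.val + 1)
    (hphi : phi i (rowsOf L) ≤ q.length) :
    Dom (fun c b => b < c) (colsAt i L) (q ++ colsAt (i + 1) L) := by
  induction L generalizing q with
  | nil => trivial
  | cons c L ih =>
    obtain ⟨h1, h2⟩ := List.pairwise_cons.1 hL
    have hq' : ∀ b ∈ q, ∀ d ∈ L, d.1.val + 1 = i → b < d.2.val + 1 := fun b hb d hd =>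
      hq b hb d (List.mem_cons_of_mem _ hd)
    rw [rowsOf, List.map_cons, phi_cons] at hphi
    rw [colsAt_cons, colsAt_cons]
    by_cases hi : c.1.val + 1 = i
    · rw [if_pos hi] at hphi
      rw [if_pos hi, if_neg (by omega)]
      cases q with
      | nil => simp at hphi
      | cons b q =>
        exact ⟨hq b List.mem_cons_self c List.mem_cons_self hi,
          ih h2 q (fun b' hb' => hq' b' (List.mem_cons_of_mem _ hb'))
            (by simpa [rowsOf] using hphi)⟩
    · rw [if_neg hi] at hphi ⊢
      by_cases hi' : c.1.val + 1 = i + 1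
      · rw [if_pos hi'] at hphi ⊢
        have := ih h2 (q ++ [c.2.val + 1]) (fun b hb d hd hdi => ?_) (by
          rw [List.length_append, List.length_singleton, rowsOf]; omega)
        · simpa using this
        · rcases List.mem_append.1 hb with hb | hb
          · exact hq' b hb d hd hdi
          · obtain rfl := List.mem_singleton.1 hb
            rcases h1 d hd with h | ⟨-, h⟩
            · exact Nat.succ_lt_succ (Fin.lt_def.1 h)
            · have := Fin.le_def.1 h
              omega
      · rw [if_neg hi'] at hphi ⊢
        exact ih h2 q hq' hphi

/-- The same queue argument from the right end, with `q` holding the columns of the letters `i`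
still to be paired. -/
theorem dom_right_of_eps {i : ℕ} {L : List (Fin m × Fin n)}
    (hL : L.Pairwise fun c d => ColMajor d c)
    (q : List ℕ) (hq : ∀ b ∈ q, ∀ c ∈ L, c.1.val + 1 = i + 1 → c.2.val + 1 < b)
    (heps : eps i (rowsOf L.reverse) ≤ q.length) :
    Dom (fun x y => x < y) (colsAt (i + 1) L) (q ++ colsAt i L) := by
  induction L generalizing q with
  | nil => trivial
  | cons c L ih =>
    obtain ⟨h1, h2⟩ := List.pairwise_cons.1 hL
    have hq' : ∀ b ∈ q, ∀ d ∈ L, d.1.val + 1 = i + 1 → d.2.val + 1 < b := fun b hb d hd =>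
      hq b hb d (List.mem_cons_of_mem _ hd)
    rw [rowsOf, List.reverse_cons, List.map_append, List.map_cons, List.map_nil, eps_append,
      eps_single, phi_single] at heps
    rw [colsAt_cons, colsAt_cons]
    by_cases hi : c.1.val + 1 = i + 1
    · rw [if_pos hi, if_neg (by omega)] at heps
      rw [if_pos hi, if_neg (by omega)]
      cases q with
      | nil => simp at heps
      | cons b q =>
        refine ⟨hq b List.mem_cons_self c List.mem_cons_self hi,
          ih h2 q (fun b' hb' => hq' b' (List.mem_cons_of_mem _ hb')) ?_⟩
        rw [List.length_cons] at heps
        rw [rowsOf]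
        omega
    · rw [if_neg hi] at heps ⊢
      by_cases hi' : c.1.val + 1 = i
      · rw [if_pos hi'] at heps ⊢
        have := ih h2 (q ++ [c.2.val + 1]) (fun b hb d hd hdi => ?_) (by
          rw [List.length_append, List.length_singleton, rowsOf]; omega)
        · simpa using this
        · rcases List.mem_append.1 hb with hb | hb
          · exact hq' b hb d hd hdi
          · obtain rfl := List.mem_singleton.1 hb
            rcases h1 d hd with h | ⟨-, h⟩
            · exact Nat.succ_lt_succ (Fin.lt_def.1 h)
            · have := Fin.le_def.1 h
              omega
      · rw [if_neg hi'] at heps ⊢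
        exact ih h2 q hq' (by rw [rowsOf]; omega)

/-! ### The row word of a matrix -/

theorem count_flatMap_finRange {α : Type*} [BEq α] {k : ℕ} (f : Fin k → List α) (a : α) :
    ((List.finRange k).flatMap f).count a = ∑ y, (f y).count a := by
  rw [List.count_flatMap, ← List.sum_ofFn, List.ofFn_eq_map]
  rfl

theorem count_rowCells (M : Matrix (Fin m) (Fin n) ℕ) (c : Fin m × Fin n) :
    (rowCells M).count c = M c.1 c.2 := by
  simp only [rowCells, count_flatMap_finRange, List.count_replicate, beq_iff_eq]
  rw [Finset.sum_eq_single c.2, Finset.sum_eq_single c.1]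
  · simp
  · intro x _ hx
    exact if_neg fun h => hx (by rw [← h])
  · simp
  · intro y _ hy
    exact Finset.sum_eq_zero fun x _ => if_neg fun h => hy (by rw [← h])
  · simp

theorem pairwise_rowCells (M : Matrix (Fin m) (Fin n) ℕ) : (rowCells M).Pairwise ColMajor := by
  rw [rowCells, List.pairwise_flatMap]
  constructor
  · intro y _
    rw [List.pairwise_flatMap]
    constructor
    · intro x _
      exact List.pairwise_replicate.2 (Or.inr (Or.inr ⟨rfl, le_rfl⟩))
    · refine List.pairwise_lt_finRange m |>.imp fun h c hc d hd => ?_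
      rw [List.eq_of_mem_replicate hc, List.eq_of_mem_replicate hd]
      exact Or.inr ⟨rfl, h.le⟩
  · refine List.pairwise_lt_finRange n |>.imp fun h c hc d hd => ?_
    obtain ⟨x, -, hc⟩ := List.mem_flatMap.1 hc
    obtain ⟨x', -, hd⟩ := List.mem_flatMap.1 hd
    rw [List.eq_of_mem_replicate hc, List.eq_of_mem_replicate hd]
    exact Or.inl h

theorem ColMajor.antisymm {c d : Fin m × Fin n} (h : ColMajor c d) (h' : ColMajor d c) : c = d := by
  rcases h with h | ⟨h1, h2⟩ <;> rcases h' with h' | ⟨h1', h2'⟩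
  · exact absurd (h.trans h') (lt_irrefl _)
  · exact absurd (h1' ▸ h) (lt_irrefl _)
  · exact absurd (h1 ▸ h') (lt_irrefl _)
  · exact Prod.ext (le_antisymm h2 h2') h1

theorem eq_of_pairwise_colMajor {L L' : List (Fin m × Fin n)} (h : L.Pairwise ColMajor)
    (h' : L'.Pairwise ColMajor) (hc : ∀ c, L.count c = L'.count c) : L = L' :=
  (List.perm_iff_count.2 hc).eq_of_pairwise (fun _ _ _ _ h1 h2 => h1.antisymm h2) h h'

theorem rowCells_injective : Function.Injective (rowCells (m := m) (n := n)) := by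
  intro M M' h
  ext x y
  rw [← count_rowCells M (x, y), h, count_rowCells]

theorem eq_rowCells {L : List (Fin m × Fin n)} (h : L.Pairwise ColMajor)
    {M : Matrix (Fin m) (Fin n) ℕ} (hM : ∀ c, L.count c = M c.1 c.2) : L = rowCells M :=
  eq_of_pairwise_colMajor h (pairwise_rowCells M) fun c => by rw [hM, count_rowCells]

theorem rowWord_eq (M : Matrix (Fin m) (Fin n) ℕ) : rowWord M = rowsOf (rowCells M) := rfl

/-- Both words are read from one column-major list of cells, so that one splitting of this list
controls both. -/
theorem colWord_eq (M : Matrix (Fin m) (Fin n) ℕ) : colWord M =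
    (List.finRange m).flatMap fun x => colsAt (x.val + 1) (rowCells M) := by
  rw [colWord, colCells, List.map_flatMap]
  refine List.flatMap_congr fun x _ => congrArg _ ?_
  refine eq_of_pairwise_colMajor ?_ ((pairwise_rowCells M).filter _) fun c => ?_
  · rw [List.pairwise_flatMap]
    constructor
    · intro y _
      exact List.pairwise_replicate.2 (Or.inr (Or.inr ⟨rfl, le_rfl⟩))
    · refine List.pairwise_lt_finRange n |>.imp fun h c hc d hd => ?_
      rw [List.eq_of_mem_replicate hc, List.eq_of_mem_replicate hd]
      exact Or.inl h
  · by_cases hx : c.1 = x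
    · subst hx
      rw [List.count_filter (by simp), count_rowCells, count_flatMap_finRange,
        Finset.sum_eq_single c.2]
      · simp
      · intro y _ hy
        rw [List.count_replicate, if_neg]
        simp only [beq_iff_eq]
        exact fun h => hy (by rw [← h])
      · simp
    · rw [List.count_eq_zero_of_not_mem, List.count_eq_zero_of_not_mem]
      · simp only [List.mem_filter, decide_eq_true_eq, not_and]
        exact fun _ h => hx (Fin.ext (by omega))
      · simp only [List.mem_flatMap, List.mem_replicate, not_exists, not_and]
        exact fun y _ _ h => hx (by rw [h])

/-! ### Lowering and raising operators on the list of cells -/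

theorem not_mem_of_phi {c : Fin m × Fin n} {L : List (Fin m × Fin n)}
    (hL : (c :: L).Pairwise ColMajor) (h : phi (c.1.val + 1) (rowsOf L) = 0) : c ∉ L := by
  intro hc
  obtain ⟨d₁, d₂, rfl⟩ := List.append_of_mem hc
  rw [rowsOf, List.map_append, List.map_cons] at h
  refine absurd h (phi_pos_of_split ?_).ne'
  intro z hz
  obtain ⟨e, he, rfl⟩ := List.mem_map.1 hz
  rw [List.pairwise_cons, List.pairwise_append] at hL
  rw [(hL.1 e (by simp [he])).antisymm (hL.2.2.2 e he c List.mem_cons_self)]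
  omega

theorem not_mem_of_eps {i : ℕ} {c : Fin m × Fin n} (hi : c.1.val = i) {L : List (Fin m × Fin n)}
    (hL : (L ++ [c]).Pairwise ColMajor) (h : eps i (rowsOf L) = 0) : c ∉ L := by
  intro hc
  subst hi
  obtain ⟨d₁, d₂, rfl⟩ := List.append_of_mem hc
  rw [rowsOf, List.map_append, List.map_cons] at h
  refine absurd h (eps_pos_of_split ?_).ne'
  intro z hz
  obtain ⟨e, he, rfl⟩ := List.mem_map.1 hz
  rw [List.pairwise_append, List.pairwise_append, List.pairwise_cons] at hL
  rw [← (hL.1.2.1.1 e he).antisymm (hL.2.2 e (by simp [he]) c (by simp))]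
  omega

/-- The replaced copy of `c` is the last one, as a later copy would be an unmatched `)`. The rows of
`c` and `d` are adjacent, so the list stays sorted. -/
theorem pairwise_lower {c d : Fin m × Fin n} (hd : d.2 = c.2) (hd' : d.1.val = c.1.val + 1)
    {c₁ c₂ : List (Fin m × Fin n)} (h : (c₁ ++ c :: c₂).Pairwise ColMajor)
    (h2 : phi (c.1.val + 1) (rowsOf c₂) = 0) : (c₁ ++ d :: c₂).Pairwise ColMajor := by
  rw [List.pairwise_append] at h ⊢
  have hn := not_mem_of_phi h.2.1 h2
  rw [List.pairwise_cons] at h ⊢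
  refine ⟨h.1, ⟨fun e he => ?_, h.2.1.2⟩, fun e he => List.forall_mem_cons.2
    ⟨?_, fun f hf => h.2.2 e he f (List.mem_cons_of_mem _ hf)⟩⟩
  · rcases h.2.1.1 e he with h' | ⟨h3, h4⟩
    · exact Or.inl (hd ▸ h')
    · refine Or.inr ⟨hd.trans h3, ?_⟩
      rw [Fin.le_def] at h4 ⊢
      have : c.1.val ≠ e.1.val := fun h5 => hn (by
        rwa [show c = e from Prod.ext (Fin.ext h5) h3])
      omega
  · rcases h.2.2 e he c List.mem_cons_self with h' | ⟨h3, h4⟩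
    · exact Or.inl (hd ▸ h')
    · refine Or.inr ⟨h3.trans hd.symm, ?_⟩
      rw [Fin.le_def] at h4 ⊢
      omega

theorem pairwise_raise {c d : Fin m × Fin n} (hd : d.2 = c.2) (hd' : d.1.val = c.1.val + 1)
    {c₁ c₂ : List (Fin m × Fin n)} (h : (c₁ ++ d :: c₂).Pairwise ColMajor)
    (h1 : eps (c.1.val + 1) (rowsOf c₁) = 0) : (c₁ ++ c :: c₂).Pairwise ColMajor := by
  have hn : d ∉ c₁ := by
    refine not_mem_of_eps hd' ?_ h1
    rw [show c₁ ++ d :: c₂ = (c₁ ++ [d]) ++ c₂ by simp] at h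
    exact (List.pairwise_append.1 h).1
  rw [List.pairwise_append, List.pairwise_cons] at h ⊢
  refine ⟨h.1, ⟨fun e he => ?_, h.2.1.2⟩, fun e he => List.forall_mem_cons.2
    ⟨?_, fun f hf => h.2.2 e he f (List.mem_cons_of_mem _ hf)⟩⟩
  · rcases h.2.1.1 e he with h' | ⟨h3, h4⟩
    · exact Or.inl (hd ▸ h')
    · refine Or.inr ⟨hd.symm.trans h3, ?_⟩
      rw [Fin.le_def] at h4 ⊢
      omega
  · rcases h.2.2 e he d List.mem_cons_self with h' | ⟨h3, h4⟩
    · exact Or.inl (hd ▸ h')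
    · refine Or.inr ⟨h3.trans hd, ?_⟩
      rw [Fin.le_def] at h4 ⊢
      have : d.1.val ≠ e.1.val := fun h5 => hn (by
        rwa [show d = e from Prod.ext (Fin.ext h5) h3.symm])
      omega

theorem rowCells_moveUnit {M : Matrix (Fin m) (Fin n) ℕ} {c d : Fin m × Fin n} (hd : d.2 = c.2)
    (hd' : d.1.val = c.1.val + 1) {c₁ c₂ : List (Fin m × Fin n)} (h : rowCells M = c₁ ++ c :: c₂)
    (h2 : phi (c.1.val + 1) (rowsOf c₂) = 0) : rowCells (moveUnit M c d) = c₁ ++ d :: c₂ := by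
  refine (eq_rowCells (pairwise_lower hd hd' (h ▸ pairwise_rowCells M) h2) fun e => ?_).symm
  have hM := count_rowCells M e
  have hne : c ≠ d := by
    rintro rfl
    omega
  simp only [h, List.count_append, List.count_cons, beq_iff_eq] at hM ⊢
  simp only [moveUnit, Matrix.of_apply, Prod.mk.eta, ← hM]
  by_cases h3 : e = c
  · subst h3
    simp [hne.symm]
  · by_cases h4 : e = d
    · subst h4
      simp [hne, h3]
      omega
    · simp [h3, h4, Ne.symm h3, Ne.symm h4]

/-- The common context `c₁`, `c₂` makes the description symmetric in `M` and `M'`, so that it serves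
for raising as well. -/
theorem lowerRow_eq_some_iff {i : ℕ} {M M' : Matrix (Fin m) (Fin n) ℕ} :
    lowerRow i M = some M' ↔ ∃ (c d : Fin m × Fin n) (c₁ c₂ : List (Fin m × Fin n)),
      c.1.val + 1 = i ∧ d.1.val = i ∧ d.2 = c.2 ∧ rowCells M = c₁ ++ c :: c₂ ∧
      rowCells M' = c₁ ++ d :: c₂ ∧ eps i (rowsOf c₁) = 0 ∧ phi i (rowsOf c₂) = 0 := by
  simp only [lowerRow, Option.bind_eq_some_iff, lowerPos_eq_some_iff]
  constructor
  · rintro ⟨p, ⟨w₁, w₂, hw, h1, h2, rfl⟩, c, hc, h⟩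
    split_ifs at h with hlt
    obtain ⟨c₁, c', h0, rfl, h4⟩ := List.map_eq_append_iff.1 hw
    obtain ⟨c', c₂, rfl, rfl, rfl⟩ := List.map_eq_cons_iff.1 h4
    rw [List.length_map, h0] at hc
    simp only [List.getElem?_append_right le_rfl, Nat.sub_self,
      List.getElem?_cons_zero, Option.some.injEq] at hc
    subst hc
    refine ⟨c', (⟨c'.1.val + 1, hlt⟩, c'.2), c₁, c₂, rfl, rfl, rfl, h0, ?_, h1, h2⟩
    rw [← Option.some.inj h]
    exact rowCells_moveUnit (c := c') (d := (⟨c'.1.val + 1, hlt⟩, c'.2)) rfl rfl h0 h2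
  · rintro ⟨c, d, c₁, c₂, rfl, hd, hd2, h0, h0', h1, h2⟩
    refine ⟨c₁.length, ⟨rowsOf c₁, rowsOf c₂, ?_, h1, h2, by simp [rowsOf]⟩, c, by simp [h0], ?_⟩
    · rw [rowWord_eq, h0]
      simp [rowsOf]
    · have hlt : c.1.val + 1 < m := hd ▸ d.1.isLt
      rw [dif_pos hlt]
      have : d = (⟨c.1.val + 1, hlt⟩, c.2) := Prod.ext (Fin.ext hd) hd2
      rw [← this]
      exact congrArg some (rowCells_injective ((rowCells_moveUnit hd2 hd h0 h2).trans h0'.symm))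

theorem step_rowWord {i : ℕ} {M M' : Matrix (Fin m) (Fin n) ℕ} (h : lowerRow i M = some M') :
    Step i (rowWord M) (rowWord M') := by
  obtain ⟨c, d, c₁, c₂, rfl, hd, hd2, h0, h0', h1, h2⟩ := lowerRow_eq_some_iff.1 h
  exact ⟨rowsOf c₁, rowsOf c₂, by simp [rowWord_eq, h0, rowsOf], by simp [rowWord_eq, h0', rowsOf, hd],
    h1, h2⟩

theorem exists_lowerRow {i : ℕ} {M : Matrix (Fin m) (Fin n) ℕ} (h : 0 < phi i (rowWord M))
    (hi : i < m) : ∃ M', lowerRow i M = some M' := by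
  obtain ⟨v, w₁, w₂, hw, -, h1, h2⟩ := exists_step_of_phi_pos h
  obtain ⟨c₁, c', h0, rfl, h4⟩ := List.map_eq_append_iff.1 hw
  obtain ⟨c, c₂, rfl, rfl, rfl⟩ := List.map_eq_cons_iff.1 h4
  let d : Fin m × Fin n := (⟨c.1.val + 1, hi⟩, c.2)
  exact ⟨_, lowerRow_eq_some_iff.2 ⟨c, d, c₁, c₂, rfl, rfl, rfl, h0,
    rowCells_moveUnit (c := c) (d := d) rfl rfl h0 h2, h1, h2⟩⟩

/-- Letters start at `1`: for `i = 0` every letter `1` is an unmatched `(`, but there is no row to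
move it to. -/
theorem exists_lowerRow_to {i : ℕ} {M : Matrix (Fin m) (Fin n) ℕ} (h : 0 < eps i (rowWord M))
    (hi : 1 ≤ i) : ∃ M', lowerRow i M' = some M := by
  obtain ⟨v, w₁, w₂, -, hw, h1, h2⟩ := exists_step_of_eps_pos h
  obtain ⟨c₁, c', h0, rfl, h4⟩ := List.map_eq_append_iff.1 hw
  obtain ⟨d, c₂, rfl, hd, rfl⟩ := List.map_eq_cons_iff.1 h4
  obtain ⟨i, rfl⟩ : ∃ k, i = k + 1 := ⟨i - 1, by omega⟩
  let c : Fin m × Fin n := (⟨i, by have := d.1.isLt; omega⟩, d.2)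
  have hL := pairwise_raise (c := c) (d := d) rfl (by simp only [c]; omega)
    (h0 ▸ pairwise_rowCells M) h1
  refine ⟨Matrix.of fun x y => (c₁ ++ c :: c₂).count (x, y), lowerRow_eq_some_iff.2
    ⟨c, d, c₁, c₂, rfl, by omega, rfl, ?_, h0, h1, h2⟩⟩
  exact (eq_rowCells hL fun e => rfl).symm

theorem flatMap_finRange_split {k : ℕ} (x y : Fin k) (hxy : y.val = x.val + 1) :
    ∃ A B, List.finRange k = A ++ x :: y :: B ∧ (∀ z ∈ A, z ≠ x ∧ z ≠ y) ∧
      ∀ z ∈ B, z ≠ x ∧ z ≠ y := by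
  have h1 : (List.finRange k).drop x.val = x :: y :: (List.finRange k).drop (x.val + 1 + 1) := by
    rw [List.drop_eq_getElem_cons (by simp), List.drop_eq_getElem_cons (by simp; omega)]
    simp only [List.getElem_finRange]
    congr 1
    congr 1
    exact Fin.ext hxy.symm
  have h2 : List.finRange k = (List.finRange k).take x.val ++
      x :: y :: (List.finRange k).drop (x.val + 1 + 1) := by
    rw [← h1, List.take_append_drop]
  have hn := List.nodup_finRange k
  refine ⟨_, _, h2, ?_⟩
  rw [h2, List.nodup_append, List.nodup_cons, List.nodup_cons] at hn
  refine ⟨fun z hz => ⟨hn.2.2 z hz x (by simp), hn.2.2 z hz y (by simp)⟩, fun z hz => ⟨?_, ?_⟩⟩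
  · rintro rfl
    exact hn.2.1.1 (List.mem_cons_of_mem _ hz)
  · rintro rfl
    exact hn.2.1.2.1 hz

/-- The row operators preserve the Knuth class of the column word. -/
theorem knuthEquiv_colWord {i : ℕ} {M M' : Matrix (Fin m) (Fin n) ℕ} (h : lowerRow i M = some M') :
    KnuthEquiv (colWord M) (colWord M') := by
  obtain ⟨c, d, c₁, c₂, rfl, hd, hd2, h0, h0', h1, h2⟩ := lowerRow_eq_some_iff.1 h
  obtain ⟨A, B, hAB, hA, hB⟩ := flatMap_finRange_split c.1 d.1 hd
  have hp := h0 ▸ pairwise_rowCells M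
  have hp' := h0' ▸ pairwise_rowCells M'
  have hother : ∀ x : Fin m, x ≠ c.1 ∧ x ≠ d.1 →
      colsAt (x.val + 1) (rowCells M) = colsAt (x.val + 1) (rowCells M') := by
    rintro x ⟨hx1, hx2⟩
    have e1 : c.1.val + 1 ≠ x.val + 1 := fun h => hx1 (Fin.ext (by omega))
    have e2 : d.1.val + 1 ≠ x.val + 1 := fun h => hx2 (Fin.ext (by omega))
    rw [h0, h0', colsAt_append, colsAt_append, colsAt_cons, colsAt_cons, if_neg e1, if_neg e2]
  rw [colWord_eq, colWord_eq, hAB]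
  simp only [List.flatMap_append, List.flatMap_cons]
  rw [List.flatMap_congr fun x hx => hother x (hA x hx),
    List.flatMap_congr fun x hx => hother x (hB x hx)]
  refine KnuthEquiv.append_left ?_ _
  rw [← List.append_assoc, ← List.append_assoc]
  refine KnuthEquiv.append_right ?_ _
  have hu := pairwise_colsAt hp (c.1.val + 1)
  have hv := pairwise_colsAt hp' (c.1.val + 1 + 1)
  rw [h0, h0']
  simp only [hd, hd2, colsAt_append, colsAt_cons, if_true] at hu hv ⊢
  rw [if_neg (by omega), if_neg (by omega)]
  -- The two rows are cut at the moved unit. The conditions `eps = 0` on `c₁` and `phi = 0` on `c₂`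
  -- become the two domination conditions.
  refine knuthEquiv_move hu hv ?_ ?_
  · have := dom_right_of_eps (i := c.1.val + 1) (L := c₁.reverse)
      (List.pairwise_reverse.2 (List.pairwise_append.1 hp).1) [] (by simp) (by simp [h1])
    simpa only [colsAt_reverse, List.nil_append] using this
  · exact dom_left_of_phi (i := c.1.val + 1)
      (List.pairwise_cons.1 (List.pairwise_append.1 hp).2.1).2 [] (by simp) (by simp [h2])

end FilteredRSK

namespace FilteredRSK

variable {m n : ℕ}

/-! ### Transposition -/

theorem colCells_eq (M : Matrix (Fin m) (Fin n) ℕ) :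
    colCells M = (rowCells M.transpose).map Prod.swap := by
  simp only [colCells, rowCells, List.map_flatMap, List.map_replicate, Prod.swap_prod_mk,
    Matrix.transpose_apply]

theorem colWord_eq_rowWord (M : Matrix (Fin m) (Fin n) ℕ) : colWord M = rowWord M.transpose := by
  simp only [colWord, rowWord, colCells_eq, List.map_map]
  rfl

theorem rowWord_eq_colWord (M : Matrix (Fin m) (Fin n) ℕ) : rowWord M = colWord M.transpose := by
  rw [colWord_eq_rowWord, Matrix.transpose_transpose]

theorem moveUnit_transpose (M : Matrix (Fin m) (Fin n) ℕ) (c d : Fin m × Fin n) :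
    (moveUnit M c d).transpose = moveUnit M.transpose c.swap d.swap := by
  have key : ∀ (x : Fin m) (y : Fin n) (e : Fin m × Fin n), (x, y) = e ↔ (y, x) = e.swap := by
    intro x y e
    rw [Prod.ext_iff, Prod.ext_iff]
    exact and_comm
  ext y x
  simp only [moveUnit, Matrix.transpose_apply, Matrix.of_apply, key]

theorem lowerCol_eq (j : ℕ) (M : Matrix (Fin m) (Fin n) ℕ) :
    lowerCol j M = (lowerRow j M.transpose).map Matrix.transpose := by
  rw [lowerCol, lowerRow, ← colWord_eq_rowWord, Option.map_bind]
  congr 1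
  funext p
  simp only [Function.comp, colCells_eq, List.getElem?_map, Option.map_bind, Option.bind_map]
  congr 1
  funext c
  simp only [Prod.fst_swap, Prod.snd_swap]
  split_ifs with h
  · rw [Option.map_some, moveUnit_transpose]
    rfl
  · rfl

theorem lowerCol_eq_some_iff {j : ℕ} {M M' : Matrix (Fin m) (Fin n) ℕ} :
    lowerCol j M = some M' ↔ lowerRow j M.transpose = some M'.transpose := by
  rw [lowerCol_eq, Option.map_eq_some_iff]
  constructor
  · rintro ⟨N, hN, rfl⟩
    exact hN
  · exact fun h => ⟨_, h, rfl⟩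

theorem step_colWord {j : ℕ} {M M' : Matrix (Fin m) (Fin n) ℕ} (h : lowerCol j M = some M') :
    Step j (colWord M) (colWord M') := by
  rw [colWord_eq_rowWord, colWord_eq_rowWord]
  exact step_rowWord (lowerCol_eq_some_iff.1 h)

theorem knuthEquiv_rowWord {j : ℕ} {M M' : Matrix (Fin m) (Fin n) ℕ} (h : lowerCol j M = some M') :
    KnuthEquiv (rowWord M) (rowWord M') := by
  rw [rowWord_eq_colWord, rowWord_eq_colWord]
  exact knuthEquiv_colWord (lowerCol_eq_some_iff.1 h)

theorem exists_lowerCol {j : ℕ} {M : Matrix (Fin m) (Fin n) ℕ} (h : 0 < phi j (colWord M))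
    (hj : j < n) : ∃ M', lowerCol j M = some M' := by
  rw [colWord_eq_rowWord] at h
  obtain ⟨N, hN⟩ := exists_lowerRow h hj
  exact ⟨N.transpose, lowerCol_eq_some_iff.2 hN⟩

theorem exists_lowerCol_to {j : ℕ} {M : Matrix (Fin m) (Fin n) ℕ} (h : 0 < eps j (colWord M))
    (hj : 1 ≤ j) : ∃ M', lowerCol j M' = some M := by
  rw [colWord_eq_rowWord] at h
  obtain ⟨N, hN⟩ := exists_lowerRow_to h hj
  exact ⟨N.transpose, lowerCol_eq_some_iff.2 hN⟩

/-! ### Injectivity of RSK -/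

/-- The sum of the entries weakly below and to the right of the position `(a, b)`. -/
def corner (M : Matrix (Fin m) (Fin n) ℕ) (a b : ℕ) : ℕ :=
  (rowCells M).countP fun c => a ≤ c.1.val ∧ b ≤ c.2.val

/-- Rows are counted from `0`, letters from `1`. Each letter `l + 2` is matched by a later `l + 1`,
which lies in a strictly later column. -/
theorem countP_le_of_eps {l : ℕ} {L : List (Fin m × Fin n)} (hL : L.Pairwise ColMajor)
    (h : eps (l + 1) (rowsOf L) = 0) (b : ℕ) :
    (L.countP fun c => c.1.val = l + 1 ∧ b ≤ c.2.val) ≤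
      L.countP fun c => c.1.val = l ∧ b + 1 ≤ c.2.val := by
  induction L with
  | nil => simp
  | cons c L ih =>
    obtain ⟨h1, h2⟩ := List.pairwise_cons.1 hL
    rw [rowsOf, List.map_cons, eps_cons] at h
    have h0 : eps (l + 1) (rowsOf L) = 0 := by
      split_ifs at h
      exact h
    have h3 := ih h2 h0
    simp only [List.countP_cons, decide_eq_true_eq]
    by_cases hc : c.1.val = l + 1 ∧ b ≤ c.2.val
    -- Since the head is matched, `L` has more letters `l + 1` than `l + 2`, and all those `l + 1`
    -- lie in columns after that of `c`.
    · have h4 : phi (l + 1) (rowsOf L) ≠ 0 := fun h4 => by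
        rw [if_pos ⟨by omega, h4⟩] at h
        omega
      have h5 := phi_add_count (l + 1) (rowsOf L)
      have h6 : (L.countP fun c => c.1.val = l + 1 ∧ b ≤ c.2.val) ≤
          (rowsOf L).count (l + 1 + 1) := by
        rw [List.count, rowsOf, List.countP_map]
        refine List.countP_mono_left fun d _ hd => ?_
        simp only [decide_eq_true_eq, Function.comp, beq_iff_eq] at hd ⊢
        omega
      have h7 : (rowsOf L).count (l + 1) ≤ L.countP fun c => c.1.val = l ∧ b + 1 ≤ c.2.val := by
        rw [List.count, rowsOf, List.countP_map]
        refine List.countP_mono_left fun d hd hd' => ?_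
        simp only [decide_eq_true_eq, Function.comp, beq_iff_eq] at hd' ⊢
        refine ⟨by omega, ?_⟩
        rcases h1 d hd with h8 | ⟨-, h8⟩
        · have := Fin.lt_def.1 h8
          omega
        · have := Fin.le_def.1 h8
          omega
      rw [if_pos hc]
      omega
    · rw [if_neg hc]
      omega

theorem countP_split (L : List (Fin m × Fin n)) (a b : ℕ) :
    (L.countP fun c => a ≤ c.1.val ∧ b ≤ c.2.val) =
      (L.countP fun c => c.1.val = a ∧ b ≤ c.2.val) +
        L.countP fun c => a + 1 ≤ c.1.val ∧ b ≤ c.2.val := by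
  induction L with
  | nil => rfl
  | cons c L ih =>
    simp only [List.countP_cons, decide_eq_true_eq, ih]
    split_ifs <;> omega

/-- Sum `countP_le_of_eps` over the rows from the bottom upwards; `k` bounds the number of rows from
`a` on. -/
theorem corner_le {M : Matrix (Fin m) (Fin n) ℕ} (h : ∀ i, 1 ≤ i → eps i (rowWord M) = 0) (k : ℕ) :
    ∀ a b, m ≤ a + k → corner M (a + 1) b ≤ corner M a (b + 1) := by
  induction k with
  | zero =>
    intro a b ha
    rw [corner, List.countP_eq_zero.2]
    · exact Nat.zero_le _
    · rintro c -
      have := c.1.isLt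
      simp only [decide_eq_true_eq]
      omega
  | succ k ih =>
    intro a b ha
    have h1 := ih (a + 1) b (by omega)
    have h2 := countP_le_of_eps (pairwise_rowCells M) (h (a + 1) (by omega)) b
    have h3 := countP_split (rowCells M) (a + 1) b
    have h4 := countP_split (rowCells M) a (b + 1)
    simp only [corner] at h1 ⊢
    omega

theorem rowCells_perm_colCells (M : Matrix (Fin m) (Fin n) ℕ) :
    (rowCells M).Perm ((rowCells M.transpose).map Prod.swap) := by
  refine List.perm_iff_count.2 fun c => ?_
  rw [count_rowCells]
  have := List.count_map_of_injective (rowCells M.transpose) Prod.swap Prod.swap_injective c.swap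
  rw [Prod.swap_swap, count_rowCells] at this
  rw [this]
  rfl

theorem corner_transpose (M : Matrix (Fin m) (Fin n) ℕ) (a b : ℕ) :
    corner M.transpose b a = corner M a b := by
  rw [corner, corner, (rowCells_perm_colCells M).countP_eq, List.countP_map]
  congr 1
  funext c
  simp only [Function.comp, Prod.fst_swap, Prod.snd_swap, and_comm]

/-- The row condition gives one inequality and, after transposition, the column condition the other.
So corner sums depend only on `a + b`. -/
theorem corner_eq {M : Matrix (Fin m) (Fin n) ℕ} (h : ∀ i, 1 ≤ i → eps i (rowWord M) = 0)
    (h' : ∀ j, 1 ≤ j → eps j (colWord M) = 0) (a b : ℕ) :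
    corner M a (b + 1) = corner M (a + 1) b := by
  refine le_antisymm ?_ (corner_le h m a b (by omega))
  rw [← corner_transpose M a (b + 1), ← corner_transpose M (a + 1) b]
  refine corner_le (M := M.transpose) (fun j hj => ?_) n b a (by omega)
  rw [← colWord_eq_rowWord]
  exact h' j hj

theorem corner_zero (M : Matrix (Fin m) (Fin n) ℕ) (a : ℕ) :
    corner M a 0 = (rowWord M).countP fun x => a + 1 ≤ x := by
  rw [corner, rowWord, List.countP_map]
  congr 1
  funext c
  simp

theorem entry_add_corner (M : Matrix (Fin m) (Fin n) ℕ) (x : Fin m) (y : Fin n) :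
    M x y + corner M (x.val + 1) y.val + corner M x.val (y.val + 1) =
      corner M x.val y.val + corner M (x.val + 1) (y.val + 1) := by
  rw [← count_rowCells M (x, y)]
  simp only [corner]
  induction rowCells M with
  | nil => rfl
  | cons c L ih =>
    have key : c = (x, y) ↔ c.1.val = x.val ∧ c.2.val = y.val := by
      rw [Prod.ext_iff, Fin.ext_iff, Fin.ext_iff]
    simp only [List.countP_cons, List.count_cons, decide_eq_true_eq, beq_iff_eq, key]
    split_ifs <;> omega

/-- By `corner_eq` all corner sums reduce to those with `b = 0`, which count letters of the row
word; inclusion-exclusion recovers the entries. -/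
theorem eq_of_sources {M M' : Matrix (Fin m) (Fin n) ℕ} (hM : ∀ i, 1 ≤ i → eps i (rowWord M) = 0)
    (hM' : ∀ i, 1 ≤ i → eps i (rowWord M') = 0) (hN : ∀ j, 1 ≤ j → eps j (colWord M) = 0)
    (hN' : ∀ j, 1 ≤ j → eps j (colWord M') = 0) (h : (rowWord M).Perm (rowWord M')) : M = M' := by
  have key : ∀ b a, corner M a b = corner M' a b := by
    intro b
    induction b with
    | zero =>
      intro a
      rw [corner_zero, corner_zero, h.countP_eq]
    | succ b ih =>
      intro a
      rw [corner_eq hM hN, corner_eq hM' hN', ih]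
  ext x y
  have h1 := entry_add_corner M x y
  have h2 := entry_add_corner M' x y
  simp only [key] at h1
  omega

/-- A matrix is determined by the Knuth classes of its row word and its column word. -/
theorem eq_of_knuthEquiv {M M' : Matrix (Fin m) (Fin n) ℕ} (h : KnuthEquiv (rowWord M) (rowWord M'))
    (h' : KnuthEquiv (colWord M) (colWord M')) : M = M' := by
  induction hs : (rowWord M).sum + (colWord M).sum using Nat.strong_induction_on
    generalizing M M' with
  | _ k ih =>
    -- Raising both matrices by a row operator preserves both hypotheses, because the column words
    -- stay in their Knuth class; similarly for columns.
    by_cases hr : ∃ i, 1 ≤ i ∧ 0 < eps i (rowWord M)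
    · obtain ⟨i, hi, he⟩ := hr
      obtain ⟨N, hN⟩ := exists_lowerRow_to he hi
      obtain ⟨N', hN'⟩ := exists_lowerRow_to (h.eps_eq i ▸ he) hi
      have h1 := step_rowWord hN
      have h2 := knuthEquiv_colWord hN
      have e : N = N' := ih _ (by rw [← hs, h1.sum_eq, h2.perm.sum_eq]; omega)
        (h.step_to h1 (step_rowWord hN')) ((h2.trans h').trans (knuthEquiv_colWord hN').symm) rfl
      rw [e, hN'] at hN
      exact (Option.some.inj hN).symm
    by_cases hc : ∃ j, 1 ≤ j ∧ 0 < eps j (colWord M)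
    · obtain ⟨j, hj, he⟩ := hc
      obtain ⟨N, hN⟩ := exists_lowerCol_to he hj
      obtain ⟨N', hN'⟩ := exists_lowerCol_to (h'.eps_eq j ▸ he) hj
      have h1 := step_colWord hN
      have h2 := knuthEquiv_rowWord hN
      have e : N = N' := ih _ (by rw [← hs, h1.sum_eq, h2.perm.sum_eq]; omega)
        ((h2.trans h).trans (knuthEquiv_rowWord hN').symm) (h'.step_to h1 (step_colWord hN')) rfl
      rw [e, hN'] at hN
      exact (Option.some.inj hN).symm
    have hr0 : ∀ i, 1 ≤ i → eps i (rowWord M) = 0 := fun i hi => by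
      by_contra hne
      exact hr ⟨i, hi, by omega⟩
    have hc0 : ∀ j, 1 ≤ j → eps j (colWord M) = 0 := fun j hj => by
      by_contra hne
      exact hc ⟨j, hj, by omega⟩
    exact eq_of_sources hr0 (fun i hi => h.eps_eq i ▸ hr0 i hi) hc0
      (fun j hj => h'.eps_eq j ▸ hc0 j hj) h.perm

end FilteredRSK

namespace FilteredRSK

namespace PreCrystalGraph

variable {L : Type}

/-! ### Isomorphisms and components -/

/-- The inverse of an isomorphism. -/
def Iso.symm {G H : PreCrystalGraph L} (e : Iso G H) : Iso H G where
  toEquiv := e.toEquiv.symm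
  isHom := e.isHom_symm
  isHom_symm := e.isHom

/-- The composition of two isomorphisms. -/
def Iso.trans {G H K : PreCrystalGraph L} (e : Iso G H) (e' : Iso H K) : Iso G K where
  toEquiv := e.toEquiv.trans e'.toEquiv
  isHom := ⟨fun v => (e.isHom.cwt_eq v).trans (e'.isHom.cwt_eq _),
    fun l v v' h => e'.isHom.map_edge l _ _ (e.isHom.map_edge l v v' h)⟩
  isHom_symm := ⟨fun v => (e'.isHom_symm.cwt_eq v).trans (e.isHom_symm.cwt_eq _),
    fun l v v' h => e.isHom_symm.map_edge l _ _ (e'.isHom_symm.map_edge l v v' h)⟩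

/-- A bijective homomorphism that reflects edges is an isomorphism. -/
noncomputable def Iso.ofBijective {G H : PreCrystalGraph L} (f : G.V → H.V)
    (hf : Function.Bijective f) (hom : IsHom G H f)
    (hedge : ∀ l v w, H.edge l (f v) (f w) → G.edge l v w) : Iso G H where
  toEquiv := Equiv.ofBijective f hf
  isHom := hom
  isHom_symm := by
    have key : ∀ v, (Equiv.ofBijective f hf).symm (f v) = v :=
      Equiv.ofBijective_symm_apply_apply f hf
    constructor
    · intro u
      obtain ⟨v, rfl⟩ := hf.2 u
      rw [key]
      exact (hom.cwt_eq v).symm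
    · intro l u u' h
      obtain ⟨v, rfl⟩ := hf.2 u
      obtain ⟨v', rfl⟩ := hf.2 u'
      rw [key, key]
      exact hedge l v v' h

theorem Joined.of_edge {G : PreCrystalGraph L} {l : L} {v w : G.V} (h : G.edge l v w) :
    G.Joined v w := .rel _ _ ⟨l, h⟩

/-- A homomorphism that lifts edges in both directions and is injective on components is a local
isomorphism. -/
theorem isLocalIso_of_lift {G H : PreCrystalGraph L} {f : G.V → H.V} (hf : IsHom G H f)
    (hout : ∀ l v u, H.edge l (f v) u → ∃ w, G.edge l v w ∧ f w = u)
    (hin : ∀ l v u, H.edge l u (f v) → ∃ w, G.edge l w v ∧ f w = u)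
    (hinj : ∀ v w, G.Joined v w → f v = f w → v = w) : IsLocalIso G H f := by
  refine ⟨hf, ?_⟩
  rintro _ ⟨v, rfl⟩
  have hmap : ∀ w w', G.Joined w w' → H.Joined (f w) (f w') := by
    intro w w' h
    induction h with
    | rel _ _ h =>
      obtain ⟨l, h⟩ := h
      exact Joined.of_edge (hf.map_edge l _ _ h)
    | refl _ => exact .refl _
    | symm _ _ _ ih => exact .symm _ _ ih
    | trans _ _ _ _ _ ih1 ih2 => exact .trans _ _ _ ih1 ih2
  -- Both directions are lifted at once, to survive the symmetric closure.
  have hlift : ∀ u u', H.Joined u u' →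
      (∀ w, f w = u → ∃ w', G.Joined w w' ∧ f w' = u') ∧
        ∀ w, f w = u' → ∃ w', G.Joined w w' ∧ f w' = u := by
    intro u u' h
    induction h with
    | rel _ _ h =>
      obtain ⟨l, h⟩ := h
      constructor
      · rintro w rfl
        obtain ⟨w', h1, h2⟩ := hout _ _ _ h
        exact ⟨w', Joined.of_edge h1, h2⟩
      · rintro w rfl
        obtain ⟨w', h1, h2⟩ := hin _ _ _ h
        exact ⟨w', (Joined.of_edge h1).symm, h2⟩
    | refl _ => exact ⟨fun w h => ⟨w, .refl _, h⟩, fun w h => ⟨w, .refl _, h⟩⟩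
    | symm _ _ _ ih => exact ih.symm
    | trans _ _ _ _ _ ih1 ih2 =>
      constructor
      · intro w h
        obtain ⟨w', h1, h2⟩ := ih1.1 w h
        obtain ⟨w'', h3, h4⟩ := ih2.1 w' h2
        exact ⟨w'', h1.trans _ _ _ h3, h4⟩
      · intro w h
        obtain ⟨w', h1, h2⟩ := ih2.2 w h
        obtain ⟨w'', h3, h4⟩ := ih1.2 w' h2
        exact ⟨w'', h1.trans _ _ _ h3, h4⟩
  let g : (G.induce {w | G.Joined v w}).V → (H.induce {u | H.Joined (f v) u}).V :=
    fun w => ⟨f w.1, hmap _ _ w.2⟩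
  have hg : Function.Bijective g := by
    constructor
    · rintro ⟨w, hw⟩ ⟨w', hw'⟩ h
      exact Subtype.ext (hinj _ _ (Relation.EqvGen.trans _ _ _ (.symm _ _ hw) hw')
        (congrArg Subtype.val h))
    · rintro ⟨u, hu⟩
      obtain ⟨w, h1, h2⟩ := (hlift _ _ hu).1 v rfl
      exact ⟨⟨w, h1⟩, Subtype.ext h2⟩
  refine ⟨{u | H.Joined (f v) u}, ⟨f v, rfl⟩, Iso.ofBijective g hg
    ⟨fun w => hf.cwt_eq w.1, fun l w w' h => hf.map_edge l _ _ h⟩ ?_, fun w => rfl⟩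
  -- The lift of the edge ends at some `w''` in the component, with the same image as `w'`;
  -- injectivity identifies the two.
  · intro l w w' h
    obtain ⟨w'', h1, h2⟩ := hout l w.1 _ h
    have : w'' = w'.1 := by
      refine hinj _ _ ?_ h2
      exact Relation.EqvGen.trans _ _ _ (Relation.EqvGen.trans _ _ _
        (.symm _ _ (Joined.of_edge h1)) (.symm _ _ w.2)) w'.2
    rw [this] at h1
    exact h1

theorem exists_joined_source {G : PreCrystalGraph L} (size : G.V → ℕ)
    (hs : ∀ l v w, G.edge l v w → size v < size w) (v : G.V) : ∃ w, G.Joined v w ∧ G.IsSource w := by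
  induction hn : size v using Nat.strong_induction_on generalizing v with
  | _ n ih =>
    by_cases h : G.IsSource v
    · exact ⟨v, .refl _, h⟩
    · simp only [IsSource, not_forall, not_not] at h
      obtain ⟨l, u, hu⟩ := h
      obtain ⟨w, h1, h2⟩ := ih _ (hn ▸ hs _ _ _ hu) u rfl
      exact ⟨w, .trans _ _ _ (.symm _ _ (Joined.of_edge hu)) h1, h2⟩

end PreCrystalGraph

/-! ### Filtrations -/

variable {r : ℕ} {i : Fin (r + 1) → ℕ}

/-- The label `l` is the label of an edge in the `k`-th block. -/
def Interior (i : Fin (r + 1) → ℕ) (k : Fin r) (l : ℕ) : Prop :=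
  i k.castSucc + 1 ≤ l ∧ l + 1 ≤ i k.succ

theorem exists_block (h0 : i 0 = 0) {l : ℕ} (h1 : 1 ≤ l) (h2 : l ≤ i (Fin.last r)) :
    ∃ k : Fin r, i k.castSucc + 1 ≤ l ∧ l ≤ i k.succ := by
  by_contra! hne
  have : ∀ k : Fin (r + 1), i k < l := by
    intro k
    induction k using Fin.induction with
    | zero => omega
    | succ k ih => exact hne k ih
  have := this (Fin.last r)
  omega

theorem exists_interior (h0 : i 0 = 0) {l : ℕ} (h1 : 1 ≤ l) (h2 : l < i (Fin.last r))
    (hl : l ∉ Set.range i) : ∃ k : Fin r, Interior i k l := by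
  obtain ⟨k, hk, hk'⟩ := exists_block h0 h1 h2.le
  exact ⟨k, hk, Nat.succ_le_of_lt (lt_of_le_of_ne hk' fun h => hl ⟨_, h.symm⟩)⟩

theorem Interior.lt_last (hi : StrictMono i) {k : Fin r} {l : ℕ} (h : Interior i k l) :
    l < i (Fin.last r) := by
  have := hi.monotone (Fin.le_last k.succ)
  have := h.2
  omega

theorem lt_or_gt_of_ne_block (hi : StrictMono i) {k k' : Fin r} (h : k' ≠ k) :
    i k'.succ ≤ i k.castSucc ∨ i k.succ ≤ i k'.castSucc := by
  rcases lt_or_gt_of_ne h with h | h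
  · exact Or.inl (hi.monotone (Fin.le_def.2 (by simpa using h)))
  · exact Or.inr (hi.monotone (Fin.le_def.2 (by simpa using h)))

theorem Interior.not_mem_range (hi : StrictMono i) {k : Fin r} {l : ℕ} (h : Interior i k l) :
    l ∉ Set.range i := by
  rintro ⟨t, rfl⟩
  have h1 : k.castSucc < t := hi.lt_iff_lt.1 h.1
  have h2 : t < k.succ := hi.lt_iff_lt.1 h.2
  rw [Fin.lt_def] at h1 h2
  simp at h1 h2
  omega

theorem mem_filterWord {w : List ℕ} {k : Fin r} {x : ℕ} :
    x ∈ filterWord i w k ↔ x ∈ w ∧ i k.castSucc + 1 ≤ x ∧ x ≤ i k.succ := by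
  simp [filterWord]

theorem eps_phi_filterWord {k : Fin r} {l : ℕ} (h : Interior i k l) (w : List ℕ) :
    eps l (filterWord i w k) = eps l w ∧ phi l (filterWord i w k) = phi l w := by
  obtain ⟨h1, h2⟩ := h
  exact eps_phi_filter (by simp; omega) (by simp; omega) w

theorem Step.filterWord {k : Fin r} {l : ℕ} (h : Interior i k l) {w v : List ℕ} (hs : Step l w v) :
    Step l (FilteredRSK.filterWord i w k) (FilteredRSK.filterWord i v k) := by
  obtain ⟨h1, h2⟩ := h
  exact hs.filter (by simp; omega) (by simp; omega)

theorem Step.filterWord_eq (hi : StrictMono i) {k k' : Fin r} {l : ℕ} (h : Interior i k l)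
    (hk : k' ≠ k) {w v : List ℕ} (hs : Step l w v) :
    FilteredRSK.filterWord i w k' = FilteredRSK.filterWord i v k' := by
  obtain ⟨h1, h2⟩ := h
  have := lt_or_gt_of_ne_block hi hk
  exact hs.filter_eq (by simp; omega) (by simp; omega)

theorem KnuthEquiv.filterWord {w v : List ℕ} (h : KnuthEquiv w v) (k : Fin r) :
    KnuthEquiv (FilteredRSK.filterWord i w k) (FilteredRSK.filterWord i v k) := by
  refine h.filter _ ?_
  intro x y z
  simp only [decide_eq_true_eq]
  omega

/-- The tableaux of the components of a filtered word. -/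
noncomputable def filterTableaux (i : Fin (r + 1) → ℕ) (w : List ℕ) (k : Fin r) : AnyTableau :=
  knuthTableau (filterWord i w k)

theorem KnuthEquiv.filterTableaux {w v : List ℕ} (h : KnuthEquiv w v) :
    filterTableaux i w = FilteredRSK.filterTableaux i v :=
  funext fun k => knuthTableau_eq_iff.2 (h.filterWord k)

theorem word_filterTableaux (w : List ℕ) (k : Fin r) :
    KnuthEquiv (word (filterTableaux i w k).2) (filterWord i w k) := knuthTableau_spec _

/-- All entries of the tableaux are in the corresponding blocks. -/
def InBlocks (i : Fin (r + 1) → ℕ) (P : Fin r → AnyTableau) : Prop :=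
  ∀ k, ∀ x ∈ word (P k).2, i k.castSucc + 1 ≤ x ∧ x ≤ i k.succ

theorem inBlocks_filterTableaux (w : List ℕ) : InBlocks i (filterTableaux i w) := fun k _ hx =>
  (mem_filterWord.1 ((word_filterTableaux w k).perm.mem_iff.1 hx)).2

/-- The edges of the direct sum in terms of tuples of tableaux. -/
def TupleEdge (l : ℕ) (P Q : Fin r → AnyTableau) : Prop :=
  ∃ k, Step l (word (P k).2) (word (Q k).2) ∧ (P k).1 = (Q k).1 ∧ ∀ k', k' ≠ k → P k' = Q k'

theorem anyTableau_ext {T T' : AnyTableau} (h : T.1 = T'.1) (hw : word T.2 = word T'.2) :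
    T = T' := by
  obtain ⟨lam, T⟩ := T
  obtain ⟨mu, T'⟩ := T'
  obtain rfl : lam = mu := h
  exact congrArg (Sigma.mk lam) (word_injective lam hw)

theorem Step.filterTableaux (hi : StrictMono i) {k : Fin r} {l : ℕ} (h : Interior i k l)
    {w v : List ℕ} (hs : Step l w v) :
    Step l (word (filterTableaux i w k).2) (word (FilteredRSK.filterTableaux i v k).2) ∧
      (FilteredRSK.filterTableaux i w k).1 = (FilteredRSK.filterTableaux i v k).1 ∧
      ∀ k', k' ≠ k → FilteredRSK.filterTableaux i w k' = FilteredRSK.filterTableaux i v k' := by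
  obtain ⟨h1, h2⟩ := (hs.filterWord h).knuthTableau
  exact ⟨h1, h2, fun k' hk => congrArg FilteredRSK.knuthTableau (hs.filterWord_eq hi h hk)⟩

theorem TupleEdge.interior {l : ℕ} {P Q : Fin r → AnyTableau} (h : TupleEdge l P Q)
    (hP : InBlocks i P) (hQ : InBlocks i Q) : ∃ k, Interior i k l ∧
      Step l (word (P k).2) (word (Q k).2) ∧ (P k).1 = (Q k).1 ∧ ∀ k', k' ≠ k → P k' = Q k' := by
  obtain ⟨k, h1, h2⟩ := h
  exact ⟨k, ⟨(hP k l (phi_pos_mem h1.phi_pos)).1, (hQ k _ (eps_pos_mem h1.eps_pos)).2⟩, h1, h2⟩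

/-- The tableau, the filtered word and `w` have the same `phi`, so `w` admits the step;
single-valuedness of lowering identifies its image with `Q`. -/
theorem TupleEdge.lift (hi : StrictMono i) {l : ℕ} {w : List ℕ} {Q : Fin r → AnyTableau}
    (h : TupleEdge l (filterTableaux i w) Q) (hQ : InBlocks i Q) :
    ∃ k v, Interior i k l ∧ Step l w v ∧ filterTableaux i v = Q := by
  obtain ⟨k, hk, h1, h2, h3⟩ := h.interior (inBlocks_filterTableaux w) hQ
  have hpos := h1.phi_pos
  rw [(word_filterTableaux w k).phi_eq, (eps_phi_filterWord hk w).2] at hpos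
  obtain ⟨v, hv⟩ := exists_step_of_phi_pos hpos
  obtain ⟨e1, e2, e3⟩ := hv.filterTableaux hi hk
  refine ⟨k, v, hk, hv, funext fun k' => ?_⟩
  by_cases hkk : k' = k
  · subst hkk
    exact anyTableau_ext (e2.symm.trans h2) (e1.right_unique h1)
  · rw [← e3 k' hkk, h3 k' hkk]

theorem TupleEdge.lift_to (hi : StrictMono i) {l : ℕ} {w : List ℕ} {Q : Fin r → AnyTableau}
    (h : TupleEdge l Q (filterTableaux i w)) (hQ : InBlocks i Q) :
    ∃ k v, Interior i k l ∧ Step l v w ∧ filterTableaux i v = Q := by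
  obtain ⟨k, hk, h1, h2, h3⟩ := h.interior hQ (inBlocks_filterTableaux w)
  have hpos := h1.eps_pos
  rw [(word_filterTableaux w k).eps_eq, (eps_phi_filterWord hk w).1] at hpos
  obtain ⟨v, hv⟩ := exists_step_of_eps_pos hpos
  obtain ⟨e1, e2, e3⟩ := hv.filterTableaux hi hk
  refine ⟨k, v, hk, hv, funext fun k' => ?_⟩
  by_cases hkk : k' = k
  · subst hkk
    exact anyTableau_ext (e2.trans h2.symm) (e1.left_unique h1)
  · rw [e3 k' hkk, h3 k' hkk]

/-- The word `w` is a source for the operators with labels in the interior of the blocks. -/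
def IsBlockSource (i : Fin (r + 1) → ℕ) (w : List ℕ) : Prop :=
  ∀ k l, Interior i k l → eps l w = 0

theorem eq_highest_of_eps {T : AnyTableau} {k : Fin r}
    (hT : ∀ x ∈ word T.2, i k.castSucc + 1 ≤ x ∧ x ≤ i k.succ)
    (h : ∀ l, Interior i k l → eps l (word T.2) = 0) :
    T = ⟨T.1, highestTableau T.1 (i k.castSucc + 1)⟩ := by
  obtain ⟨lam, T⟩ := T
  refine congrArg (Sigma.mk lam) (eq_highestTableau T (fun x y hxy =>
    (hT _ (mem_word_iff.2 ⟨x, y, hxy, rfl⟩)).1) fun l hl => ?_)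
  by_contra hne
  have := (hT _ (eps_pos_mem (Nat.pos_of_ne_zero hne))).2
  exact hne (h l ⟨hl, this⟩)

theorem IsBlockSource.filterTableaux {w : List ℕ} (h : IsBlockSource i w) (k : Fin r) :
    filterTableaux i w k = ⟨(FilteredRSK.filterTableaux i w k).1,
      highestTableau (FilteredRSK.filterTableaux i w k).1 (i k.castSucc + 1)⟩ :=
  eq_highest_of_eps (inBlocks_filterTableaux w k) fun l hl => by
    rw [(word_filterTableaux w k).eps_eq, (eps_phi_filterWord hl w).1, h k l hl]

/-! ### Suffixes and the uniqueness of sources -/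

theorem eps_drop {l : ℕ} {w : List ℕ} (h : eps l w = 0) (q : ℕ) : eps l (w.drop q) = 0 := by
  rw [← List.take_append_drop q w, eps_append] at h
  omega

theorem Step.drop {l : ℕ} {w v : List ℕ} (h : Step l w v) (q : ℕ) :
    Step l (w.drop q) (v.drop q) ∨ w.drop q = v.drop q := by
  obtain ⟨w₁, w₂, rfl, rfl, h1, h2⟩ := h
  rcases le_or_gt q w₁.length with hq | hq
  · left
    exact ⟨w₁.drop q, w₂, List.drop_append_of_le_length hq, List.drop_append_of_le_length hq,
      eps_drop h1 q, h2⟩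
  · right
    obtain ⟨d, rfl⟩ : ∃ d, q = w₁.length + (d + 1) := ⟨q - w₁.length - 1, by omega⟩
    simp [List.drop_append]

theorem eq_of_forall_drop_perm {w w' : List ℕ} (h : ∀ q, (w.drop q).Perm (w'.drop q)) : w = w' := by
  induction w generalizing w' with
  | nil => exact (h 0).nil_eq
  | cons x w ih =>
    cases w' with
    | nil => exact (h 0).eq_nil
    | cons y w' =>
      obtain rfl := ih fun q => h (q + 1)
      have := (h 0).sum_eq
      simp only [List.drop_zero, List.sum_cons] at this
      rw [show x = y by omega]

/-- Two sources in the same component of the filtered word graph are equal. -/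
theorem eq_of_isBlockSource (hi : StrictMono i) (h0 : i 0 = 0) {w w' : List ℕ}
    (h : Relation.EqvGen (fun u v => ∃ k l, Interior i k l ∧ Step l u v) w w')
    (hw : IsBlockSource i w) (hw' : IsBlockSource i w')
    (hr : ∀ x ∈ w, 1 ≤ x ∧ x ≤ i (Fin.last r)) (hr' : ∀ x ∈ w', 1 ≤ x ∧ x ≤ i (Fin.last r)) :
    w = w' := by
  -- These shapes play the role of a recording tableau: a step acts on a suffix as a step or not at
  -- all, and steps preserve shapes.
  have key : ∀ q k, (filterTableaux i (w.drop q) k).1 = (filterTableaux i (w'.drop q) k).1 := by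
    clear hw hw' hr hr'
    intro q k
    induction h with
    | rel u v h =>
      obtain ⟨k', l, hl, hs⟩ := h
      rcases hs.drop q with hs | hs
      · obtain ⟨-, h2, h3⟩ := hs.filterTableaux hi hl
        by_cases hk : k = k'
        · exact hk ▸ h2
        · rw [h3 k hk]
      · rw [hs]
    | refl _ => rfl
    | symm _ _ _ ih => exact ih.symm
    | trans _ _ _ _ _ ih1 ih2 => exact ih1.trans ih2
  refine eq_of_forall_drop_perm fun q => List.perm_iff_count.2 fun x => ?_
  by_cases hx : 1 ≤ x ∧ x ≤ i (Fin.last r)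
  · obtain ⟨k, hk⟩ := exists_block h0 hx.1 hx.2
    -- Suffixes of sources are sources, so their tableaux are highest-weight ones and the shapes
    -- determine how often each letter occurs.
    have e1 : IsBlockSource i (w.drop q) := fun k l hl => eps_drop (hw k l hl) q
    have e2 : IsBlockSource i (w'.drop q) := fun k l hl => eps_drop (hw' k l hl) q
    have e3 : filterTableaux i (w.drop q) k = filterTableaux i (w'.drop q) k := by
      rw [e1.filterTableaux, e2.filterTableaux, key]
    have e4 := (knuthTableau_eq_iff.1 e3).perm.count_eq x
    rwa [filterWord, filterWord, List.count_filter (by simpa using hk),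
      List.count_filter (by simpa using hk)] at e4
  · rw [List.count_eq_zero_of_not_mem fun h => hx (hr x (List.mem_of_mem_drop h)),
      List.count_eq_zero_of_not_mem fun h => hx (hr' x (List.mem_of_mem_drop h))]

/-! ### Weights -/

theorem flatten_range' (hi : Monotone i) :
    (List.ofFn fun k : Fin r => List.range' (i k.castSucc + 1)
      (i k.succ + 1 - (i k.castSucc + 1))).flatten =
      List.range' (i 0 + 1) (i (Fin.last r) - i 0) := by
  induction r with
  | zero => simp
  | succ r ih =>
    rw [List.ofFn_succ', List.concat_eq_append, List.flatten_append, List.flatten_singleton]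
    have := ih (i := fun k => i k.castSucc) fun a b h => hi h
    simp only [← Fin.succ_castSucc] at this ⊢
    rw [this, Fin.succ_last]
    have h1 : i 0 ≤ i (Fin.last r).castSucc := hi (Fin.zero_le _)
    have h2 : i (Fin.last r).castSucc ≤ i (Fin.last (r + 1)) := hi (Fin.le_last _)
    rw [show i (Fin.last r).castSucc + 1 = (i 0 + 1) + (i (Fin.last r).castSucc - i 0) by omega]
    simp only [Fin.castSucc_zero]
    rw [List.range'_append_1]
    congr 1
    have h3 : i (Fin.last r.succ) = i (Fin.last (r + 1)) := rfl
    omega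

theorem weight_filterTableaux (hi : StrictMono i) (h0 : i 0 = 0) (w : List ℕ) :
    ((List.range' 1 (i (Fin.last r))).map fun x => w.count x) =
      (List.ofFn fun k : Fin r => (List.range' (i k.castSucc + 1)
        (i k.succ + 1 - (i k.castSucc + 1))).map fun x =>
          (word (filterTableaux i w k).2).count x).flatten := by
  have h1 := flatten_range' hi.monotone
  rw [h0, Nat.sub_zero, Nat.zero_add] at h1
  rw [← h1, List.map_flatten, List.map_ofFn]
  congr 2
  funext k
  refine List.map_congr_left fun x hx => ?_
  rw [List.mem_range'_1] at hx
  rw [(word_filterTableaux w k).perm.count_eq, filterWord, List.count_filter]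
  simp only [decide_eq_true_eq]
  omega

end FilteredRSK

namespace FilteredRSK

variable {m n r s : ℕ} {i : Fin (r + 1) → ℕ} {j : Fin (s + 1) → ℕ}

/-! ### The vertices and edges of the direct sum -/

theorem tableaux_injective : Function.Injective (tableaux i j) := by
  rintro ⟨⟨lam, mu⟩, u, v⟩ ⟨⟨lam', mu'⟩, u', v'⟩ h
  have h1 : ∀ k, (⟨(lam k).1, (u k).1⟩ : AnyTableau) = ⟨(lam' k).1, (u' k).1⟩ :=
    congrFun (congrArg Prod.fst h)
  have h2 : ∀ k, (⟨(mu k).1, (v k).1⟩ : AnyTableau) = ⟨(mu' k).1, (v' k).1⟩ :=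
    congrFun (congrArg Prod.snd h)
  obtain rfl : lam = lam' := funext fun k => Subtype.ext (congrArg Sigma.fst (h1 k))
  obtain rfl : mu = mu' := funext fun k => Subtype.ext (congrArg Sigma.fst (h2 k))
  obtain rfl : u = u' := funext fun k => Subtype.ext (eq_of_heq (Sigma.mk.inj (h1 k)).2)
  obtain rfl : v = v' := funext fun k => Subtype.ext (eq_of_heq (Sigma.mk.inj (h2 k)).2)
  rfl

theorem inBlocks_tableaux_fst (v : (tableauPairSum i j).V) : InBlocks i (tableaux i j v).1 := by
  intro k x hx
  obtain ⟨a, b, h, rfl⟩ := mem_word_iff.1 hx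
  exact (v.2.1 k).2 a b h

theorem inBlocks_tableaux_snd (v : (tableauPairSum i j).V) : InBlocks j (tableaux i j v).2 := by
  intro k x hx
  obtain ⟨a, b, h, rfl⟩ := mem_word_iff.1 hx
  exact (v.2.2 k).2 a b h

theorem filteredTableauGraph_edge_iff {lam : PartitionTuple i} {l : ℕ}
    {u u' : (filteredTableauGraph i lam).V} : (filteredTableauGraph i lam).edge l u u' ↔
      ∃ k, Step l (word (u k).1) (word (u' k).1) ∧ ∀ k', k' ≠ k → u k' = u' k' := by
  constructor
  · rintro ⟨⟨k, l⟩, rfl, h1, h2⟩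
    exact ⟨k, lower_eq_some_iff.1 h1, h2⟩
  · rintro ⟨k, h1, h2⟩
    exact ⟨⟨k, l⟩, rfl, lower_eq_some_iff.2 h1, h2⟩

theorem tupleEdge_iff {lam : PartitionTuple i} {l : ℕ} {u u' : (filteredTableauGraph i lam).V} :
    (filteredTableauGraph i lam).edge l u u' ↔
      TupleEdge l (fun k => (⟨(lam k).1, (u k).1⟩ : AnyTableau)) fun k => ⟨(lam k).1, (u' k).1⟩ := by
  rw [filteredTableauGraph_edge_iff]
  constructor
  · rintro ⟨k, h1, h2⟩
    exact ⟨k, h1, rfl, fun k' hk =>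
      congrArg (fun t => (⟨(lam k').1, t.1⟩ : AnyTableau)) (h2 k' hk)⟩
  · rintro ⟨k, h1, -, h2⟩
    exact ⟨k, h1, fun k' hk => Subtype.ext (eq_of_heq (Sigma.mk.inj (h2 k' hk)).2)⟩

theorem TupleEdge.shape_eq {l : ℕ} {P Q : Fin r → AnyTableau} (h : TupleEdge l P Q) (k : Fin r) :
    (P k).1 = (Q k).1 := by
  obtain ⟨k', -, h1, h2⟩ := h
  by_cases hk : k = k'
  · exact hk ▸ h1
  · rw [h2 k hk]

theorem shape_eq_of_tableaux {v v' : (tableauPairSum i j).V}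
    (h1 : ∀ k, ((tableaux i j v).1 k).1 = ((tableaux i j v').1 k).1)
    (h2 : ∀ k, ((tableaux i j v).2 k).1 = ((tableaux i j v').2 k).1) : v.1 = v'.1 :=
  Prod.ext (funext fun k => Subtype.ext (h1 k)) (funext fun k => Subtype.ext (h2 k))

theorem directSum_edge_iff {x : PartitionTuple i × PartitionTuple j} {l : ℕ ⊕ ℕ}
    {u u' : (tableauPairGraph i j x).V} :
    (tableauPairSum i j).edge l ⟨x, u⟩ ⟨x, u'⟩ ↔ (tableauPairGraph i j x).edge l u u' := by
  constructor
  · rintro ⟨y, w, w', h1, h2, h⟩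
    cases h1
    cases h2
    exact h
  · exact fun h => ⟨x, u, u', rfl, rfl, h⟩

theorem tableauPairSum_edge_fst {l : ℕ ⊕ ℕ} {v v' : (tableauPairSum i j).V}
    (h : (tableauPairSum i j).edge l v v') : v.1 = v'.1 := by
  obtain ⟨x, u, u', rfl, rfl, -⟩ := h
  rfl

theorem edge_inl_iff {l : ℕ} {v v' : (tableauPairSum i j).V} :
    (tableauPairSum i j).edge (Sum.inl l) v v' ↔
      TupleEdge l (tableaux i j v).1 (tableaux i j v').1 ∧
        (tableaux i j v).2 = (tableaux i j v').2 := by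
  constructor
  · rintro ⟨x, ⟨u, w⟩, ⟨u', w'⟩, rfl, rfl, h1, h2⟩
    obtain rfl : w = w' := h2
    exact ⟨tupleEdge_iff.1 h1, rfl⟩
  · rintro ⟨h1, h2⟩
    have hx := shape_eq_of_tableaux h1.shape_eq fun k => congrArg Sigma.fst (congrFun h2 k)
    obtain ⟨x, u, w⟩ := v
    obtain ⟨x', u', w'⟩ := v'
    obtain rfl : x = x' := hx
    refine directSum_edge_iff.2 ⟨tupleEdge_iff.2 h1, funext fun k => Subtype.ext ?_⟩
    exact eq_of_heq (Sigma.mk.inj (congrFun h2 k)).2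

theorem edge_inr_iff {l : ℕ} {v v' : (tableauPairSum i j).V} :
    (tableauPairSum i j).edge (Sum.inr l) v v' ↔
      (tableaux i j v).1 = (tableaux i j v').1 ∧
        TupleEdge l (tableaux i j v).2 (tableaux i j v').2 := by
  constructor
  · rintro ⟨x, ⟨u, w⟩, ⟨u', w'⟩, rfl, rfl, h1, h2⟩
    obtain rfl : u = u' := h1
    exact ⟨rfl, tupleEdge_iff.1 h2⟩
  · rintro ⟨h1, h2⟩
    have hx := shape_eq_of_tableaux (fun k => congrArg Sigma.fst (congrFun h1 k)) h2.shape_eq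
    obtain ⟨x, u, w⟩ := v
    obtain ⟨x', u', w'⟩ := v'
    obtain rfl : x = x' := hx
    refine directSum_edge_iff.2 ⟨funext fun k => Subtype.ext ?_, tupleEdge_iff.2 h2⟩
    exact eq_of_heq (Sigma.mk.inj (congrFun h1 k)).2

/-! ### Filtered RSK as a map to the vertices of the direct sum -/

theorem entry_filterTableaux (w : List ℕ) (k : Fin r) (x y : ℕ)
    (h : (x, y) ∈ (filterTableaux i w k).1) :
    i k.castSucc + 1 ≤ (filterTableaux i w k).2 x y ∧ (filterTableaux i w k).2 x y ≤ i k.succ :=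
  inBlocks_filterTableaux w k _ (mem_word_iff.2 ⟨x, y, h, rfl⟩)

/-- By column strictness the entry in row `x`, counted from `0`, is at least `i k.castSucc + 1 + x`,
but it is at most `i k.succ`. -/
theorem colLen_filterTableaux (w : List ℕ) (k : Fin r) :
    (filterTableaux i w k).1.colLen 0 ≤ i k.succ - i k.castSucc := by
  rcases Nat.eq_zero_or_pos ((filterTableaux i w k).1.colLen 0) with h0 | h0
  · omega
  · obtain ⟨x, hx⟩ : ∃ x, (filterTableaux i w k).1.colLen 0 = x + 1 :=
      ⟨(filterTableaux i w k).1.colLen 0 - 1, by omega⟩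
    have hm : (x, 0) ∈ (filterTableaux i w k).1 := YoungDiagram.mem_iff_lt_colLen.2 (by omega)
    have h1 := add_le_entry (filterTableaux i w k).2 (a := i k.castSucc + 1)
      (fun x y h => (entry_filterTableaux w k x y h).1) x 0 hm
    have h2 := (entry_filterTableaux w k x 0 hm).2
    omega

/-- The shapes of the tableaux of a filtered word. -/
noncomputable def filterShape (i : Fin (r + 1) → ℕ) (w : List ℕ) : PartitionTuple i :=
  fun k => ⟨(filterTableaux i w k).1, colLen_filterTableaux w k⟩

/-- The tableaux of a filtered word as a vertex of the filtered tableau graph. -/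
noncomputable def filterVertex (i : Fin (r + 1) → ℕ) (w : List ℕ) :
    (filteredTableauGraph i (filterShape i w)).V :=
  fun k => ⟨(filterTableaux i w k).2, entry_filterTableaux w k⟩

/-- Filtered RSK with values in the vertices of the direct sum. -/
noncomputable def filterRSKVertex (i : Fin (r + 1) → ℕ) (j : Fin (s + 1) → ℕ)
    (M : (filteredMatrixGraph m n i j).V) : (tableauPairSum i j).V :=
  ⟨(filterShape i (rowWord (m := m) (n := n) M), filterShape j (colWord (m := m) (n := n) M)),
    filterVertex i (rowWord (m := m) (n := n) M), filterVertex j (colWord (m := m) (n := n) M)⟩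

theorem tableaux_filterRSKVertex (M : Matrix (Fin m) (Fin n) ℕ) :
    tableaux i j (filterRSKVertex i j M) = filterRSK i j M := rfl

theorem isFilterRSK_iff (M : Matrix (Fin m) (Fin n) ℕ)
    (T : (Fin r → AnyTableau) × (Fin s → AnyTableau)) :
    IsFilterRSK i j M T ↔ T = filterRSK i j M := by
  simp only [IsFilterRSK, Prod.ext_iff, funext_iff, filterRSK, eq_knuthTableau_iff]

/-! ### Edges of the filtered matrix graph -/

theorem filteredMatrixGraph_edge_inl {l : ℕ} {M M' : Matrix (Fin m) (Fin n) ℕ} :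
    (filteredMatrixGraph m n i j).edge (Sum.inl l) M M' ↔
      l ∉ Set.range i ∧ lowerRow l M = some M' := by
  change ¬ _ ∧ _ ↔ _
  simp [matrixGraph]

theorem filteredMatrixGraph_edge_inr {l : ℕ} {M M' : Matrix (Fin m) (Fin n) ℕ} :
    (filteredMatrixGraph m n i j).edge (Sum.inr l) M M' ↔
      l ∉ Set.range j ∧ lowerCol l M = some M' := by
  change ¬ _ ∧ _ ↔ _
  simp [matrixGraph]

theorem lowerRow_bounds {l : ℕ} {M M' : Matrix (Fin m) (Fin n) ℕ} (h : lowerRow l M = some M') :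
    1 ≤ l ∧ l < m := by
  obtain ⟨c, hc, rfl, -⟩ := lowerRow_spec h
  omega

theorem lowerCol_bounds {l : ℕ} {M M' : Matrix (Fin m) (Fin n) ℕ} (h : lowerCol l M = some M') :
    1 ≤ l ∧ l < n := by
  obtain ⟨c, hc, rfl, -⟩ := lowerCol_spec h
  omega

theorem rowWord_bounds (M : Matrix (Fin m) (Fin n) ℕ) : ∀ x ∈ rowWord M, 1 ≤ x ∧ x ≤ m := by
  intro x hx
  obtain ⟨c, -, rfl⟩ := List.mem_map.1 hx
  omega

theorem colWord_bounds (M : Matrix (Fin m) (Fin n) ℕ) : ∀ x ∈ colWord M, 1 ≤ x ∧ x ≤ n := by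
  intro x hx
  obtain ⟨c, -, rfl⟩ := List.mem_map.1 hx
  omega

/-- The size of a matrix, which increases along the edges. -/
def matrixSize (M : Matrix (Fin m) (Fin n) ℕ) : ℕ := (rowWord M).sum + (colWord M).sum

theorem matrixSize_lt {l : ℕ ⊕ ℕ} {M M' : Matrix (Fin m) (Fin n) ℕ}
    (h : (filteredMatrixGraph m n i j).edge l M M') : matrixSize M < matrixSize M' := by
  rcases l with l | l
  · have h := (filteredMatrixGraph_edge_inl.1 h).2
    rw [matrixSize, matrixSize, (step_rowWord h).sum_eq, (knuthEquiv_colWord h).perm.sum_eq]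
    omega
  · have h := (filteredMatrixGraph_edge_inr.1 h).2
    rw [matrixSize, matrixSize, (step_colWord h).sum_eq, (knuthEquiv_rowWord h).perm.sum_eq]
    omega

theorem filteredMatrixGraph_edge_unique {l : ℕ ⊕ ℕ} {M M' M'' : Matrix (Fin m) (Fin n) ℕ}
    (h : (filteredMatrixGraph m n i j).edge l M M')
    (h' : (filteredMatrixGraph m n i j).edge l M M'') : M' = M'' := by
  rcases l with l | l
  · exact Option.some.inj ((filteredMatrixGraph_edge_inl.1 h).2.symm.trans
      (filteredMatrixGraph_edge_inl.1 h').2)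
  · exact Option.some.inj ((filteredMatrixGraph_edge_inr.1 h).2.symm.trans
      (filteredMatrixGraph_edge_inr.1 h').2)

end FilteredRSK

namespace FilteredRSK

variable {m n r s : ℕ} {i : Fin (r + 1) → ℕ} {j : Fin (s + 1) → ℕ}

/-- The sequence `i` is of the form `0 = i 0 < ... < i r = m`. -/
structure IsFlag (i : Fin (r + 1) → ℕ) (m : ℕ) : Prop where
  strictMono : StrictMono i
  zero : i 0 = 0
  last : i (Fin.last r) = m

theorem IsFlag.exists_interior (hi : IsFlag i m) {l : ℕ} (h1 : 1 ≤ l) (h2 : l < m)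
    (hl : l ∉ Set.range i) : ∃ k, Interior i k l :=
  FilteredRSK.exists_interior hi.zero h1 (hi.last ▸ h2) hl

theorem Interior.lt_of_isFlag (hi : IsFlag i m) {k : Fin r} {l : ℕ} (h : Interior i k l) : l < m :=
  hi.last ▸ h.lt_last hi.strictMono

theorem Interior.one_le {k : Fin r} {l : ℕ} (h : Interior i k l) : 1 ≤ l := by
  have := h.1
  omega

/-! ### Filtered RSK is a local isomorphism -/

theorem tupleEdge_filterTableaux (hi : StrictMono i) {k : Fin r} {l : ℕ} (h : Interior i k l)
    {w v : List ℕ} (hs : Step l w v) : TupleEdge l (filterTableaux i w) (filterTableaux i v) :=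
  ⟨k, hs.filterTableaux hi h⟩

theorem isHom_filterRSKVertex (hi : IsFlag i m) (hj : IsFlag j n) :
    PreCrystalGraph.IsHom (filteredMatrixGraph m n i j) (tableauPairSum i j)
      (filterRSKVertex i j) := by
  constructor
  · intro M
    have h1 := weight_filterTableaux hi.strictMono hi.zero (rowWord (m := m) (n := n) M)
    have h2 := weight_filterTableaux hj.strictMono hj.zero (colWord (m := m) (n := n) M)
    rw [hi.last] at h1
    rw [hj.last] at h2
    exact congrArg₂ (· ++ ·) h1 h2
  · rintro (l | l) M M' h
    · obtain ⟨h1, h2⟩ := filteredMatrixGraph_edge_inl.1 h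
      obtain ⟨h3, h4⟩ := lowerRow_bounds h2
      obtain ⟨k, hk⟩ := hi.exists_interior h3 h4 h1
      exact edge_inl_iff.2 ⟨tupleEdge_filterTableaux hi.strictMono hk (step_rowWord h2),
        (knuthEquiv_colWord h2).filterTableaux⟩
    · obtain ⟨h1, h2⟩ := filteredMatrixGraph_edge_inr.1 h
      obtain ⟨h3, h4⟩ := lowerCol_bounds h2
      obtain ⟨k, hk⟩ := hj.exists_interior h3 h4 h1
      exact edge_inr_iff.2 ⟨(knuthEquiv_rowWord h2).filterTableaux,
        tupleEdge_filterTableaux hj.strictMono hk (step_colWord h2)⟩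

/-- An edge changes one side only. On that side it lifts to a step with an interior label, which the
matrix operator realises; on the other side the Knuth class is constant. -/
theorem exists_edge_of_edge (hi : IsFlag i m) (hj : IsFlag j n) (l : ℕ ⊕ ℕ)
    (M : (filteredMatrixGraph m n i j).V) (u : (tableauPairSum i j).V)
    (h : (tableauPairSum i j).edge l (filterRSKVertex i j M) u) :
    ∃ M', (filteredMatrixGraph m n i j).edge l M M' ∧ filterRSKVertex i j M' = u := by
  rcases l with l | l
  · obtain ⟨h1, h2⟩ := edge_inl_iff.1 h
    obtain ⟨k, v, hk, hv, hv'⟩ := TupleEdge.lift hi.strictMono h1 (inBlocks_tableaux_fst u)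
    obtain ⟨M', hM'⟩ := exists_lowerRow hv.phi_pos (hk.lt_of_isFlag hi)
    refine ⟨M', filteredMatrixGraph_edge_inl.2 ⟨hk.not_mem_range hi.strictMono, hM'⟩,
      tableaux_injective (Prod.ext ?_ ?_)⟩
    · rw [← hv', hv.right_unique (step_rowWord hM')]
      rfl
    · exact (knuthEquiv_colWord hM').symm.filterTableaux.trans h2
  · obtain ⟨h1, h2⟩ := edge_inr_iff.1 h
    obtain ⟨k, v, hk, hv, hv'⟩ := TupleEdge.lift hj.strictMono h2 (inBlocks_tableaux_snd u)
    obtain ⟨M', hM'⟩ := exists_lowerCol hv.phi_pos (hk.lt_of_isFlag hj)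
    refine ⟨M', filteredMatrixGraph_edge_inr.2 ⟨hk.not_mem_range hj.strictMono, hM'⟩,
      tableaux_injective (Prod.ext ?_ ?_)⟩
    · exact (knuthEquiv_rowWord hM').symm.filterTableaux.trans h1
    · rw [← hv', hv.right_unique (step_colWord hM')]
      rfl

theorem exists_edge_of_edge_to (hi : IsFlag i m) (hj : IsFlag j n) (l : ℕ ⊕ ℕ)
    (M : (filteredMatrixGraph m n i j).V) (u : (tableauPairSum i j).V)
    (h : (tableauPairSum i j).edge l u (filterRSKVertex i j M)) :
    ∃ M', (filteredMatrixGraph m n i j).edge l M' M ∧ filterRSKVertex i j M' = u := by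
  rcases l with l | l
  · obtain ⟨h1, h2⟩ := edge_inl_iff.1 h
    obtain ⟨k, v, hk, hv, hv'⟩ := TupleEdge.lift_to hi.strictMono h1 (inBlocks_tableaux_fst u)
    obtain ⟨M', hM'⟩ := exists_lowerRow_to hv.eps_pos hk.one_le
    refine ⟨M', filteredMatrixGraph_edge_inl.2 ⟨hk.not_mem_range hi.strictMono, hM'⟩,
      tableaux_injective (Prod.ext ?_ ?_)⟩
    · rw [← hv', hv.left_unique (step_rowWord hM')]
      rfl
    · exact (knuthEquiv_colWord hM').filterTableaux.trans h2.symm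
  · obtain ⟨h1, h2⟩ := edge_inr_iff.1 h
    obtain ⟨k, v, hk, hv, hv'⟩ := TupleEdge.lift_to hj.strictMono h2 (inBlocks_tableaux_snd u)
    obtain ⟨M', hM'⟩ := exists_lowerCol_to hv.eps_pos hk.one_le
    refine ⟨M', filteredMatrixGraph_edge_inr.2 ⟨hk.not_mem_range hj.strictMono, hM'⟩,
      tableaux_injective (Prod.ext ?_ ?_)⟩
    · exact (knuthEquiv_rowWord hM').filterTableaux.trans h1.symm
    · rw [← hv', hv.left_unique (step_colWord hM')]
      rfl

/-! ### Sources -/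

theorem isBlockSource_rowWord (hi : IsFlag i m) {M : (filteredMatrixGraph m n i j).V}
    (h : (filteredMatrixGraph m n i j).IsSource M) :
    IsBlockSource i (rowWord (m := m) (n := n) M) := by
  intro k l hk
  by_contra hne
  obtain ⟨M', hM'⟩ := exists_lowerRow_to (Nat.pos_of_ne_zero hne) hk.one_le
  exact h _ M' (filteredMatrixGraph_edge_inl.2 ⟨hk.not_mem_range hi.strictMono, hM'⟩)

theorem isBlockSource_colWord (hj : IsFlag j n) {M : (filteredMatrixGraph m n i j).V}
    (h : (filteredMatrixGraph m n i j).IsSource M) :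
    IsBlockSource j (colWord (m := m) (n := n) M) := by
  intro k l hk
  by_contra hne
  obtain ⟨M', hM'⟩ := exists_lowerCol_to (Nat.pos_of_ne_zero hne) hk.one_le
  exact h _ M' (filteredMatrixGraph_edge_inr.2 ⟨hk.not_mem_range hj.strictMono, hM'⟩)

/-- The reading word of the tableau of a word. -/
noncomputable def canonicalWord (w : List ℕ) : List ℕ := word (knuthTableau w).2

/-- A column operator changes the row word within its Knuth class, hence is invisible on the
canonical representative, while a row operator remains a crystal step on it. -/
theorem eqvGen_canonicalWord_rowWord (hi : IsFlag i m) {M M' : (filteredMatrixGraph m n i j).V}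
    (h : (filteredMatrixGraph m n i j).Joined M M') :
    Relation.EqvGen (fun u v => ∃ k l, Interior i k l ∧ Step l u v)
      (canonicalWord (rowWord (m := m) (n := n) M))
      (canonicalWord (rowWord (m := m) (n := n) M')) := by
  induction h with
  | rel M M' h =>
    obtain ⟨l | l, h⟩ := h
    · obtain ⟨h1, h2⟩ := filteredMatrixGraph_edge_inl.1 h
      obtain ⟨h3, h4⟩ := lowerRow_bounds h2
      obtain ⟨k, hk⟩ := hi.exists_interior h3 h4 h1
      exact .rel _ _ ⟨k, l, hk, (step_rowWord h2).knuthTableau.1⟩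
    · have h2 := knuthEquiv_rowWord (filteredMatrixGraph_edge_inr.1 h).2
      rw [canonicalWord, canonicalWord, knuthTableau_eq_iff.2 h2]
      exact .refl _
  | refl _ => exact .refl _
  | symm _ _ _ ih => exact .symm _ _ ih
  | trans _ _ _ _ _ ih1 ih2 => exact .trans _ _ _ ih1 ih2

theorem eqvGen_canonicalWord_colWord (hj : IsFlag j n) {M M' : (filteredMatrixGraph m n i j).V}
    (h : (filteredMatrixGraph m n i j).Joined M M') :
    Relation.EqvGen (fun u v => ∃ k l, Interior j k l ∧ Step l u v)
      (canonicalWord (colWord (m := m) (n := n) M))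
      (canonicalWord (colWord (m := m) (n := n) M')) := by
  induction h with
  | rel M M' h =>
    obtain ⟨l | l, h⟩ := h
    · have h2 := knuthEquiv_colWord (filteredMatrixGraph_edge_inl.1 h).2
      rw [canonicalWord, canonicalWord, knuthTableau_eq_iff.2 h2]
      exact .refl _
    · obtain ⟨h1, h2⟩ := filteredMatrixGraph_edge_inr.1 h
      obtain ⟨h3, h4⟩ := lowerCol_bounds h2
      obtain ⟨k, hk⟩ := hj.exists_interior h3 h4 h1
      exact .rel _ _ ⟨k, l, hk, (step_colWord h2).knuthTableau.1⟩
  | refl _ => exact .refl _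
  | symm _ _ _ ih => exact .symm _ _ ih
  | trans _ _ _ _ _ ih1 ih2 => exact .trans _ _ _ ih1 ih2

theorem knuthEquiv_of_eqvGen (hi : IsFlag i m) {w w' : List ℕ}
    (h : Relation.EqvGen (fun u v => ∃ k l, Interior i k l ∧ Step l u v)
      (canonicalWord w) (canonicalWord w'))
    (hw : IsBlockSource i w) (hw' : IsBlockSource i w')
    (hr : ∀ x ∈ w, 1 ≤ x ∧ x ≤ m) (hr' : ∀ x ∈ w', 1 ≤ x ∧ x ≤ m) : KnuthEquiv w w' := by
  have e : canonicalWord w = canonicalWord w' := by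
    refine eq_of_isBlockSource hi.strictMono hi.zero h (fun k l hk => ?_) (fun k l hk => ?_)
      (fun x hx => ?_) fun x hx => ?_
    · rw [canonicalWord, (knuthTableau_spec w).eps_eq, hw k l hk]
    · rw [canonicalWord, (knuthTableau_spec w').eps_eq, hw' k l hk]
    · rw [hi.last]
      exact hr x ((knuthTableau_spec w).perm.mem_iff.1 hx)
    · rw [hi.last]
      exact hr' x ((knuthTableau_spec w').perm.mem_iff.1 hx)
  have h1 := knuthTableau_spec w
  have h2 := knuthTableau_spec w'
  rw [canonicalWord, canonicalWord] at e
  rw [← e] at h2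
  exact h1.symm.trans h2

/-- Being in one component makes even the unfiltered tableaux of the two sources agree, so
injectivity of ordinary RSK applies. -/
theorem source_unique (hi : IsFlag i m) (hj : IsFlag j n) {M M' : (filteredMatrixGraph m n i j).V}
    (h : (filteredMatrixGraph m n i j).Joined M M')
    (hM : (filteredMatrixGraph m n i j).IsSource M)
    (hM' : (filteredMatrixGraph m n i j).IsSource M') : M = M' :=
  eq_of_knuthEquiv (m := m) (n := n)
    (knuthEquiv_of_eqvGen hi (eqvGen_canonicalWord_rowWord hi h) (isBlockSource_rowWord hi hM)
      (isBlockSource_rowWord hi hM') (rowWord_bounds _) (rowWord_bounds _))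
    (knuthEquiv_of_eqvGen hj (eqvGen_canonicalWord_colWord hj h) (isBlockSource_colWord hj hM)
      (isBlockSource_colWord hj hM') (colWord_bounds _) (colWord_bounds _))

/-- Equal images allow raising along equal labels. If `M` is a source then so is `M'`, as an edge
into `M'` would yield one into `M`. -/
theorem filterRSKVertex_injOn (hi : IsFlag i m) (hj : IsFlag j n)
    (M M' : (filteredMatrixGraph m n i j).V) (h : (filteredMatrixGraph m n i j).Joined M M')
    (hF : filterRSKVertex i j M = filterRSKVertex i j M') : M = M' := by
  induction hs : matrixSize (m := m) (n := n) M using Nat.strong_induction_on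
    generalizing M M' with
  | _ k ih =>
    by_cases hM : (filteredMatrixGraph m n i j).IsSource M
    · refine source_unique hi hj h hM fun l u hu => ?_
      have := (isHom_filterRSKVertex hi hj).map_edge l u M' hu
      rw [← hF] at this
      obtain ⟨N, hN, -⟩ := exists_edge_of_edge_to hi hj l M _ this
      exact hM l N hN
    · simp only [PreCrystalGraph.IsSource, not_forall, not_not] at hM
      obtain ⟨l, N, hN⟩ := hM
      have := (isHom_filterRSKVertex hi hj).map_edge l N M hN
      rw [hF] at this
      obtain ⟨N', hN', hF'⟩ := exists_edge_of_edge_to hi hj l M' _ this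
      have e : N = N' := by
        refine ih _ (hs ▸ matrixSize_lt hN) N N' ?_ hF'.symm rfl
        exact .trans _ _ _ (.trans _ _ _ (PreCrystalGraph.Joined.of_edge hN) h)
          (.symm _ _ (PreCrystalGraph.Joined.of_edge hN'))
      subst e
      exact filteredMatrixGraph_edge_unique hN hN'

theorem isLocalIso_filterRSKVertex (hi : IsFlag i m) (hj : IsFlag j n) :
    PreCrystalGraph.IsLocalIso (filteredMatrixGraph m n i j) (tableauPairSum i j)
      (filterRSKVertex i j) :=
  PreCrystalGraph.isLocalIso_of_lift (isHom_filterRSKVertex hi hj)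
    (fun l M u h => exists_edge_of_edge hi hj l M u h)
    (fun l M u h => exists_edge_of_edge_to hi hj l M u h) (filterRSKVertex_injOn hi hj)

/-! ### The components of the direct sum -/

/-- An unmatched `(` for an interior label would allow raising the `k`-th tableau inside its block,
which gives an edge into `u`. -/
theorem source_filteredTableauGraph {lam : PartitionTuple i} {u : (filteredTableauGraph i lam).V}
    (h : ∀ l u', ¬ (filteredTableauGraph i lam).edge l u' u) (k : Fin r) :
    (u k).1 = highestTableau (lam k).1 (i k.castSucc + 1) := by
  have hblock : ∀ x ∈ word (u k).1, i k.castSucc + 1 ≤ x ∧ x ≤ i k.succ := by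
    intro x hx
    obtain ⟨a, b, h, rfl⟩ := mem_word_iff.1 hx
    exact (u k).2 a b h
  have := eq_highest_of_eps (T := ⟨(lam k).1, (u k).1⟩) hblock fun l hl => by
    by_contra hne
    obtain ⟨v, hv⟩ := exists_step_of_eps_pos (Nat.pos_of_ne_zero hne)
    obtain ⟨U, rfl⟩ := exists_word_eq_of_step_to hv
    have hU : ∀ x y, (x, y) ∈ (lam k).1 → i k.castSucc + 1 ≤ U x y ∧ U x y ≤ i k.succ := by
      intro x y hxy
      have hm : U x y ∈ word U := mem_word_iff.2 ⟨x, y, hxy, rfl⟩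
      obtain ⟨w₁, w₂, h1, h2, -, -⟩ := hv
      rw [h1, List.mem_append, List.mem_cons] at hm
      have h2' : word (u k).1 = w₁ ++ (l + 1) :: w₂ := h2
      obtain ⟨hl1, hl2⟩ := hl
      rcases hm with hm | hm | hm
      · exact hblock _ (h2' ▸ by simp [hm])
      · omega
      · exact hblock _ (h2' ▸ by simp [hm])
    let u' : (filteredTableauGraph i lam).V := fun k' =>
      if hk : k' = k then hk ▸ (⟨U, hU⟩ : SSYT (lam k).1 (i k.castSucc + 1) (i k.succ)) else u k'
    have hu' : u' k = ⟨U, hU⟩ := dif_pos rfl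
    refine h l u' (filteredTableauGraph_edge_iff.2 ⟨k, ?_, fun k' hk => dif_neg hk⟩)
    rw [hu']
    exact hv
  exact eq_of_heq (Sigma.mk.inj this).2

theorem fst_eq_of_joined {v w : (tableauPairSum i j).V} (h : (tableauPairSum i j).Joined v w) :
    v.1 = w.1 := by
  induction h with
  | rel _ _ h => exact tableauPairSum_edge_fst h.choose_spec
  | refl _ => rfl
  | symm _ _ _ ih => exact ih.symm
  | trans _ _ _ _ _ ih1 ih2 => exact ih1.trans ih2

/-- Entry sums increase along edges, so every vertex is joined to a source of its summand, and there
is only one. -/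
theorem joined_tableauPairSum {v w : (tableauPairSum i j).V} (h : v.1 = w.1) :
    (tableauPairSum i j).Joined v w := by
  have hsize : ∀ l (a b : (tableauPairSum i j).V), (tableauPairSum i j).edge l a b →
      (∑ k, (word ((tableaux i j a).1 k).2).sum) + ∑ k, (word ((tableaux i j a).2 k).2).sum <
      (∑ k, (word ((tableaux i j b).1 k).2).sum) + ∑ k, (word ((tableaux i j b).2 k).2).sum := by
    have key : ∀ {t : ℕ} {l : ℕ} {P Q : Fin t → AnyTableau}, TupleEdge l P Q →
        ∑ k, (word (P k).2).sum < ∑ k, (word (Q k).2).sum := by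
      rintro t l P Q ⟨k, h1, -, h2⟩
      refine Finset.sum_lt_sum (fun k' _ => ?_) ⟨k, Finset.mem_univ k, by have := h1.sum_eq; omega⟩
      by_cases hk : k' = k
      · subst hk
        have := h1.sum_eq
        omega
      · rw [h2 k' hk]
    rintro (l | l) a b hab
    · obtain ⟨h1, h2⟩ := edge_inl_iff.1 hab
      have := key h1
      rw [h2]
      omega
    · obtain ⟨h1, h2⟩ := edge_inr_iff.1 hab
      have := key h2
      rw [h1]
      omega
  obtain ⟨v', hv, hv'⟩ := PreCrystalGraph.exists_joined_source _ hsize v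
  obtain ⟨w', hw, hw'⟩ := PreCrystalGraph.exists_joined_source _ hsize w
  have hsource : ∀ a b : (tableauPairSum i j).V, (tableauPairSum i j).IsSource a →
      (tableauPairSum i j).IsSource b → a.1 = b.1 → a = b := by
    rintro ⟨x, a, a'⟩ ⟨y, b, b'⟩ ha hb hxy
    obtain rfl : x = y := hxy
    have e1 : a = b := funext fun k => Subtype.ext
      ((source_filteredTableauGraph (fun l u hu => ha (Sum.inl l) ⟨x, u, a'⟩
        (directSum_edge_iff.2 ⟨hu, rfl⟩)) k).trans
      (source_filteredTableauGraph (fun l u hu => hb (Sum.inl l) ⟨x, u, b'⟩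
        (directSum_edge_iff.2 ⟨hu, rfl⟩)) k).symm)
    have e2 : a' = b' := funext fun k => Subtype.ext
      ((source_filteredTableauGraph (fun l u hu => ha (Sum.inr l) ⟨x, a, u⟩
        (directSum_edge_iff.2 ⟨rfl, hu⟩)) k).trans
      (source_filteredTableauGraph (fun l u hu => hb (Sum.inr l) ⟨x, b, u⟩
        (directSum_edge_iff.2 ⟨rfl, hu⟩)) k).symm)
    rw [e1, e2]
  have e := hsource v' w' hv' hw' (by rw [← fst_eq_of_joined hv, ← fst_eq_of_joined hw, h])
  subst e
  exact .trans _ _ _ hv (.symm _ _ hw)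

/-- Each summand of the direct sum is a component. -/
theorem nonempty_iso_induce (v : (tableauPairSum i j).V) :
    Nonempty (PreCrystalGraph.Iso (tableauPairGraph i j v.1)
      ((tableauPairSum i j).induce {w | (tableauPairSum i j).Joined v w})) := by
  let f : (tableauPairGraph i j v.1).V →
      ((tableauPairSum i j).induce {w | (tableauPairSum i j).Joined v w}).V :=
    fun u => ⟨⟨v.1, u⟩, joined_tableauPairSum rfl⟩
  refine ⟨PreCrystalGraph.Iso.ofBijective f ⟨?_, ?_⟩ ⟨fun u => rfl, fun l u u' h => ?_⟩ ?_⟩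
  · intro u u' h
    exact eq_of_heq (Sigma.mk.inj (congrArg Subtype.val h)).2
  · rintro ⟨⟨x, u⟩, h⟩
    obtain rfl : v.1 = x := fst_eq_of_joined h
    exact ⟨u, rfl⟩
  · exact directSum_edge_iff.2 h
  · exact fun l u u' h => directSum_edge_iff.1 h

theorem filterRSK_of_isSource (hi : IsFlag i m) (hj : IsFlag j n)
    {M : (filteredMatrixGraph m n i j).V} (hM : (filteredMatrixGraph m n i j).IsSource M) :
    filterRSK i j (m := m) (n := n) M = highestTuple i j (filterRSKVertex i j M).1.1
      (filterRSKVertex i j M).1.2 :=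
  Prod.ext (funext fun k => (isBlockSource_rowWord hi hM).filterTableaux k)
    (funext fun k => (isBlockSource_colWord hj hM).filterTableaux k)

end FilteredRSK

/-! ### The main theorem -/

theorem proposition5 (m n r s : ℕ) (i : Fin (r + 1) → ℕ) (j : Fin (s + 1) → ℕ)
    (hi : StrictMono i) (hi_zero : i 0 = 0) (hi_last : i (Fin.last r) = m)
    (hj : StrictMono j) (hj_zero : j 0 = 0) (hj_last : j (Fin.last s) = n) :
    -- filtered RSK is well defined
    (∀ (M : Matrix (Fin m) (Fin n) ℕ) T,
      FilteredRSK.IsFilterRSK i j M T ↔ T = FilteredRSK.filterRSK i j M) ∧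
    -- filtered RSK takes its values in the vertices of the direct sum, and is a local isomorphism
    (∃ F : (FilteredRSK.filteredMatrixGraph m n i j).V → (FilteredRSK.tableauPairSum i j).V,
      (∀ M, FilteredRSK.tableaux i j (F M) = FilteredRSK.filterRSK i j M) ∧
      FilteredRSK.PreCrystalGraph.IsLocalIso
        (FilteredRSK.filteredMatrixGraph m n i j) (FilteredRSK.tableauPairSum i j) F) ∧
    -- every component has a unique source, which is mapped to a highest-weight tableau-tuple
    (∀ C, (FilteredRSK.filteredMatrixGraph m n i j).IsComponent C →
      ∃ M ∈ C, (FilteredRSK.filteredMatrixGraph m n i j).IsSource M ∧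
        (∀ M' ∈ C, (FilteredRSK.filteredMatrixGraph m n i j).IsSource M' → M' = M) ∧
        ∃ lam mu, FilteredRSK.filterRSK i j M = FilteredRSK.highestTuple i j lam mu ∧
          Nonempty (FilteredRSK.PreCrystalGraph.Iso
            ((FilteredRSK.filteredMatrixGraph m n i j).induce C)
            (FilteredRSK.tableauPairGraph i j (lam, mu)))) := by
  have hI : FilteredRSK.IsFlag i m := ⟨hi, hi_zero, hi_last⟩
  have hJ : FilteredRSK.IsFlag j n := ⟨hj, hj_zero, hj_last⟩
  have hiso := FilteredRSK.isLocalIso_filterRSKVertex hI hJ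
  refine ⟨FilteredRSK.isFilterRSK_iff, ⟨FilteredRSK.filterRSKVertex i j,
    FilteredRSK.tableaux_filterRSKVertex, hiso⟩, ?_⟩
  rintro _ ⟨N, rfl⟩
  obtain ⟨M, hNM, hM⟩ := FilteredRSK.PreCrystalGraph.exists_joined_source
    (G := FilteredRSK.filteredMatrixGraph m n i j) (FilteredRSK.matrixSize (m := m) (n := n))
    (fun _ _ _ h => FilteredRSK.matrixSize_lt h) N
  refine ⟨M, hNM, hM, fun M' hM' hs => FilteredRSK.source_unique hI hJ
    (.trans _ _ _ (.symm _ _ hM') hNM) hs hM, _, _, FilteredRSK.filterRSK_of_isSource hI hJ hM, ?_⟩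
  -- The image of the component is an entire summand. Its base vertex `v` is arbitrary, but its
  -- index equals that of the image of `M`.
  obtain ⟨C', ⟨v, rfl⟩, e, he⟩ := hiso.2 _ ⟨N, rfl⟩
  have hv := he ⟨M, hNM⟩
  have hvM : (FilteredRSK.tableauPairSum i j).Joined v (FilteredRSK.filterRSKVertex i j M) :=
    hv ▸ (e.toEquiv ⟨M, hNM⟩).2
  obtain ⟨e'⟩ := FilteredRSK.nonempty_iso_induce v
  have h1 := FilteredRSK.fst_eq_of_joined hvM
  have e'' := e.trans e'.symm
  rw [h1] at e''
  exact ⟨e''⟩
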